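/- The following is provable in $\mathsf{ATR_0^{set}}$ (equivalently, it holds in every model of this theory). Let $\lambda$ be a limit ordinal, let $(D_\alpha)_{\alpha<\lambda}$ be a family of dilators (given as a set), and let $\gamma$ be an ordinal. If $(\sum_{\alpha<\mu}D_\alpha)^\gamma$ has a $\psi$-fixed point for every $\mu<\lambda$, then the supremum of these $\psi$-fixed points exists and is the (unique) $\psi$-fixed point of $(\sum_{\alpha<\lambda}D_\alpha)^\gamma$, i.e. $$\psi\Big(\sum_{\alpha<\lambda}D_\alpha\Big)^\gamma=\sup_{\mu<\lambda}\psi\Big(\sum_{\alpha<\mu}D_\alpha\Big)^\gamma .$$ Here the notions are as follows. * $\mathsf{ATR_0^{set}}$ has the language with $\in$, $=$ and a function symbol for each construction of a primitive recursive set function (with $\omega$ as an additional constant). Its axioms are the defining axioms of these symbols, extensionality, foundation (every non-empty set has an $\in$-minimal element), infinity, axiom beta (for every well-founded relation $r$ there is a function $f$ on the field of $r$ with $f(y)=\{f(x)\mid(x,y)\in r\}$), and countability (every set admits an injection into $\omega$). * A predilator is a functor $D$ from the category of the finite orders $n=\{0,\dots,n-1\}$ and strictly increasing maps to the category of linear orders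 and embeddings, which is monotone ($f\le g$ pointwise implies $D(f)\le D(g)$ pointwise), together with a natural transformation $\operatorname{supp}_n:D(n)\to[n]^{<\omega}$ such that, for every $f:m\to n$ and $\sigma\in D(n)$, $\operatorname{supp}_n(\sigma)\subseteq\operatorname{rng}(f)$ implies $\sigma\in\operatorname{rng}(D(f))$. * A predilator extends to all linear orders $X$: the elements of $D(X)$ are the pairs $(\sigma,a)$ with $a\subseteq X$ finite, $\sigma\in D(|a|)$ and $\operatorname{supp}_{|a|}(\sigma)=|a|$. We have $(\sigma,a)<(\tau,b)$ iff $D(f)(\sigma)<D(g)(\tau)$ in $D(|a\cup b|)$, where $f:|a|\to|a\cup b|$ and $g:|b|\to|a\cup b|$ correspond to the inclusions of $a$ and $b$ into $a\cup b$. The action on an embedding $h$ is $(\sigma,a)\mapsto(\sigma,h[a])$, and the support of $(\sigma,a)$ is $a$. A dilator is a predilator $D$ such that $D(X)$ is well-founded for every well order $X$. * The sum $\sum_{\alpha<\mu}D_\alpha$ has as elements at $n$ the pairs $(\alpha,\sigma)$ with $\alpha<\mu$ and $\sigma\in D_\alpha(n)$, ordered lexicographically (first by $\alpha$), with $(\alpha,\sigma)\mapsto(\alpha,D_\alpha(f)(\sigma))$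 as action on $f$ and with the support of $\sigma$ as support of $(\alpha,\sigma)$. * $D^\gamma$ is given by $D^\gamma(n)=D(\gamma+n)$ and $D^\gamma(f)=D(\gamma+f)$, where the support of $(\sigma,a)\in D(\gamma+n)$ is $\{i<n\mid\gamma+i\in a\}$. * An ordinal $\Omega$ is a $\psi$-fixed point of a predilator $D$ if there is an order embedding $\pi:\Omega\to D(\Omega)$ such that for all $\alpha,\beta<\Omega$ and $\tau\in D(\Omega)$: if $\alpha\in\operatorname{supp}_\Omega(\pi(\beta))$ then $\alpha<\beta$; and if $\pi(\alpha)<\tau$ for all $\alpha\in\operatorname{supp}_\Omega(\tau)$, then $\tau\in\operatorname{rng}(\pi)$. A dilator $D$ has at most one $\psi$-fixed point; it is denoted by $\psi D$ if it exists. -/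

import Mathlib

universe u

namespace ATRSet

/-- Function symbols for the primitive recursive set functions (with parameter `ω`), one for each
construction of such a function; `PRFun n` contains the symbols of arity `n`. -/
inductive PRFun : ℕ → Type
  /-- `x ↦ 0` -/
  | zero : PRFun 1
  /-- `(x₀, …, xₙ₋₁) ↦ xᵢ` -/
  | proj {n : ℕ} (i : Fin n) : PRFun n
  /-- `(x₀, x₁) ↦ x₀ ∪ {x₁}` -/
  | adjoin : PRFun 2
  /-- `(x₀, x₁, x₂, x₃) ↦ x₀` if `x₂ ∈ x₃`, and `x₁` otherwise -/
  | cond : PRFun 4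
  /-- the constant `ω` -/
  | omega : PRFun 0
  /-- `x ↦ F (G₀ x, …, Gₘ₋₁ x)` -/
  | comp {m n : ℕ} (F : PRFun m) (G : Fin m → PRFun n) : PRFun n
  /-- `R (x, y) = H (⋃ {R (v, y) | v ∈ x}, x, y)` -/
  | recursion {n : ℕ} (H : PRFun (n + 2)) : PRFun (n + 1)

/-- Structures for the language with a binary relation symbol `∈` and the function symbols
`PRFun`. -/
class SetStructure (M : Type u) where
  mem : M → M → Prop
  fn : ∀ {n : ℕ}, PRFun n → (Fin n → M) → M

infix:50 " ∈ᴹ " => SetStructure.mem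

section

variable {M : Type u} [SetStructure M]

/-! ### Terms and basic set theoretic notions inside a structure -/

/-- The set `ω`. -/
def om : M := SetStructure.fn PRFun.omega ![]

/-- The empty set. -/
def empty : M := SetStructure.fn PRFun.zero ![om]

/-- `x ∪ {y}` -/
def adj (x y : M) : M := SetStructure.fn PRFun.adjoin ![x, y]

/-- `{x, y}` -/
def upair (x y : M) : M := adj (adj empty x) y

/-- The ordered pair `⟨x, y⟩ = {{x}, {x, y}}`. -/
def pair (x y : M) : M := upair (upair x x) (upair x y)

open Classical in
/-- The value `f(x)` of a function `f` (a set of ordered pairs); the empty set if there is no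
unique value. -/
noncomputable def app (f x : M) : M :=
  if h : ∃! y, pair x y ∈ᴹ f then h.choose else empty

/-- `f` is (the graph of) a function with domain `A`. -/
def IsFunOn (f A : M) : Prop :=
  (∀ p, p ∈ᴹ f → ∃ x y, x ∈ᴹ A ∧ p = pair x y) ∧ ∀ x, x ∈ᴹ A → ∃! y, pair x y ∈ᴹ f

/-- The relation `r` (a set of ordered pairs) is well-founded: any non-empty set has an
`r`-minimal element. -/
def WFRel (r : M) : Prop :=
  ∀ s, (∃ x, x ∈ᴹ s) → ∃ y, y ∈ᴹ s ∧ ∀ x, x ∈ᴹ s → ¬ pair x y ∈ᴹ r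

end

/-! ### The theory -/

/-- `M` is a model of `ATR₀^set`, that is, of primitive recursive set theory with infinity
(defining axioms for all function symbols, extensionality, foundation, infinity), axiom beta, and
the axiom of countability. -/
structure ModelsATR0Set (M : Type u) [SetStructure M] : Prop where
  fn_zero : ∀ (v : Fin 1 → M) (z : M), ¬ z ∈ᴹ SetStructure.fn PRFun.zero v
  fn_proj : ∀ {n : ℕ} (i : Fin n) (v : Fin n → M), SetStructure.fn (PRFun.proj i) v = v i
  fn_adjoin : ∀ (v : Fin 2 → M) (z : M),
    z ∈ᴹ SetStructure.fn PRFun.adjoin v ↔ z ∈ᴹ v 0 ∨ z = v 1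
  fn_cond_pos : ∀ v : Fin 4 → M, v 2 ∈ᴹ v 3 → SetStructure.fn PRFun.cond v = v 0
  fn_cond_neg : ∀ v : Fin 4 → M, ¬ v 2 ∈ᴹ v 3 → SetStructure.fn PRFun.cond v = v 1
  fn_comp : ∀ {m n : ℕ} (F : PRFun m) (G : Fin m → PRFun n) (v : Fin n → M),
    SetStructure.fn (PRFun.comp F G) v
      = SetStructure.fn F (fun i => SetStructure.fn (G i) v)
  fn_recursion : ∀ {n : ℕ} (H : PRFun (n + 2)) (x : M) (y : Fin n → M), ∃ w : M,
    (∀ z, z ∈ᴹ w ↔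
      ∃ v, v ∈ᴹ x ∧ z ∈ᴹ SetStructure.fn (PRFun.recursion H) (Fin.cons v y : Fin (n + 1) → M)) ∧
    SetStructure.fn (PRFun.recursion H) (Fin.cons x y : Fin (n + 1) → M)
      = SetStructure.fn H (Fin.cons w (Fin.cons x y : Fin (n + 1) → M) : Fin (n + 2) → M)
  extensionality : ∀ x y : M, (∀ z, z ∈ᴹ x ↔ z ∈ᴹ y) → x = y
  foundation : ∀ x : M, (∃ y, y ∈ᴹ x) → ∃ y, y ∈ᴹ x ∧ ∀ z, z ∈ᴹ x → ¬ z ∈ᴹ y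
  infinity : ∀ n : M, n ∈ᴹ om ↔ n = empty ∨ ∃ m, m ∈ᴹ om ∧ n = adj m m
  beta : ∀ r : M, WFRel r → ∃ A f : M,
    (∀ x, x ∈ᴹ A ↔ ∃ y, pair x y ∈ᴹ r ∨ pair y x ∈ᴹ r) ∧ IsFunOn f A ∧
    ∀ y, y ∈ᴹ A → ∀ z, z ∈ᴹ app f y ↔ ∃ x, pair x y ∈ᴹ r ∧ z = app f x
  countability : ∀ x : M, ∃ g : M, IsFunOn g x ∧ (∀ y, y ∈ᴹ x → app g y ∈ᴹ om) ∧
    ∀ y z, y ∈ᴹ x → z ∈ᴹ x → app g y = app g z → y = z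

section

variable {M : Type u} [SetStructure M]

/-! ### Ordinals -/

/-- `x` is a transitive set. -/
def IsTransSet (x : M) : Prop := ∀ y, y ∈ᴹ x → ∀ z, z ∈ᴹ y → z ∈ᴹ x

/-- `x` is an ordinal: a transitive set of transitive sets. -/
def IsOrd (x : M) : Prop := IsTransSet x ∧ ∀ y, y ∈ᴹ x → IsTransSet y

/-- `x` is a limit ordinal (in particular, `x` is not zero). -/
def IsLimitOrd (x : M) : Prop :=
  IsOrd x ∧ (∃ y, y ∈ᴹ x) ∧ ∀ y, y ∈ᴹ x → ∃ z, z ∈ᴹ x ∧ y ∈ᴹ z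

/-- `α ≤ β` for ordinals. -/
def OrdLe (α β : M) : Prop := α ∈ᴹ β ∨ α = β

/-- The ordinal `Ω` is the supremum of the class `C` of ordinals. -/
def IsOrdSup (C : M → Prop) (Ω : M) : Prop :=
  IsOrd Ω ∧ (∀ β, C β → OrdLe β Ω) ∧ ∀ Ω', IsOrd Ω' → (∀ β, C β → OrdLe β Ω') → OrdLe Ω Ω'

/-! ### Orders -/

end

/-- The data of a (strict) order, given by definable classes of elements of `M`. -/
structure ClassOrder (M : Type u) where
  mem : M → Prop
  lt : M → M → Prop

section

variable {M : Type u} [SetStructure M]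

/-- A set `X` with order relation `R` (a set of ordered pairs). -/
def setOrder (X R : M) : ClassOrder M where
  mem x := x ∈ᴹ X
  lt x y := pair x y ∈ᴹ R

/-- An ordinal as an order. In particular this covers `n = {0, …, n - 1}` for `n ∈ ω`. -/
def ordOrder (α : M) : ClassOrder M where
  mem x := x ∈ᴹ α
  lt x y := x ∈ᴹ y

/-- The order sum `X + Y`. An element `x` of the left summand is represented by `⟨0, x⟩`, and the
element `X + y` for `y` in `Y` by `⟨1, y⟩` with `1 = {0}`. -/
def ClassOrder.add (X Y : ClassOrder M) : ClassOrder M where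
  mem z := (∃ x, X.mem x ∧ z = pair empty x) ∨ (∃ y, Y.mem y ∧ z = pair (adj empty empty) y)
  lt z w :=
    (∃ x x', z = pair empty x ∧ w = pair empty x' ∧ X.lt x x') ∨
    (∃ x y, z = pair empty x ∧ w = pair (adj empty empty) y) ∨
    (∃ y y', z = pair (adj empty empty) y ∧ w = pair (adj empty empty) y' ∧ Y.lt y y')

/-- `X` is a (strict) linear order. -/
def ClassOrder.IsLinear (X : ClassOrder M) : Prop :=
  (∀ x, X.mem x → ¬ X.lt x x) ∧
  (∀ x y z, X.mem x → X.mem y → X.mem z → X.lt x y → X.lt y z → X.lt x z) ∧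
  (∀ x y, X.mem x → X.mem y → X.lt x y ∨ x = y ∨ X.lt y x)

/-- `X` is well-founded in the sense of `M`: any non-empty subset of `X` that is an element of `M`
has a minimal element. -/
def ClassOrder.IsWF (X : ClassOrder M) : Prop :=
  ∀ s : M, (∃ x, x ∈ᴹ s) → (∀ x, x ∈ᴹ s → X.mem x) →
    ∃ y, y ∈ᴹ s ∧ ∀ x, x ∈ᴹ s → ¬ X.lt x y

/-- `a` is a finite subset of `X` with `n ∈ ω` elements, and `e` is the increasing enumeration
`en_a : n → a`. -/
def Enum (X : ClassOrder M) (a n e : M) : Prop :=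
  n ∈ᴹ om ∧ IsFunOn e n ∧
  (∀ x, x ∈ᴹ a → X.mem x) ∧
  (∀ x, x ∈ᴹ a ↔ ∃ i, i ∈ᴹ n ∧ x = app e i) ∧
  ∀ i j, i ∈ᴹ n → j ∈ᴹ n → i ∈ᴹ j → X.lt (app e i) (app e j)

/-- `f : m → n` is a morphism of the category `Nat`, i.e. `m, n ∈ ω` and `f` is strictly
increasing. -/
def NatHom (m n f : M) : Prop :=
  m ∈ᴹ om ∧ n ∈ᴹ om ∧ IsFunOn f m ∧ (∀ i, i ∈ᴹ m → app f i ∈ᴹ n) ∧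
  ∀ i j, i ∈ᴹ m → j ∈ᴹ m → i ∈ᴹ j → app f i ∈ᴹ app f j

/-- For finite `a ⊆ b` in `X` with `|a| = m` and `|b| = n`, the morphism `f : m → n` is
`|ι|` for the inclusion `ι : a → b`, i.e. we have `en_b ∘ f = en_a`. -/
def InclHom (X : ClassOrder M) (a b m n f : M) : Prop :=
  NatHom m n f ∧ ∃ e e', Enum X a m e ∧ Enum X b n e' ∧
    ∀ i, i ∈ᴹ m → app e' (app f i) = app e i

/-! ### Predilators and dilators -/

end

/-- The data of a predilator `D : Nat → LO` with support functions:
* `El n σ` says that `σ` is an element of `D(n)`,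
* `lt n σ τ` says that `σ < τ` holds in `D(n)`,
* `map m n f σ τ` says that `D(f)(σ) = τ` holds for the morphism `f : m → n`,
* `supp n σ i` says that `i` lies in `supp_n(σ)`.
The values matter only for `n ∈ ω`, morphisms `f : m → n` and elements `σ` of `D(n)` or `D(m)`. -/
structure Predil (M : Type u) where
  El : M → M → Prop
  lt : M → M → M → Prop
  map : M → M → M → M → M → Prop
  supp : M → M → M → Prop

section

variable {M : Type u} [SetStructure M]

namespace Predil

/-- The linear order `D(n)`. -/
def ob (D : Predil M) (n : M) : ClassOrder M where
  mem := D.El n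
  lt := D.lt n

/-- `D` is a predilator: a monotone functor from `Nat` to linear orders with a natural
transformation `supp` to finite powersets that validates the support condition. -/
structure IsPredilator (D : Predil M) : Prop where
  linear : ∀ n, n ∈ᴹ om → (D.ob n).IsLinear
  map_fun : ∀ m n f σ, NatHom m n f → D.El m σ → ∃! τ, D.map m n f σ τ
  map_mem : ∀ m n f σ τ, NatHom m n f → D.El m σ → D.map m n f σ τ → D.El n τ
  map_lt : ∀ m n f σ σ' τ τ', NatHom m n f → D.El m σ → D.El m σ' →
    D.map m n f σ τ → D.map m n f σ' τ' → D.lt m σ σ' → D.lt n τ τ'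
  map_id : ∀ n f σ, NatHom n n f → (∀ i, i ∈ᴹ n → app f i = i) → D.El n σ → D.map n n f σ σ
  map_comp : ∀ k m n f g h ρ σ τ, NatHom k m f → NatHom m n g → NatHom k n h →
    (∀ i, i ∈ᴹ k → app h i = app g (app f i)) → D.El k ρ →
    D.map k m f ρ σ → D.map m n g σ τ → D.map k n h ρ τ
  monotone : ∀ m n f g σ τ τ', NatHom m n f → NatHom m n g →
    (∀ i, i ∈ᴹ m → OrdLe (app f i) (app g i)) → D.El m σ →
    D.map m n f σ τ → D.map m n g σ τ' → D.lt n τ τ' ∨ τ = τ'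
  supp_sub : ∀ n σ i, n ∈ᴹ om → D.El n σ → D.supp n σ i → i ∈ᴹ n
  supp_nat : ∀ m n f σ τ, NatHom m n f → D.El m σ → D.map m n f σ τ →
    ∀ j, D.supp n τ j ↔ ∃ i, D.supp m σ i ∧ app f i = j
  supp_cond : ∀ m n f τ, NatHom m n f → D.El n τ →
    (∀ j, D.supp n τ j → ∃ i, i ∈ᴹ m ∧ app f i = j) → ∃ σ, D.El m σ ∧ D.map m n f σ τ

/-- `(σ, n)` lies in the trace of `D`. -/
def Tr (D : Predil M) (σ n : M) : Prop :=
  n ∈ᴹ om ∧ D.El n σ ∧ ∀ i, i ∈ᴹ n → D.supp n σ i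

/-- The extension of `D` to arbitrary linear orders `X`: the elements of `D(X)` are the pairs
`⟨σ, a⟩` for a finite subset `a` of `X` such that `(σ, |a|)` lies in the trace of `D`, and we have
`⟨σ, a⟩ < ⟨τ, b⟩` if `D(|ι_a|)(σ) < D(|ι_b|)(τ)` holds in `D(|c|)` with `c = a ∪ b`, for the
inclusions `ι_a : a → c` and `ι_b : b → c`. -/
def ext (D : Predil M) (X : ClassOrder M) : ClassOrder M where
  mem p := ∃ σ a n e, p = pair σ a ∧ Enum X a n e ∧ D.Tr σ n
  lt p q := ∃ σ a τ b, p = pair σ a ∧ q = pair τ b ∧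
    ∃ c k m n f g σ' τ', (∀ x, x ∈ᴹ c ↔ x ∈ᴹ a ∨ x ∈ᴹ b) ∧
      InclHom X a c k n f ∧ InclHom X b c m n g ∧
      D.map k n f σ σ' ∧ D.map m n g τ τ' ∧ D.lt n σ' τ'

/-- The action of the extended functor on an embedding `F` (given by its graph), which maps
`⟨σ, a⟩` to `⟨σ, F[a]⟩`: here `extMap F p q` says that `q` is the value on `p`. -/
def extMap (F : M → M → Prop) (p q : M) : Prop :=
  ∃ σ a b, p = pair σ a ∧ q = pair σ b ∧ ∀ y, y ∈ᴹ b ↔ ∃ x, x ∈ᴹ a ∧ F x y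

/-- The support `a` of an element `⟨σ, a⟩` of `D(X)`: here `extSupp p x` says that `x` is an
element of the support of `p`. -/
def extSupp (p x : M) : Prop := ∃ σ a, p = pair σ a ∧ x ∈ᴹ a

/-- `D` is a dilator: a predilator such that `D(X)` is well-founded for any well order `X`. -/
def IsDilator (D : Predil M) : Prop :=
  D.IsPredilator ∧ ∀ X R : M, (setOrder X R).IsLinear → (setOrder X R).IsWF →
    (D.ext (setOrder X R)).IsWF

/-- The sum `∑_{α ∈ L} D_α`. -/
def sum (L : ClassOrder M) (D : M → Predil M) : Predil M where
  El n p := ∃ α σ, p = pair α σ ∧ L.mem α ∧ (D α).El n σ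
  lt n p q := ∃ α σ β τ, p = pair α σ ∧ q = pair β τ ∧ L.mem α ∧ L.mem β ∧
    (L.lt α β ∨ (α = β ∧ (D α).lt n σ τ))
  map m n f p q := ∃ α σ τ, p = pair α σ ∧ q = pair α τ ∧ L.mem α ∧ (D α).map m n f σ τ
  supp n p i := ∃ α σ, p = pair α σ ∧ L.mem α ∧ (D α).supp n σ i

/-- The graph of the function `γ + f : γ + m → γ + n` for `f : m → n`. -/
def addMap (γ m f x y : M) : Prop :=
  (∃ z, z ∈ᴹ γ ∧ x = pair empty z ∧ y = pair empty z) ∨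
  (∃ i, i ∈ᴹ m ∧ x = pair (adj empty empty) i ∧ y = pair (adj empty empty) (app f i))

/-- The predilator `D^γ` with `D^γ(n) = D(γ + n)` and `D^γ(f) = D(γ + f)`, where the support of
`⟨σ, a⟩` in `D^γ(n)` consists of those `i < n` such that the element `γ + i` lies in `a`. -/
def shift (D : Predil M) (γ : M) : Predil M where
  El n p := (D.ext ((ordOrder γ).add (ordOrder n))).mem p
  lt n p q := (D.ext ((ordOrder γ).add (ordOrder n))).lt p q
  map m _ f p q := extMap (addMap γ m f) p q
  supp n p i := i ∈ᴹ n ∧ extSupp p (pair (adj empty empty) i)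

/-- The ordinal `Ω` is a `ψ`-fixed point of `D`. -/
def IsPsiFixedPoint (D : Predil M) (Ω : M) : Prop :=
  IsOrd Ω ∧ ∃ π : M, IsFunOn π Ω ∧
    (∀ α, α ∈ᴹ Ω → (D.ext (ordOrder Ω)).mem (app π α)) ∧
    (∀ α β, α ∈ᴹ Ω → β ∈ᴹ Ω → α ∈ᴹ β → (D.ext (ordOrder Ω)).lt (app π α) (app π β)) ∧
    (∀ α β, α ∈ᴹ Ω → β ∈ᴹ Ω → extSupp (app π β) α → α ∈ᴹ β) ∧
    (∀ τ, (D.ext (ordOrder Ω)).mem τ →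
      (∀ α, extSupp τ α → (D.ext (ordOrder Ω)).lt (app π α) τ) →
      ∃ β, β ∈ᴹ Ω ∧ app π β = τ)

/-- The element `⟨⟨E, L⟩, ⟨F, S⟩⟩` of `M`, which codes a predilator. -/
def code (E L F S : M) : M := pair (pair E L) (pair F S)

/-- The predilator that is coded by the set `d = ⟨⟨E, L⟩, ⟨F, S⟩⟩`, where
* `E` contains the pairs `⟨n, σ⟩` with `σ` in `D(n)`,
* `L` contains the triples `⟨n, ⟨σ, τ⟩⟩` with `σ < τ` in `D(n)`,
* `F` contains the tuples `⟨⟨⟨m, n⟩, f⟩, ⟨σ, τ⟩⟩` with `D(f)(σ) = τ`,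
* `S` contains the triples `⟨n, ⟨σ, i⟩⟩` with `i` in `supp_n(σ)`. -/
def ofCode (d : M) : Predil M where
  El n σ := ∃ E L F S, d = code E L F S ∧ pair n σ ∈ᴹ E
  lt n σ τ := ∃ E L F S, d = code E L F S ∧ pair n (pair σ τ) ∈ᴹ L
  map m n f σ τ := ∃ E L F S, d = code E L F S ∧ pair (pair (pair m n) f) (pair σ τ) ∈ᴹ F
  supp n σ i := ∃ E L F S, d = code E L F S ∧ pair n (pair σ i) ∈ᴹ S

/-- The element `d` of `M` is (a code of) a dilator in the sense of `M`. -/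
def IsDilatorCode (d : M) : Prop :=
  (∃ E L F S, d = code E L F S) ∧ (ofCode d).IsDilator

/-- For a family `D` of dilators, i.e. a function in `M` with codes of dilators as values, this is
the predilator `(∑_{α < μ} D_α)^γ`. -/
noncomputable def shiftedSum (D μ γ : M) : Predil M :=
  (sum (ordOrder μ) (fun α => ofCode (app D α))).shift γ

end Predil

end

end ATRSet

namespace ATRSet

universe v w

set_option linter.unusedSectionVars false

/-! Write `E μ` for the shifted partial sum of length `μ` and `D` for the full shifted sum. Even
before any well-foundedness is known, there is a linear order `X` that consists of exactly those `p`
in `D(X)` which lie above all elements of their own support, ordered as in `D(X)`. It arises in `ω`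
steps from the empty order, because supports are finite (`exists_terms`). If `X` is well-founded,
axiom beta collapses it to an ordinal, and this ordinal is a `ψ`-fixed point of `D`
(`exists_collapse`, `exists_isPsiFixedPoint_of_terms`). So existence reduces to the well-foundedness
of this term order.

Each `E μ` is an initial segment of `D`, naturally in the argument, and since the length of the sum
is a limit, each element of `D(X)` lies in some `E μ (X)`. If `π` witnesses that `Ω` is a fixed
point of `E μ`, the recursion `k β = ⟨σ, k[a]⟩` for `π β = ⟨σ, a⟩` embeds `Ω` into `X`, and its
range contains each term from `E μ (X)` together with all smaller terms (`exists_embedding`). A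
non-empty subset of `X` has an element in some `E μ (X)`; below this element the order is that of an
ordinal, so a minimal element exists (`terms_wf`).

For the supremum, fixed points of a predilator and of an initial segment of it are compared: their
embeddings agree wherever both are defined, so the fixed point of the smaller predilator is at most
the other (`IsPsiWith.app_eq`, `IsPsiWith.ordLe`). This gives uniqueness and the upper bound. If
some `Ω₁` below the fixed point `Ω` of `D` were an upper bound, `π Ω₁` would lie in some `E μ (Ω)`.
With `β` the fixed point of `E μ`, the value `π β` is at most `π Ω₁`, hence lies in `E μ` with
support below `β`, and is thus already a value at some `δ < β`, against injectivity
(`IsPsiFixedPoint.isOrdSup`).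

All of this takes place inside a model with separation and induction for primitive recursive
predicates only. The predicate `PR` records that a function or predicate is given by a function
symbol with parameters, and `fun_prop` proves most instances. Quantifiers have to be bounded; the
bounds come from the sets `univ x`, which contain all pairs and finite sets that are needed. -/

/-- Types whose elements are coded by tuples of elements of `M`. -/
class Ctx (M : Type u) (Γ : Type v) where
  dim : ℕ
  toV : Γ → Fin dim → M

open Ctx

instance Ctx.self (M : Type u) : Ctx M M := ⟨1, fun x _ => x⟩

instance Ctx.prod (M : Type u) (Γ : Type v) (Δ : Type w) [Ctx M Γ] [Ctx M Δ] : Ctx M (Γ × Δ) :=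
  ⟨dim M Γ + dim M Δ, fun z => Fin.append (toV z.1) (toV z.2)⟩

instance Ctx.tuple (M : Type u) (n : ℕ) : Ctx M (Fin n → M) := ⟨n, id⟩

-- A proposition is coded by its truth value `1 = {0}` or `0`, so that `PR` for a predicate says
-- that its characteristic function is primitive recursive.
open Classical in
noncomputable instance Ctx.prop (M : Type u) [SetStructure M] : Ctx M Prop :=
  ⟨1, fun P _ => if P then adj empty empty else empty⟩

/-! ### Primitive recursive functions with parameters -/

/-- The function `f` is primitive recursive with parameters from `M`. -/
@[fun_prop]
def PR (M : Type u) [SetStructure M] {Γ : Type v} {Δ : Type w} [Ctx M Γ] [Ctx M Δ]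
    (f : Γ → Δ) : Prop :=
  ∃ (k : ℕ) (p : Fin k → M) (s : Fin (dim M Δ) → PRFun (k + dim M Γ)),
    ∀ x j, toV (f x) j = SetStructure.fn (s j) (Fin.append p (toV x))

section

variable {M : Type u} [SetStructure M]
variable [hM : Fact (ModelsATR0Set M)]
variable {Γ : Type*} {Δ : Type*} {Θ : Type*} [Ctx M Γ] [Ctx M Δ] [Ctx M Θ]

@[fun_prop]
theorem PR.id : PR M (fun x : Γ => x) :=
  ⟨0, ![], fun j => .proj (Fin.natAdd 0 j), fun x j => by
    rw [hM.out.fn_proj, Fin.append_right]⟩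

@[fun_prop]
theorem PR.const (c : Δ) : PR M (fun _ : Γ => c) :=
  ⟨dim M Δ, toV c, fun j => .proj (Fin.castAdd _ j), fun x j => by
    rw [hM.out.fn_proj, Fin.append_left]⟩

@[fun_prop]
theorem PR.comp {g : Δ → Θ} {f : Γ → Δ} (hg : PR M g) (hf : PR M f) :
    PR M (fun x => g (f x)) := by
  obtain ⟨l, q, t, ht⟩ := hg
  obtain ⟨k, p, s, hs⟩ := hf
  -- The arguments are ordered as `q`, `p`, `x`: the symbol `t j` takes `q` as it stands, and its
  -- last block is filled with `f x`, computed from `p` and `x`.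
  refine ⟨l + k, Fin.append q p, fun j => .comp (t j) (Fin.addCases
    (fun a => .proj (Fin.castAdd _ (Fin.castAdd _ a)))
    (fun b => .comp (s b) (Fin.addCases (fun a => .proj (Fin.castAdd _ (Fin.natAdd _ a)))
      (fun a => .proj (Fin.natAdd _ a))))), fun x j => ?_⟩
  rw [ht, hM.out.fn_comp]
  congr 1
  funext i
  refine Fin.addCases (fun a => ?_) (fun b => ?_) i
  · simp [hM.out.fn_proj]
  · simp only [Fin.append_right, Fin.addCases_right, hM.out.fn_comp, hs]
    congr 1
    funext i
    refine Fin.addCases (fun a => ?_) (fun b => ?_) i <;> simp [hM.out.fn_proj]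

@[fun_prop]
theorem PR.fst {f : Γ → Δ × Θ} (hf : PR M f) : PR M (fun z => (f z).1) := by
  refine PR.comp (g := Prod.fst) ⟨0, ![], fun j => .proj (Fin.natAdd 0 (Fin.castAdd _ j)),
    fun x j => ?_⟩ hf
  rw [hM.out.fn_proj, Fin.append_right]
  exact (Fin.append_left _ _ _).symm

@[fun_prop]
theorem PR.snd {f : Γ → Δ × Θ} (hf : PR M f) : PR M (fun z => (f z).2) := by
  refine PR.comp (g := Prod.snd) ⟨0, ![], fun j => .proj (Fin.natAdd 0 (Fin.natAdd _ j)),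
    fun x j => ?_⟩ hf
  rw [hM.out.fn_proj, Fin.append_right]
  exact (Fin.append_right _ _ _).symm

@[fun_prop]
theorem PR.prodMk {f : Γ → Δ} {g : Γ → Θ} (hf : PR M f) (hg : PR M g) :
    PR M (fun x => (f x, g x)) := by
  obtain ⟨k, p, s, hs⟩ := hf
  obtain ⟨l, q, t, ht⟩ := hg
  refine ⟨k + l, Fin.append p q, Fin.addCases
    (fun b => .comp (s b) (Fin.addCases (fun a => .proj (Fin.castAdd _ (Fin.castAdd _ a)))
      (fun a => .proj (Fin.natAdd _ a))))
    (fun b => .comp (t b) (Fin.addCases (fun a => .proj (Fin.castAdd _ (Fin.natAdd _ a)))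
      (fun a => .proj (Fin.natAdd _ a)))), fun x j => ?_⟩
  refine Fin.addCases (fun a => ?_) (fun b => ?_) j
  · simp only [Fin.addCases_left, hM.out.fn_comp]
    refine (Fin.append_left _ _ _).trans ((hs x a).trans ?_)
    congr 1
    funext i
    refine Fin.addCases (fun a => ?_) (fun b => ?_) i <;> simp [hM.out.fn_proj]
  · simp only [Fin.addCases_right, hM.out.fn_comp]
    refine (Fin.append_right _ _ _).trans ((ht x b).trans ?_)
    congr 1
    funext i
    refine Fin.addCases (fun a => ?_) (fun b => ?_) i <;> simp [hM.out.fn_proj]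

theorem PR.cons {n : ℕ} {f : Γ → M} {g : Γ → Fin n → M} (hf : PR M f) (hg : PR M g) :
    PR M (fun x => (Fin.cons (f x) (g x) : Fin (n + 1) → M)) := by
  refine PR.comp (g := fun z : M × (Fin n → M) => (Fin.cons z.1 z.2 : Fin (n + 1) → M))
    ⟨0, ![], Fin.cons (.proj (Fin.natAdd 0 (Fin.castAdd n 0)))
      (fun j => .proj (Fin.natAdd 0 (Fin.natAdd 1 j))), fun x j => ?_⟩ (hf.prodMk hg)
  refine Fin.cases ?_ (fun j => ?_) j
  · rw [Fin.cons_zero, hM.out.fn_proj, Fin.append_right]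
    exact (Fin.append_left (m := 1) (n := n) (fun _ => x.1) x.2 0).symm
  · rw [Fin.cons_succ, hM.out.fn_proj, Fin.append_right]
    exact (Fin.append_right (m := 1) (n := n) (fun _ => x.1) x.2 j).symm

theorem PR.fn {n : ℕ} (s : PRFun n) {f : Γ → Fin n → M} (hf : PR M f) :
    PR M (fun x => SetStructure.fn s (f x)) := by
  refine PR.comp (g := fun v : Fin n → M => SetStructure.fn s v)
    ⟨0, ![], fun _ => .comp s (fun i => .proj (Fin.natAdd 0 i)), fun x j => ?_⟩ hf
  simp only [hM.out.fn_comp, hM.out.fn_proj, Fin.append_right]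
  rfl

theorem PR.empty_tuple : PR M (fun _ : Γ => (![] : Fin 0 → M)) := PR.const _

@[fun_prop]
theorem PR.adj {f g : Γ → M} (hf : PR M f) (hg : PR M g) : PR M (fun x => adj (f x) (g x)) :=
  PR.fn .adjoin (hf.cons (hg.cons PR.empty_tuple))

@[fun_prop]
theorem PR.upair {f g : Γ → M} (hf : PR M f) (hg : PR M g) : PR M (fun x => upair (f x) (g x)) := by
  unfold ATRSet.upair; fun_prop

@[fun_prop]
theorem PR.pair {f g : Γ → M} (hf : PR M f) (hg : PR M g) : PR M (fun x => pair (f x) (g x)) := by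
  unfold ATRSet.pair; fun_prop

/-! ### Basic set theory -/

theorem ext {x y : M} (h : ∀ z, z ∈ᴹ x ↔ z ∈ᴹ y) : x = y := hM.out.extensionality x y h

@[simp] theorem not_mem_empty (x : M) : ¬ x ∈ᴹ empty := hM.out.fn_zero _ _

@[simp] theorem mem_adj {x y z : M} : z ∈ᴹ adj x y ↔ z ∈ᴹ x ∨ z = y := hM.out.fn_adjoin _ _

@[simp] theorem mem_upair {x y z : M} : z ∈ᴹ upair x y ↔ z = x ∨ z = y := by simp [upair]

theorem not_mem_self (x : M) : ¬ x ∈ᴹ x := by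
  obtain ⟨y, hy, h⟩ := hM.out.foundation (adj empty x) ⟨x, by simp⟩
  simp only [mem_adj, not_mem_empty, false_or] at hy h
  subst hy
  exact h _ rfl

theorem upair_inj_left {x y z : M} (h : upair x y = upair x z) : y = z := by
  have h1 : y ∈ᴹ upair x z := by simp [← h]
  have h2 : z ∈ᴹ upair x y := by simp [h]
  simp only [mem_upair] at h1 h2
  rcases h1 with rfl | h1
  · rcases h2 with h2 | h2 <;> exact h2.symm
  · exact h1

theorem upair_self_eq {x y z : M} (h : upair x x = upair y z) : x = y ∧ x = z := by
  have h1 : y ∈ᴹ upair x x := by simp [h]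
  have h2 : z ∈ᴹ upair x x := by simp [h]
  simp only [mem_upair, or_self] at h1 h2
  exact ⟨h1.symm, h2.symm⟩

@[simp] theorem pair_inj {x y x' y' : M} : pair x y = pair x' y' ↔ x = x' ∧ y = y' := by
  refine ⟨fun h => ?_, by rintro ⟨rfl, rfl⟩; rfl⟩
  have hx : x = x' := by
    have : upair x x ∈ᴹ pair x' y' := by rw [← h]; simp [pair]
    rcases mem_upair.1 this with h | h
    · exact (upair_self_eq h).1
    · exact (upair_self_eq h).1
  subst hx
  exact ⟨rfl, upair_inj_left (upair_inj_left h)⟩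

/-! ### Predicates -/

open Classical in
theorem PR.char_iff {P : Γ → Prop} :
    PR M P ↔ PR M (fun x => if P x then ATRSet.adj empty empty else (empty : M)) :=
  ⟨fun ⟨k, p, s, h⟩ => ⟨k, p, s, h⟩, fun ⟨k, p, s, h⟩ => ⟨k, p, s, h⟩⟩

theorem PR.cond {a b c d : Γ → M} (ha : PR M a) (hb : PR M b) (hc : PR M c) (hd : PR M d) :
    PR M (fun x => SetStructure.fn PRFun.cond ![a x, b x, c x, d x]) :=
  PR.fn .cond (ha.cons (hb.cons (hc.cons (hd.cons PR.empty_tuple))))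

open Classical in
@[fun_prop]
theorem PR.mem {f g : Γ → M} (hf : PR M f) (hg : PR M g) : PR M (fun x => f x ∈ᴹ g x) := by
  rw [PR.char_iff]
  convert PR.cond (PR.const (M := M) (ATRSet.adj empty empty)) (PR.const (M := M) empty) hf hg using 2
    with x
  split_ifs with h
  · exact (hM.out.fn_cond_pos ![_, _, f x, g x] h).symm
  · exact (hM.out.fn_cond_neg ![_, _, f x, g x] h).symm

open Classical in
@[fun_prop]
theorem PR.ite {P : Γ → Prop} {f g : Γ → M} (hP : PR M P) (hf : PR M f) (hg : PR M g) :
    PR M (fun x => if P x then f x else g x) := by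
  rw [PR.char_iff] at hP
  convert PR.cond hf hg (PR.const (M := M) empty) hP using 2 with x
  split_ifs with h
  · exact (hM.out.fn_cond_pos ![f x, g x, _, _] (by simp)).symm
  · exact (hM.out.fn_cond_neg ![f x, g x, _, _] (by simp)).symm

-- Membership is the basic predicate of the language. Equality and the connectives are reduced to it
-- by coding each of them as membership between suitable values.
open Classical in
theorem PR.of_iff_mem {P : Γ → Prop} {f g : Γ → M} (hf : PR M f) (hg : PR M g)
    (h : ∀ x, P x ↔ f x ∈ᴹ g x) : PR M P := by
  obtain rfl : P = fun x => f x ∈ᴹ g x := funext fun x => propext (h x)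
  exact hf.mem hg

@[fun_prop]
theorem PR.eq {f g : Γ → M} (hf : PR M f) (hg : PR M g) : PR M (fun x => f x = g x) :=
  PR.of_iff_mem hf (g := fun x => ATRSet.adj empty (g x)) (by fun_prop) (by simp)

open Classical in
@[fun_prop]
theorem PR.not {P : Γ → Prop} (hP : PR M P) : PR M (fun x => ¬ P x) :=
  PR.of_iff_mem (f := fun _ => (empty : M)) (g := fun x => if P x then empty else ATRSet.adj empty empty)
    (by fun_prop) (by fun_prop) (fun x => by by_cases h : P x <;> simp [h])

open Classical in
@[fun_prop]
theorem PR.and {P Q : Γ → Prop} (hP : PR M P) (hQ : PR M Q) : PR M (fun x => P x ∧ Q x) :=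
  PR.of_iff_mem (f := fun _ => empty)
    (g := fun x => if P x then (if Q x then ATRSet.adj empty empty else empty) else empty)
    (by fun_prop) (by fun_prop) (fun x => by by_cases h : P x <;> by_cases h' : Q x <;> simp [h, h'])

theorem PR.congr {P Q : Γ → Prop} (hQ : PR M Q) (h : ∀ x, P x ↔ Q x) : PR M P := by
  obtain rfl : P = Q := funext fun x => propext (h x)
  exact hQ

@[fun_prop]
theorem PR.or {P Q : Γ → Prop} (hP : PR M P) (hQ : PR M Q) : PR M (fun x => P x ∨ Q x) :=
  PR.congr (Q := fun x => ¬ (¬ P x ∧ ¬ Q x)) (by fun_prop) (fun x => by tauto)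

@[fun_prop]
theorem PR.imp {P Q : Γ → Prop} (hP : PR M P) (hQ : PR M Q) : PR M (fun x => P x → Q x) :=
  PR.congr (Q := fun x => ¬ (P x ∧ ¬ Q x)) (by fun_prop) (fun x => by tauto)

@[fun_prop]
theorem PR.iff {P Q : Γ → Prop} (hP : PR M P) (hQ : PR M Q) : PR M (fun x => P x ↔ Q x) :=
  PR.congr (Q := fun x => (P x ∧ Q x) ∨ (¬ P x ∧ ¬ Q x)) (by fun_prop) (fun x => by tauto)

/-! ### Recursion and bounded quantifiers -/

theorem PR.recursion {h : M → M → Γ → M} (hh : PR M (fun z : M × M × Γ => h z.1 z.2.1 z.2.2)) :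
    ∃ R : M → Γ → M, PR M (fun z : M × Γ => R z.1 z.2) ∧ ∀ x y, ∃ w,
      (∀ z, z ∈ᴹ w ↔ ∃ v, v ∈ᴹ x ∧ z ∈ᴹ R v y) ∧ R x y = h w x y := by
  obtain ⟨k, p, s, hs⟩ := hh
  let n := dim M Γ
  -- The recursion axiom supplies the arguments in the order `w`, `x`, `p`, `y`, while the symbol
  -- for `h` expects the parameters `p` in front. The projections permute them.
  let H : PRFun ((k + n) + 2) := .comp (s (0 : Fin 1)) (Fin.addCases
    (fun a => .proj (Fin.castAdd n a).succ.succ)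
    (Fin.addCases (m := 1) (n := 1 + n) (fun _ => .proj 0)
      (Fin.addCases (m := 1) (n := n) (fun _ => .proj 1)
        (fun c => .proj (Fin.natAdd k c : Fin (k + n)).succ.succ))))
  have hH : ∀ (w x : M) (y : Γ), SetStructure.fn H (Fin.cons w (Fin.cons x (Fin.append p (toV y)) :
      Fin (k + n + 1) → M) : Fin (k + n + 2) → M) = h w x y := by
    intro w x y
    refine Eq.trans ?_ (hs (w, x, y) (0 : Fin 1)).symm
    rw [hM.out.fn_comp]
    congr 1
    funext i
    refine Fin.addCases (fun a => ?_) (fun b => ?_) i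
    · simp only [Fin.addCases_left, hM.out.fn_proj, Fin.cons_succ, Fin.append_left]
    · simp only [Fin.addCases_right, Fin.append_right]
      refine Fin.addCases (m := 1) (n := 1 + n) (fun a => ?_) (fun b => ?_) b
      · obtain rfl : a = 0 := Subsingleton.elim _ _
        refine Eq.trans ?_ (Fin.append_left (α := M) (m := 1) (n := 1 + n) _ _ _).symm
        simp only [Fin.addCases_left, hM.out.fn_proj]
        rfl
      · refine Eq.trans ?_ (Fin.append_right (α := M) (m := 1) (n := 1 + n) _ _ _).symm
        simp only [Fin.addCases_right]
        refine Fin.addCases (fun a => ?_) (fun b => ?_) b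
        · simp only [Fin.addCases_left, hM.out.fn_proj]
          exact (Fin.append_left (m := 1) (n := n) (fun _ => x) (toV y) a).symm
        · simp only [Fin.addCases_right, hM.out.fn_proj, Fin.cons_succ, Fin.append_right]
          exact (Fin.append_right (m := 1) (n := n) (fun _ => x) (toV y) b).symm
  refine ⟨fun x y => SetStructure.fn (.recursion H) (Fin.cons x (Fin.append p (toV y)) :
    Fin (k + n + 1) → M), PR.fn _ (PR.cons (by fun_prop) ?_), fun x y => ?_⟩
  · have h1 : PR M (fun z : Γ => (Fin.append p (toV z) : Fin (k + n) → M)) := by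
      refine ⟨k, p, fun j => .proj j, fun x j => ?_⟩
      rw [hM.out.fn_proj]
      rfl
    exact h1.comp (PR.snd (f := fun z : M × Γ => z) PR.id)
  · obtain ⟨w, hw, e⟩ := hM.out.fn_recursion H x (Fin.append p (toV y))
    exact ⟨w, hw, e.trans (hH w x y)⟩

-- Recursion only provides unions over earlier values of the same function. The case distinction
-- makes all values at elements `x` of `u y` equal to `F y x`, and lets the value at `u y` itself be
-- the union of those. The two cases do not interfere because `u y` is not an element of itself.
open Classical in
theorem PR.exists_bUnion {u : Γ → M} {F : Γ → M → M} (hu : PR M u)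
    (hF : PR M (fun z : Γ × M => F z.1 z.2)) :
    ∃ G : Γ → M, PR M G ∧ ∀ y z, z ∈ᴹ G y ↔ ∃ x, x ∈ᴹ u y ∧ z ∈ᴹ F y x := by
  have h1 : PR M (fun z : M × M × Γ => F z.2.2 z.2.1) :=
    hF.comp (f := fun z : M × M × Γ => (z.2.2, z.2.1)) (by fun_prop)
  obtain ⟨R, hR, h⟩ := PR.recursion (Γ := Γ)
    (h := fun w x y => if x = u y then w else F y x) (by fun_prop)
  refine ⟨fun y => R (u y) y, hR.comp (f := fun y => (u y, y)) (by fun_prop), fun y z => ?_⟩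
  obtain ⟨w, hw, e⟩ := h (u y) y
  simp only [e, if_pos, hw]
  refine exists_congr fun x => and_congr_right fun hx => ?_
  obtain ⟨w', _, e'⟩ := h x y
  rw [e', if_neg]
  rintro rfl
  exact not_mem_self _ hx

-- The union of the sets that are `{0}` where `P` holds and empty elsewhere contains `0` precisely
-- if there is a witness.
open Classical in
theorem PR.ex_mem {u : Γ → M} {P : Γ → M → Prop} (hu : PR M u)
    (hP : PR M (fun z : Γ × M => P z.1 z.2)) : PR M (fun y => ∃ x, x ∈ᴹ u y ∧ P y x) := by
  obtain ⟨G, hG, h⟩ := PR.exists_bUnion (F := fun y x => if P y x then ATRSet.adj empty empty else empty)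
    hu (by fun_prop)
  refine PR.of_iff_mem (PR.const (M := M) empty) hG fun y => ?_
  rw [h]
  refine exists_congr fun x => and_congr_right fun hx => ?_
  by_cases h : P y x <;> simp [h]

theorem PR.all_mem {u : Γ → M} {P : Γ → M → Prop} (hu : PR M u)
    (hP : PR M (fun z : Γ × M => P z.1 z.2)) : PR M (fun y => ∀ x, x ∈ᴹ u y → P y x) :=
  PR.congr (PR.not (PR.ex_mem hu (P := fun y x => ¬ P y x) (by fun_prop)))
    (fun x => by push Not; rfl)

/-- Unbounded quantifiers over bounded predicates. -/
theorem PR.ex {u : Γ → M} {P : Γ → M → Prop} (hu : PR M u) (hb : ∀ y x, P y x → x ∈ᴹ u y)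
    (hP : PR M (fun z : Γ × M => P z.1 z.2)) : PR M (fun y => ∃ x, P y x) :=
  PR.congr (PR.ex_mem hu hP) fun _ => exists_congr fun _ => ⟨fun h => ⟨hb _ _ h, h⟩, And.right⟩

open Classical in
theorem PR.exists_sep {u : Γ → M} {P : Γ → M → Prop} (hu : PR M u)
    (hP : PR M (fun z : Γ × M => P z.1 z.2)) :
    ∃ G : Γ → M, PR M G ∧ ∀ y z, z ∈ᴹ G y ↔ z ∈ᴹ u y ∧ P y z := by
  obtain ⟨G, hG, h⟩ := PR.exists_bUnion (F := fun y x => if P y x then ATRSet.adj empty x else empty)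
    hu (by fun_prop)
  refine ⟨G, hG, fun y z => ?_⟩
  rw [h]
  constructor
  · rintro ⟨x, hx, hz⟩
    split_ifs at hz with hp
    · simp only [mem_adj, not_mem_empty, false_or] at hz
      subst hz; exact ⟨hx, hp⟩
    · simp at hz
  · rintro ⟨hz, hp⟩
    exact ⟨z, hz, by simp [hp]⟩

/-- Separation. -/
theorem sep (u : M) {P : M → Prop} (hP : PR M P) : ∃ s : M, ∀ z, z ∈ᴹ s ↔ z ∈ᴹ u ∧ P z := by
  obtain ⟨G, -, h⟩ := PR.exists_sep (Γ := M) (u := fun _ => u) (P := fun _ => P) (by fun_prop)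
    (by fun_prop)
  exact ⟨G u, h u⟩

/-! ### Foundation and induction -/

theorem exists_minimal {A : M} {P : M → Prop} (hP : PR M P) (h : ∃ x, x ∈ᴹ A ∧ P x) :
    ∃ x, x ∈ᴹ A ∧ P x ∧ ∀ z, z ∈ᴹ x → z ∈ᴹ A → ¬ P z := by
  obtain ⟨s, hs⟩ := sep A hP
  obtain ⟨x, hx⟩ := h
  obtain ⟨y, hy, hmin⟩ := hM.out.foundation s ⟨x, (hs x).2 hx⟩
  exact ⟨y, ((hs y).1 hy).1, ((hs y).1 hy).2, fun z hz hA hPz => hmin z ((hs z).2 ⟨hA, hPz⟩) hz⟩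

theorem mem_induction {A : M} {P : M → Prop} (hP : PR M P)
    (h : ∀ x, x ∈ᴹ A → (∀ z, z ∈ᴹ x → z ∈ᴹ A → P z) → P x) : ∀ x, x ∈ᴹ A → P x := by
  by_contra! hc
  obtain ⟨x, hx, hn, hmin⟩ := exists_minimal hP.not hc
  exact hn (h x hx fun z hz hA => not_not.1 (hmin z hz hA))

theorem not_mem_mem {x y : M} (h : x ∈ᴹ y) : ¬ y ∈ᴹ x := by
  intro h'
  obtain ⟨z, hz, hmin⟩ := hM.out.foundation (upair x y) ⟨x, by simp⟩
  rcases mem_upair.1 hz with rfl | rfl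
  · exact hmin y (by simp) h'
  · exact hmin x (by simp) h

@[simp] theorem empty_mem_om : (empty : M) ∈ᴹ om := (hM.out.infinity _).2 (Or.inl rfl)

theorem succ_mem_om {n : M} (h : n ∈ᴹ om) : adj n n ∈ᴹ om := (hM.out.infinity _).2 (Or.inr ⟨n, h, rfl⟩)

theorem om_induction {P : M → Prop} (hP : PR M P) (h0 : P empty)
    (hs : ∀ n, n ∈ᴹ om → P n → P (adj n n)) : ∀ n, n ∈ᴹ om → P n := by
  refine mem_induction hP fun x hx ih => ?_
  rcases (hM.out.infinity x).1 hx with rfl | ⟨m, hm, rfl⟩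
  · exact h0
  · exact hs m hm (ih m (by simp) hm)

theorem om_trans {n m : M} (hn : n ∈ᴹ om) (hm : m ∈ᴹ n) : m ∈ᴹ om := by
  have : ∀ n, n ∈ᴹ (om : M) → ∀ m, m ∈ᴹ n → m ∈ᴹ om := by
    refine om_induction (P := fun n : M => ∀ m, m ∈ᴹ n → m ∈ᴹ om)
      (PR.all_mem (by fun_prop) (by fun_prop)) (by simp) fun n hn ih m hm => ?_
    rcases mem_adj.1 hm with h | rfl
    · exact ih m h
    · exact hn
  exact this n hn m hm

theorem isOrd_empty : IsOrd (empty : M) := ⟨fun y hy => by simp at hy, fun y hy => by simp at hy⟩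

theorem IsOrd.mem {x y : M} (hx : IsOrd x) (hy : y ∈ᴹ x) : IsOrd y :=
  ⟨hx.2 y hy, fun z hz => hx.2 z (hx.1 y hy z hz)⟩

theorem IsOrd.succ {x : M} (hx : IsOrd x) : IsOrd (adj x x) := by
  constructor
  · intro y hy z hz
    rcases mem_adj.1 hy with h | rfl
    · exact mem_adj.2 (Or.inl (hx.1 y h z hz))
    · exact mem_adj.2 (Or.inl hz)
  · intro y hy
    rcases mem_adj.1 hy with h | rfl
    · exact hx.2 y h
    · exact hx.1

theorem isOrd_of_mem_om {n : M} (hn : n ∈ᴹ om) : IsOrd n := by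
  refine om_induction (P := fun n : M => IsOrd n) ?_ isOrd_empty (fun n _ h => h.succ) n hn
  unfold IsOrd IsTransSet
  refine PR.and (PR.all_mem (by fun_prop) (PR.all_mem (by fun_prop) (by fun_prop)))
    (PR.all_mem (by fun_prop) (PR.all_mem (by fun_prop) (PR.all_mem (by fun_prop) (by fun_prop))))

theorem isOrd_om : IsOrd (om : M) :=
  ⟨fun _ hy _ hz => om_trans hy hz, fun _ hy => (isOrd_of_mem_om hy).1⟩

/-- Two nested minimal choices: first `x` in `α + 1` that is incomparable with some element of `β +
1`, then such a `y` for this `x`. By minimality `x` and `y` have the same elements. The successors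
serve as sets that contain `α` and `β`, as foundation applies to sets only. -/
theorem IsOrd.trichotomy {α β : M} (hα : IsOrd α) (hβ : IsOrd β) : α ∈ᴹ β ∨ α = β ∨ β ∈ᴹ α := by
  by_contra hc
  obtain ⟨x, hx, ⟨y, hy, hxy⟩, hmin⟩ := exists_minimal (A := adj α α)
    (P := fun x => ∃ y, y ∈ᴹ adj β β ∧ ¬ (x ∈ᴹ y ∨ x = y ∨ y ∈ᴹ x))
    (PR.ex_mem (by fun_prop) (by fun_prop)) ⟨α, by simp, β, by simp, hc⟩
  obtain ⟨y, hy, hxy, hmin'⟩ := exists_minimal (A := adj β β)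
    (P := fun y => ¬ (x ∈ᴹ y ∨ x = y ∨ y ∈ᴹ x)) (by fun_prop) ⟨y, hy, hxy⟩
  have hx' := hα.succ
  have hy' := hβ.succ
  refine hxy (Or.inr (Or.inl (ext fun z => ⟨fun hz => ?_, fun hz => ?_⟩)))
  · have hzA := hx'.1 x hx z hz
    by_contra hzy
    refine hmin z hz hzA ⟨y, hy, ?_⟩
    rintro (h | rfl | h)
    · exact hzy h
    · exact hxy (Or.inr (Or.inr hz))
    · exact hxy (Or.inr (Or.inr ((hx'.mem hx).1 z hz y h)))
  · have hzB := hy'.1 y hy z hz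
    have := not_not.1 (hmin' z hz hzB)
    rcases this with h | rfl | h
    · exact absurd (Or.inl ((hy'.mem hy).1 z hz x h)) hxy
    · exact absurd (Or.inl hz) hxy
    · exact h

theorem ordOrder_linear {α : M} (hα : IsOrd α) : (ordOrder α).IsLinear :=
  ⟨fun x _ => not_mem_self x, fun x y _ _ _ hz h h' => (hα.mem hz).1 y h' x h,
    fun _ _ hx hy => (hα.mem hx).trichotomy (hα.mem hy)⟩

/-! ### Functions -/

theorem exists_sUnion : ∃ G : M → M, PR M G ∧ ∀ x z, z ∈ᴹ G x ↔ ∃ y, y ∈ᴹ x ∧ z ∈ᴹ y :=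
  PR.exists_bUnion (Γ := M) (u := fun x => x) (F := fun _ y => y) (by fun_prop) (by fun_prop)

/-- The union `⋃ x`. -/
noncomputable def sUnion (x : M) : M := (exists_sUnion (M := M)).choose x

@[simp] theorem mem_sUnion {x z : M} : z ∈ᴹ sUnion x ↔ ∃ y, y ∈ᴹ x ∧ z ∈ᴹ y :=
  (exists_sUnion (M := M)).choose_spec.2 x z

@[fun_prop]
theorem PR.sUnion {f : Γ → M} (hf : PR M f) : PR M (fun x => sUnion (f x)) :=
  (exists_sUnion (M := M)).choose_spec.1.comp hf

/-- The union `x ∪ y`. -/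
noncomputable def cup (x y : M) : M := sUnion (upair x y)

@[simp] theorem mem_cup {x y z : M} : z ∈ᴹ cup x y ↔ z ∈ᴹ x ∨ z ∈ᴹ y := by simp [cup]

@[fun_prop]
theorem PR.cup {f g : Γ → M} (hf : PR M f) (hg : PR M g) : PR M (fun x => cup (f x) (g x)) := by
  unfold ATRSet.cup; fun_prop

theorem mem_sUnion_of_pair {x y f : M} (h : pair x y ∈ᴹ f) :
    x ∈ᴹ sUnion (sUnion f) ∧ y ∈ᴹ sUnion (sUnion f) :=
  ⟨mem_sUnion.2 ⟨upair x y, mem_sUnion.2 ⟨_, h, by simp [pair]⟩, by simp⟩,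
    mem_sUnion.2 ⟨upair x y, mem_sUnion.2 ⟨_, h, by simp [pair]⟩, by simp⟩⟩

theorem app_spec {f x : M} (h : ∃! y, pair x y ∈ᴹ f) : pair x (app f x) ∈ᴹ f := by
  rw [app, dif_pos h]; exact h.choose_spec.1

theorem app_eq {f x y : M} (h : ∃! y, pair x y ∈ᴹ f) (hy : pair x y ∈ᴹ f) : app f x = y :=
  h.unique (app_spec h) hy

theorem PR.existsUnique_pair {f g : Γ → M} (hf : PR M f) (hg : PR M g) :
    PR M (fun x => ∃! y, ATRSet.pair (f x) y ∈ᴹ g x) := by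
  refine PR.ex (u := fun x => ATRSet.sUnion (ATRSet.sUnion (g x))) (by fun_prop)
    (fun x y h => (mem_sUnion_of_pair h.1).2) ?_
  refine PR.and (by fun_prop) (PR.congr (PR.all_mem
    (u := fun z : Γ × M => ATRSet.sUnion (ATRSet.sUnion (g z.1)))
    (P := fun z y => ATRSet.pair (f z.1) y ∈ᴹ g z.1 → y = z.2) (by fun_prop) (by fun_prop)) ?_)
  exact fun z => ⟨fun h y _ hy => h y hy, fun h y hy => h y (mem_sUnion_of_pair hy).2 hy⟩

-- The value is the union of the set of all `y` that are the unique value at the argument. This set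
-- is a singleton or empty, and in the latter case its union agrees with the default value of `app`.
@[fun_prop]
theorem PR.app {f g : Γ → M} (hf : PR M f) (hg : PR M g) : PR M (fun x => app (f x) (g x)) := by
  obtain ⟨G, hG, h⟩ := PR.exists_sep (u := fun x => ATRSet.sUnion (ATRSet.sUnion (f x)))
    (P := fun x y => (∃! y, ATRSet.pair (g x) y ∈ᴹ f x) ∧ ATRSet.pair (g x) y ∈ᴹ f x) (by fun_prop)
    (PR.and (PR.existsUnique_pair (by fun_prop) (by fun_prop)) (by fun_prop))
  have : PR M (fun x => ATRSet.sUnion (G x)) := by fun_prop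
  convert this using 2 with x
  refine ext fun z => ?_
  simp only [mem_sUnion, h]
  by_cases hx : ∃! y, ATRSet.pair (g x) y ∈ᴹ f x
  · constructor
    · intro hz
      exact ⟨ATRSet.app (f x) (g x), ⟨by simpa using (mem_sUnion_of_pair (app_spec hx)).2, hx, app_spec hx⟩, hz⟩
    · rintro ⟨y, ⟨-, -, hy⟩, hz⟩
      rwa [app_eq hx hy]
  · simp [hx, ATRSet.app]

theorem IsFunOn.pair_mem {f A x : M} (h : IsFunOn f A) (hx : x ∈ᴹ A) : pair x (app f x) ∈ᴹ f :=
  app_spec (h.2 x hx)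

theorem IsFunOn.app_eq {f A x y : M} (h : IsFunOn f A) (hx : x ∈ᴹ A) (hy : pair x y ∈ᴹ f) :
    app f x = y := ATRSet.app_eq (h.2 x hx) hy

theorem IsFunOn.mem_iff {f A p : M} (h : IsFunOn f A) : p ∈ᴹ f ↔ ∃ x, x ∈ᴹ A ∧ p = pair x (app f x) := by
  constructor
  · intro hp
    obtain ⟨x, y, hx, rfl⟩ := h.1 p hp
    exact ⟨x, hx, by rw [h.app_eq hx hp]⟩
  · rintro ⟨x, hx, rfl⟩
    exact h.pair_mem hx

theorem IsFunOn.ext {f g A : M} (hf : IsFunOn f A) (hg : IsFunOn g A)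
    (h : ∀ x, x ∈ᴹ A → app f x = app g x) : f = g := by
  refine ATRSet.ext fun p => ?_
  rw [hf.mem_iff, hg.mem_iff]
  exact exists_congr fun x => and_congr_right fun hx => by rw [h x hx]

@[fun_prop]
theorem PR.isFunOn {f g : Γ → M} (hf : PR M f) (hg : PR M g) : PR M (fun x => IsFunOn (f x) (g x)) := by
  unfold IsFunOn
  refine PR.and (PR.congr (Q := fun z => ∀ p, p ∈ᴹ f z → ∃ x, x ∈ᴹ g z ∧
    ∃ y, y ∈ᴹ ATRSet.sUnion (ATRSet.sUnion (f z)) ∧ p = ATRSet.pair x y)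
    (PR.all_mem (by fun_prop) (PR.ex_mem (by fun_prop) (PR.ex_mem (by fun_prop) (by fun_prop)))) ?_)
    (PR.all_mem (by fun_prop) (PR.existsUnique_pair (by fun_prop) (by fun_prop)))
  refine fun z => forall_congr' fun p => forall_congr' fun hp => exists_congr fun x => ⟨?_, ?_⟩
  · rintro ⟨y, hx, rfl⟩
    exact ⟨hx, y, (mem_sUnion_of_pair hp).2, rfl⟩
  · rintro ⟨hx, y, -, rfl⟩
    exact ⟨y, hx, rfl⟩

/-- The function with domain `A` and values `F x`. -/
theorem exists_fun (A : M) {F : M → M} (hF : PR M F) :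
    ∃ f, IsFunOn f A ∧ ∀ x, x ∈ᴹ A → app f x = F x := by
  obtain ⟨G, -, h⟩ := PR.exists_bUnion (Γ := M) (u := fun _ => A)
    (F := fun _ x => adj empty (pair x (F x))) (by fun_prop) (by fun_prop)
  have h' : ∀ p, p ∈ᴹ G A ↔ ∃ x, x ∈ᴹ A ∧ p = pair x (F x) := by simpa using h A
  have hf : IsFunOn (G A) A := by
    refine ⟨fun p hp => ?_, fun x hx => ⟨F x, (h' _).2 ⟨x, hx, rfl⟩, fun y hy => ?_⟩⟩
    · obtain ⟨x, hx, rfl⟩ := (h' p).1 hp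
      exact ⟨x, _, hx, rfl⟩
    · obtain ⟨x', hx', e⟩ := (h' _).1 hy
      rw [pair_inj] at e
      rw [e.2, e.1]
  exact ⟨G A, hf, fun x hx => hf.app_eq hx ((h' _).2 ⟨x, hx, rfl⟩)⟩

/-- The function with domain `A` and graph given by a relation. -/
theorem exists_fun_of_rel (A B : M) {R : M → M → Prop} (hR : PR M (fun z : M × M => R z.1 z.2))
    (h : ∀ x, x ∈ᴹ A → ∃ y, y ∈ᴹ B ∧ R x y)
    (hu : ∀ x y y', x ∈ᴹ A → R x y → R x y' → y = y') :
    ∃ f, IsFunOn f A ∧ ∀ x, x ∈ᴹ A → app f x ∈ᴹ B ∧ R x (app f x) := by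
  obtain ⟨G, hG, hG'⟩ := PR.exists_sep (Γ := M) (u := fun _ => B) (by fun_prop) hR
  obtain ⟨f, hf, hf'⟩ := exists_fun A (F := fun x => sUnion (G x)) (by fun_prop)
  refine ⟨f, hf, fun x hx => ?_⟩
  obtain ⟨y, hy, hxy⟩ := h x hx
  have : sUnion (G x) = y := by
    refine ext fun z => ?_
    simp only [mem_sUnion, hG']
    exact ⟨fun ⟨y', h1, h2⟩ => hu x y' y hx h1.2 hxy ▸ h2, fun hz => ⟨y, ⟨hy, hxy⟩, hz⟩⟩
  rw [hf' x hx, this]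
  exact ⟨hy, hxy⟩

/-- The image of a set. -/
theorem exists_image (A : M) {F : M → M} (hF : PR M F) :
    ∃ B, ∀ y, y ∈ᴹ B ↔ ∃ x, x ∈ᴹ A ∧ y = F x := by
  obtain ⟨G, -, h⟩ := PR.exists_bUnion (Γ := M) (u := fun _ => A)
    (F := fun _ x => adj empty (F x)) (by fun_prop) (by fun_prop)
  exact ⟨G A, by simpa using h A⟩

/-! ### Transitive sets closed under adjunction -/

/-- The set `U` is transitive, contains the empty set and is closed under adjunction. -/
structure Univ (U : M) : Prop where
  trans : ∀ {x y}, x ∈ᴹ U → y ∈ᴹ x → y ∈ᴹ U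
  empty : ATRSet.empty ∈ᴹ U
  adj : ∀ {x y}, x ∈ᴹ U → y ∈ᴹ U → adj x y ∈ᴹ U

/-- Iterate along `ω`: stage `n` collects `0`, `x`, the earlier stages, the elements of their
elements, and all adjunctions of two earlier sets. Any two elements of the union appear at stages
below a common one, which yields the closure properties. That `T` is itself primitive recursive in
`x` allows its values to serve as quantifier bounds. -/
theorem exists_univ : ∃ T : M → M, PR M T ∧ ∀ x, x ∈ᴹ T x ∧ Univ (T x) := by
  obtain ⟨G, hG, hG'⟩ := PR.exists_bUnion (Γ := M × M) (u := fun z => z.2)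
    (F := fun z y => adj empty (adj z.1 y)) (by fun_prop) (by fun_prop)
  obtain ⟨K, hK, hK'⟩ := PR.exists_bUnion (Γ := M) (u := fun z => z)
    (F := fun z y => G (y, z)) (by fun_prop) (by fun_prop)
  have hK : ∀ w z, z ∈ᴹ K w ↔ ∃ a b, a ∈ᴹ w ∧ b ∈ᴹ w ∧ z = adj a b := by
    simp only [hK', hG', mem_adj, not_mem_empty, false_or]
    grind
  obtain ⟨R, hR, h⟩ := PR.recursion (M := M) (Γ := M)
    (h := fun w _ x => cup (adj (adj empty empty) x) (cup w (cup (sUnion w) (K w)))) (by fun_prop)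
  have h1 : ∀ n x z, z ∈ᴹ R n x ↔ z = empty ∨ z = x ∨ (∃ v, v ∈ᴹ n ∧ z ∈ᴹ R v x) ∨
      (∃ y, (∃ v, v ∈ᴹ n ∧ y ∈ᴹ R v x) ∧ z ∈ᴹ y) ∨ ∃ a b, (∃ v, v ∈ᴹ n ∧ a ∈ᴹ R v x) ∧
        (∃ v, v ∈ᴹ n ∧ b ∈ᴹ R v x) ∧ z = adj a b := by
    intro n x z
    obtain ⟨w, hw, e⟩ := h n x
    rw [e]
    simp only [mem_cup, mem_sUnion, hK, hw, mem_adj, not_mem_empty, false_or, or_assoc]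
  obtain ⟨T, hT, hT'⟩ := PR.exists_bUnion (Γ := M) (u := fun _ => (om : M))
    (F := fun x n => R n x) (by fun_prop)
    (hR.comp (f := fun z : M × M => (z.2, z.1)) (by fun_prop))
  refine ⟨T, hT, fun x => ⟨(hT' x x).2 ⟨empty, by simp, (h1 _ _ _).2 (by simp)⟩,
    fun {y z} hy hz => ?_, (hT' x empty).2 ⟨empty, by simp, (h1 _ _ _).2 (by simp)⟩,
    fun {y z} hy hz => ?_⟩⟩
  · obtain ⟨n, hn, hy⟩ := (hT' _ _).1 hy
    exact (hT' _ _).2 ⟨adj n n, succ_mem_om hn, (h1 _ _ _).2 (Or.inr (Or.inr (Or.inr (Or.inl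
      ⟨y, ⟨n, by simp, hy⟩, hz⟩))))⟩
  · obtain ⟨n, hn, hy⟩ := (hT' _ _).1 hy
    obtain ⟨m, hm, hz⟩ := (hT' _ _).1 hz
    obtain ⟨k, hk, h1k, h2k⟩ : ∃ k, k ∈ᴹ om ∧ n ∈ᴹ k ∧ m ∈ᴹ k := by
      rcases (isOrd_of_mem_om hn).trichotomy (isOrd_of_mem_om hm) with h | rfl | h
      · exact ⟨adj m m, succ_mem_om hm, by simp [h], by simp⟩
      · exact ⟨adj n n, succ_mem_om hn, by simp, by simp⟩
      · exact ⟨adj n n, succ_mem_om hn, by simp, by simp [h]⟩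
    exact (hT' _ _).2 ⟨k, hk, (h1 _ _ _).2 (Or.inr (Or.inr (Or.inr (Or.inr
      ⟨y, z, ⟨n, h1k, hy⟩, ⟨m, h2k, hz⟩, rfl⟩))))⟩

/-- A transitive set that contains `x` and is closed under adjunction. -/
noncomputable def univ (x : M) : M := (exists_univ (M := M)).choose x

@[fun_prop]
theorem PR.univ {f : Γ → M} (hf : PR M f) : PR M (fun x => univ (f x)) :=
  (exists_univ (M := M)).choose_spec.1.comp hf

theorem mem_univ_self (x : M) : x ∈ᴹ univ x := ((exists_univ (M := M)).choose_spec.2 x).1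

theorem univ_univ (x : M) : Univ (univ x) := ((exists_univ (M := M)).choose_spec.2 x).2

namespace Univ

variable {U : M} (hU : Univ U)
include hU

theorem upair {x y : M} (hx : x ∈ᴹ U) (hy : y ∈ᴹ U) : upair x y ∈ᴹ U :=
  hU.adj (hU.adj hU.empty hx) hy

theorem pair {x y : M} (hx : x ∈ᴹ U) (hy : y ∈ᴹ U) : pair x y ∈ᴹ U :=
  hU.upair (hU.upair hx hx) (hU.upair hx hy)

theorem left {x y : M} (h : ATRSet.pair x y ∈ᴹ U) : x ∈ᴹ U :=
  hU.trans (hU.trans h (y := ATRSet.upair x x) (by simp [ATRSet.pair])) (by simp)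

theorem right {x y : M} (h : ATRSet.pair x y ∈ᴹ U) : y ∈ᴹ U :=
  hU.trans (hU.trans h (y := ATRSet.upair x y) (by simp [ATRSet.pair])) (by simp)

@[simp] theorem pair_mem_iff {x y : M} : ATRSet.pair x y ∈ᴹ U ↔ x ∈ᴹ U ∧ y ∈ᴹ U :=
  ⟨fun h => ⟨hU.left h, hU.right h⟩, fun h => hU.pair h.1 h.2⟩

theorem of_mem_om : ∀ n, n ∈ᴹ om → n ∈ᴹ U :=
  om_induction (P := fun n => n ∈ᴹ U) (by fun_prop) hU.empty (fun _ _ h => hU.adj h h)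

/-- A finite function with values in `U` is an element of `U`. -/
theorem fun_mem {n e : M} (hn : n ∈ᴹ om) (he : IsFunOn e n) (h : ∀ i, i ∈ᴹ n → app e i ∈ᴹ U) :
    e ∈ᴹ U := by
  -- `r m` is the restriction of `e` to arguments below `m`, so the step from `m` to `m + 1` adjoins
  -- one pair.
  obtain ⟨r, hr, hr'⟩ := PR.exists_sep (Γ := M) (u := fun _ => e)
    (P := fun m p => ∃ i, i ∈ᴹ m ∧ p = ATRSet.pair i (app e i)) (by fun_prop)
    (PR.ex_mem (by fun_prop) (by fun_prop))
  have key := om_induction (P := fun m => (∀ i, i ∈ᴹ m → i ∈ᴹ n) → r m ∈ᴹ U)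
    (PR.imp (PR.all_mem (by fun_prop) (by fun_prop)) (by fun_prop)) (fun _ => ?_)
    (fun m hm ih hmn => ?_) n hn (fun _ h => h)
  · rwa [show r n = e from ext fun p => by rw [hr', he.mem_iff]; simp] at key
  · rw [show r ATRSet.empty = ATRSet.empty from ext fun p => by simp [hr']]
    exact hU.empty
  · have hm' : m ∈ᴹ n := hmn m (by simp)
    rw [show r (ATRSet.adj m m) = ATRSet.adj (r m) (ATRSet.pair m (app e m)) from ext fun p => by
      simp only [hr', mem_adj]
      constructor
      · rintro ⟨hp, i, hi | rfl, rfl⟩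
        · exact Or.inl ⟨hp, i, hi, rfl⟩
        · exact Or.inr rfl
      · rintro (⟨hp, i, hi, rfl⟩ | rfl)
        · exact ⟨hp, i, Or.inl hi, rfl⟩
        · exact ⟨he.pair_mem hm', m, Or.inr rfl, rfl⟩]
    exact hU.adj (ih fun i hi => hmn i (by simp [hi]))
      (hU.pair (hU.of_mem_om _ hm) (h _ hm'))

/-- A finite subset of `U` is an element of `U`. -/
theorem finite_mem {n e a : M} (hn : n ∈ᴹ om) (ha : ∀ x, x ∈ᴹ a ↔ ∃ i, i ∈ᴹ n ∧ x = app e i)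
    (h : ∀ x, x ∈ᴹ a → x ∈ᴹ U) : a ∈ᴹ U := by
  obtain ⟨r, hr, hr'⟩ := PR.exists_sep (Γ := M) (u := fun _ => a)
    (P := fun m p => ∃ i, i ∈ᴹ m ∧ p = app e i) (by fun_prop)
    (PR.ex_mem (by fun_prop) (by fun_prop))
  have key := om_induction (P := fun m => (∀ i, i ∈ᴹ m → i ∈ᴹ n) → r m ∈ᴹ U)
    (PR.imp (PR.all_mem (by fun_prop) (by fun_prop)) (by fun_prop)) (fun _ => ?_)
    (fun m hm ih hmn => ?_) n hn (fun _ h => h)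
  · rwa [show r n = a from ext fun p => by rw [hr', ha]; simp] at key
  · rw [show r ATRSet.empty = ATRSet.empty from ext fun p => by simp [hr']]
    exact hU.empty
  · have hm' : app e m ∈ᴹ a := (ha _).2 ⟨m, hmn m (by simp), rfl⟩
    rw [show r (ATRSet.adj m m) = ATRSet.adj (r m) (app e m) from ext fun p => by
      simp only [hr', mem_adj]
      constructor
      · rintro ⟨hp, i, hi | rfl, rfl⟩
        · exact Or.inl ⟨hp, i, hi, rfl⟩
        · exact Or.inr rfl
      · rintro (⟨hp, i, hi, rfl⟩ | rfl)
        · exact ⟨hp, i, Or.inl hi, rfl⟩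
        · exact ⟨hm', m, Or.inr rfl, rfl⟩]
    exact hU.adj (ih fun i hi => hmn i (by simp [hi])) (h _ hm')

end Univ

/-! ### Finite subsets of linear orders -/

/-- `X` is a linear order on a set of elements of `M`. -/
structure Small (X : ClassOrder M) : Prop where
  linear : X.IsLinear
  bdd : ∃ A, ∀ x, X.mem x → x ∈ᴹ A
  pr_mem : PR M X.mem
  pr_lt : PR M (fun z : M × M => X.lt z.1 z.2)

/-- `a` is a finite subset of `X`. -/
def FinSub (X : ClassOrder M) (a : M) : Prop := ∃ n e, Enum X a n e

namespace Enum

variable {X Y : ClassOrder M} {a n e : M}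

theorem fin (h : Enum X a n e) : FinSub X a := ⟨n, e, h⟩

theorem app_mem (h : Enum X a n e) {i : M} (hi : i ∈ᴹ n) : app e i ∈ᴹ a := (h.2.2.2.1 _).2 ⟨i, hi, rfl⟩

theorem exists_index (h : Enum X a n e) {x : M} (hx : x ∈ᴹ a) : ∃ i, i ∈ᴹ n ∧ x = app e i :=
  (h.2.2.2.1 _).1 hx

theorem mem (h : Enum X a n e) {x : M} (hx : x ∈ᴹ a) : X.mem x := h.2.2.1 x hx

theorem lt_iff (h : Enum X a n e) (hX : X.IsLinear) {i j : M} (hi : i ∈ᴹ n) (hj : j ∈ᴹ n) :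
    X.lt (app e i) (app e j) ↔ i ∈ᴹ j := by
  refine ⟨fun hl => ?_, h.2.2.2.2 i j hi hj⟩
  have hi' := h.mem (h.app_mem hi)
  have hj' := h.mem (h.app_mem hj)
  rcases (isOrd_of_mem_om (om_trans h.1 hi)).trichotomy (isOrd_of_mem_om (om_trans h.1 hj))
    with h1 | rfl | h1
  · exact h1
  · exact absurd hl (hX.1 _ hi')
  · exact absurd (hX.2.1 _ _ _ hi' hj' hi' hl (h.2.2.2.2 j i hj hi h1)) (hX.1 _ hi')

theorem inj (h : Enum X a n e) (hX : X.IsLinear) {i j : M} (hi : i ∈ᴹ n) (hj : j ∈ᴹ n)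
    (hij : app e i = app e j) : i = j := by
  have hi' := h.mem (h.app_mem hi)
  rcases (isOrd_of_mem_om (om_trans h.1 hi)).trichotomy (isOrd_of_mem_om (om_trans h.1 hj))
    with h1 | rfl | h1
  · have := h.2.2.2.2 i j hi hj h1
    rw [← hij] at this
    exact absurd this (hX.1 _ hi')
  · rfl
  · have := h.2.2.2.2 j i hj hi h1
    rw [← hij] at this
    exact absurd this (hX.1 _ hi')

theorem image (h : Enum X a n e) {H : M → M} (hH : PR M H) (h1 : ∀ x, x ∈ᴹ a → Y.mem (H x))
    (h2 : ∀ x y, x ∈ᴹ a → y ∈ᴹ a → X.lt x y → Y.lt (H x) (H y)) {b : M}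
    (hb : ∀ y, y ∈ᴹ b ↔ ∃ x, x ∈ᴹ a ∧ y = H x) :
    ∃ e', Enum Y b n e' ∧ ∀ i, i ∈ᴹ n → app e' i = H (app e i) := by
  obtain ⟨e', he', hv⟩ := exists_fun n (F := fun i => H (app e i)) (by fun_prop)
  refine ⟨e', ⟨h.1, he', fun y hy => ?_, fun y => ?_, fun i j hi hj hij => ?_⟩, hv⟩
  · obtain ⟨x, hx, rfl⟩ := (hb y).1 hy
    exact h1 x hx
  · rw [hb]
    constructor
    · rintro ⟨x, hx, rfl⟩
      obtain ⟨i, hi, rfl⟩ := h.exists_index hx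
      exact ⟨i, hi, (hv i hi).symm⟩
    · rintro ⟨i, hi, rfl⟩
      exact ⟨_, h.app_mem hi, hv i hi⟩
  · rw [hv i hi, hv j hj]
    exact h2 _ _ (h.app_mem hi) (h.app_mem hj) (h.2.2.2.2 i j hi hj hij)

theorem mem_univ (h : Enum X a n e) {U : M} (hU : Univ U) (ha : ∀ x, x ∈ᴹ a → x ∈ᴹ U) :
    e ∈ᴹ U ∧ a ∈ᴹ U :=
  ⟨hU.fun_mem h.1 h.2.1 fun _ hi => ha _ (h.app_mem hi), hU.finite_mem h.1 h.2.2.2.1 ha⟩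

open Classical in
theorem append (h : Enum X a n e) {y : M} (hy : X.mem y) (hlt : ∀ x, x ∈ᴹ a → X.lt x y) :
    ∃ e', Enum X (adj a y) (adj n n) e' := by
  obtain ⟨e', he', hv⟩ := exists_fun (adj n n) (F := fun i => if i ∈ᴹ n then app e i else y)
    (by fun_prop)
  have hv1 : ∀ i, i ∈ᴹ n → app e' i = app e i := fun i hi => by
    rw [hv i (by simp [hi]), if_pos hi]
  have hv2 : app e' n = y := by rw [hv n (by simp), if_neg (not_mem_self n)]
  refine ⟨e', succ_mem_om h.1, he', fun x hx => ?_, fun x => ?_, fun i j hi hj hij => ?_⟩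
  · rcases mem_adj.1 hx with hx | rfl
    · exact h.mem hx
    · exact hy
  · rw [mem_adj]
    constructor
    · rintro (hx | rfl)
      · obtain ⟨i, hi, rfl⟩ := h.exists_index hx
        exact ⟨i, by simp [hi], (hv1 i hi).symm⟩
      · exact ⟨n, by simp, hv2.symm⟩
    · rintro ⟨i, hi, rfl⟩
      rcases mem_adj.1 hi with hi | rfl
      · exact Or.inl (by rw [hv1 i hi]; exact h.app_mem hi)
      · exact Or.inr hv2
  · rcases mem_adj.1 hj with hj | rfl
    · have hi' := (isOrd_of_mem_om h.1).1 _ hj _ hij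
      rw [hv1 i hi', hv1 j hj]
      exact h.2.2.2.2 i j hi' hj hij
    · rw [hv1 i hij, hv2]
      exact hlt _ (h.app_mem hij)

theorem restrict (hn : n ∈ᴹ om) (h : Enum X a (adj n n) e) : ∃ a' e', Enum X a' n e' ∧
    a = adj a' (app e n) ∧ ∀ x, x ∈ᴹ a' → X.lt x (app e n) := by
  obtain ⟨a', ha'⟩ := exists_image n (F := fun i => app e i) (by fun_prop)
  obtain ⟨e', he', hv⟩ := exists_fun n (F := fun i => app e i) (by fun_prop)
  refine ⟨a', e', ⟨hn, he', fun x hx => ?_, fun x => ?_, fun i j hi hj hij => ?_⟩,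
    ext fun x => ?_, fun x hx => ?_⟩
  · obtain ⟨i, hi, rfl⟩ := (ha' x).1 hx
    exact h.mem (h.app_mem (by simp [hi]))
  · rw [ha']
    exact exists_congr fun i => and_congr_right fun hi => by rw [hv i hi]
  · rw [hv i hi, hv j hj]
    exact h.2.2.2.2 i j (by simp [hi]) (by simp [hj]) hij
  · rw [h.2.2.2.1, mem_adj, ha']
    constructor
    · rintro ⟨i, hi, rfl⟩
      rcases mem_adj.1 hi with hi | rfl
      · exact Or.inl ⟨i, hi, rfl⟩
      · exact Or.inr rfl
    · rintro (⟨i, hi, rfl⟩ | rfl)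
      · exact ⟨i, by simp [hi], rfl⟩
      · exact ⟨n, by simp, rfl⟩
  · obtain ⟨i, hi, rfl⟩ := (ha' x).1 hx
    exact h.2.2.2.2 i n (by simp [hi]) (by simp) hi

theorem exists_inclHom (hX : X.IsLinear) (h : Enum X a n e) {b m e' : M} (h' : Enum X b m e')
    (hab : ∀ x, x ∈ᴹ a → x ∈ᴹ b) :
    ∃ f, NatHom n m f ∧ ∀ i, i ∈ᴹ n → app e' (app f i) = app e i := by
  obtain ⟨f, hf, hv⟩ := exists_fun_of_rel n m (R := fun i j => j ∈ᴹ m ∧ app e' j = app e i)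
    (by fun_prop) (fun i hi => by
      obtain ⟨j, hj, e⟩ := h'.exists_index (hab _ (h.app_mem hi))
      exact ⟨j, hj, hj, e.symm⟩)
    (fun i j j' hi hj hj' => h'.inj hX hj.1 hj'.1 (hj.2.trans hj'.2.symm))
  · refine ⟨f, ⟨h.1, h'.1, hf, fun i hi => (hv i hi).1, fun i j hi hj hij => ?_⟩,
      fun i hi => (hv i hi).2.2⟩
    rw [← h'.lt_iff hX (hv i hi).1 (hv j hj).1, (hv i hi).2.2, (hv j hj).2.2]
    exact h.2.2.2.2 i j hi hj hij

/-- The comparison morphism `f` between the two enumerations is strictly increasing and surjective.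
By induction along `n` such a map is the identity. -/
theorem unique (hX : X.IsLinear) (h : Enum X a n e) {m e' : M} (h' : Enum X a m e') :
    n = m ∧ e = e' := by
  obtain ⟨f, hf, hv⟩ := h.exists_inclHom hX h' fun _ => id
  have hsurj : ∀ j, j ∈ᴹ m → ∃ i, i ∈ᴹ n ∧ app f i = j := fun j hj => by
    obtain ⟨i, hi, e⟩ := h.exists_index (h'.app_mem hj)
    exact ⟨i, hi, h'.inj hX (hf.2.2.2.1 i hi) hj ((hv i hi).trans e.symm)⟩
  have hno := isOrd_of_mem_om h.1
  have hmo := isOrd_of_mem_om h'.1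
  have key : ∀ i, i ∈ᴹ n → app f i = i := by
    refine mem_induction (P := fun i => app f i = i) (by fun_prop) fun i hi ih => ?_
    have ih' : ∀ j, j ∈ᴹ i → app f j = j := fun j hj => ih j hj (hno.1 i hi j hj)
    rcases (hno.mem hi).trichotomy (hmo.mem (hf.2.2.2.1 i hi)) with h1 | h1 | h1
    · obtain ⟨j, hj, e⟩ := hsurj i (hmo.1 _ (hf.2.2.2.1 i hi) i h1)
      rcases (hno.mem hi).trichotomy (hno.mem hj) with h2 | rfl | h2
      · have := hf.2.2.2.2 i j hi hj h2
        rw [e] at this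
        exact absurd h1 (not_mem_mem this)
      · exact e
      · rw [ih' j h2] at e
        subst e
        exact absurd h2 (not_mem_self _)
    · exact h1.symm
    · have h2 := hno.1 i hi _ h1
      have := hf.2.2.2.2 _ i h2 hi h1
      rw [ih' _ h1] at this
      exact absurd this (not_mem_self _)
  have hnm : n = m := ATRSet.ext fun i => by
    constructor
    · intro hi
      rw [← key i hi]
      exact hf.2.2.2.1 i hi
    · intro hi
      obtain ⟨j, hj, rfl⟩ := hsurj i hi
      rw [key j hj]
      exact hj
  subst hnm
  exact ⟨rfl, h.2.1.ext h'.2.1 fun i hi => by rw [← hv i hi, key i hi]⟩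

end Enum

@[fun_prop]
theorem PR.enum {X : Γ → ClassOrder M} {a n e : Γ → M} (ha : PR M a) (hn : PR M n) (he : PR M e)
    (hm : PR M (fun z : Γ × M => (X z.1).mem z.2))
    (hl : PR M (fun z : Γ × M × M => (X z.1).lt z.2.1 z.2.2)) :
    PR M (fun z => Enum (X z) (a z) (n z) (e z)) := by
  unfold Enum
  refine PR.and (by fun_prop) (PR.and (by fun_prop) (PR.and (PR.all_mem (by fun_prop) hm) (PR.and
    (PR.congr (Q := fun z => (∀ x, x ∈ᴹ a z → ∃ i, i ∈ᴹ n z ∧ x = ATRSet.app (e z) i) ∧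
      ∀ i, i ∈ᴹ n z → ATRSet.app (e z) i ∈ᴹ a z) (PR.and
        (PR.all_mem (by fun_prop) (PR.ex_mem (by fun_prop) (by fun_prop)))
        (PR.all_mem (by fun_prop) (by fun_prop))) fun z => ?_)
    (PR.congr (Q := fun z => ∀ i, i ∈ᴹ n z → ∀ j, j ∈ᴹ n z → i ∈ᴹ j →
      (X z).lt (ATRSet.app (e z) i) (ATRSet.app (e z) j)) (PR.all_mem (by fun_prop)
        (PR.all_mem (by fun_prop) (PR.imp (by fun_prop) (hl.comp (f := fun z : (Γ × M) × M =>
          (z.1.1, ATRSet.app (e z.1.1) z.1.2, ATRSet.app (e z.1.1) z.2)) (by fun_prop))))) fun z => ?_))))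
  · constructor
    · exact fun h => ⟨fun x hx => (h x).1 hx, fun i hi => (h _).2 ⟨i, hi, rfl⟩⟩
    · exact fun h x => ⟨fun hx => h.1 x hx, by rintro ⟨i, hi, rfl⟩; exact h.2 i hi⟩
  · exact ⟨fun h i hi j hj => h i j hi hj, fun h i j hi hj => h i hi j hj⟩

theorem PR.finSub {X : Γ → ClassOrder M} {a : Γ → M} (ha : PR M a)
    (hm : PR M (fun z : Γ × M => (X z.1).mem z.2))
    (hl : PR M (fun z : Γ × M × M => (X z.1).lt z.2.1 z.2.2)) :
    PR M (fun z => FinSub (X z) (a z)) := by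
  refine PR.ex (u := fun _ => om) (by fun_prop) (fun z n ⟨e, h⟩ => h.1)
    (PR.ex (u := fun z => ATRSet.univ (a z.1)) (by fun_prop) (fun z e h => ?_) ?_)
  · exact (h.mem_univ (univ_univ _) fun x hx => (univ_univ _).trans (mem_univ_self _) hx).1
  · exact PR.enum (X := fun z : (Γ × M) × M => X z.1.1) (by fun_prop) (by fun_prop) (by fun_prop)
      (hm.comp (f := fun z : ((Γ × M) × M) × M => (z.1.1.1, z.2)) (by fun_prop))
      (hl.comp (f := fun z : ((Γ × M) × M) × M × M => (z.1.1.1, z.2)) (by fun_prop))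

namespace Small

variable {X : ClassOrder M} (hX : Small X)
include hX

theorem pr_enum {a n e : Γ → M} (ha : PR M a) (hn : PR M n) (he : PR M e) :
    PR M (fun z => Enum X (a z) (n z) (e z)) :=
  PR.enum (X := fun _ => X) ha hn he (hX.pr_mem.comp (by fun_prop))
    (hX.pr_lt.comp (f := fun z : Γ × M × M => z.2) (by fun_prop))

theorem pr_finSub {a : Γ → M} (ha : PR M a) : PR M (fun z => FinSub X (a z)) :=
  PR.finSub (X := fun _ => X) ha (hX.pr_mem.comp (by fun_prop))
    (hX.pr_lt.comp (f := fun z : Γ × M × M => z.2) (by fun_prop))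

/-- Induction on the number of elements, where the maximum is split off in each step. Finite subsets
of a bounded order and their enumerations all lie in one set `univ A`, which bounds the quantifiers
in the induction statement. -/
theorem finSub_induction {P : M → Prop} (hP : PR M P) (h0 : P empty)
    (hs : ∀ a y, FinSub X a → X.mem y → (∀ x, x ∈ᴹ a → X.lt x y) → P a → P (adj a y)) :
    ∀ a, FinSub X a → P a := by
  obtain ⟨A, hA⟩ := hX.bdd
  have hU := univ_univ A
  have hAU : ∀ x, X.mem x → x ∈ᴹ univ A := fun x hx => hU.trans (mem_univ_self A) (hA x hx)
  have key : ∀ n, n ∈ᴹ om → ∀ a, a ∈ᴹ univ A → ∀ e, e ∈ᴹ univ A → Enum X a n e → P a := by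
    refine om_induction (P := fun n => ∀ a, a ∈ᴹ univ A → ∀ e, e ∈ᴹ univ A → Enum X a n e → P a)
      (PR.all_mem (by fun_prop) (PR.all_mem (by fun_prop) (PR.imp
        (hX.pr_enum (by fun_prop) (by fun_prop) (by fun_prop)) (by fun_prop))))
      (fun a _ e _ h => ?_) (fun n hn ih a _ e _ h => ?_)
    · rwa [show a = empty from ext fun x => by rw [h.2.2.2.1]; simp]
    · obtain ⟨a', e', h', rfl, hlt⟩ := h.restrict hn
      have hU' := h'.mem_univ hU fun x hx => hAU x (h'.mem hx)
      exact hs _ _ h'.fin (h.mem (by simp)) hlt (ih a' hU'.2 e' hU'.1 h')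
  rintro a ⟨n, e, h⟩
  have hU' := h.mem_univ hU fun x hx => hAU x (h.mem hx)
  exact key n h.1 a hU'.2 e hU'.1 h

/-- Enumerations can only be extended at the top. If `x` is not above the maximum `y`, it is first
inserted into the rest of the set by the induction hypothesis, and `y` is put back on top. -/
theorem finSub_adj {a x : M} (ha : FinSub X a) (hx : X.mem x) : FinSub X (adj a x) := by
  refine hX.finSub_induction (P := fun a => FinSub X (adj a x)) (hX.pr_finSub (by fun_prop)) ?_
    (fun a y ⟨n, e, ha⟩ hy hlt ⟨n', e', ih⟩ => ?_) a ha
  · obtain ⟨e, he⟩ := exists_fun (empty : M) (F := fun x => x) (by fun_prop)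
    obtain ⟨e', h⟩ := Enum.append (X := X) (a := empty) (n := empty) (e := e)
      ⟨by simp, he.1, by simp, by simp, by simp⟩ hx (by simp)
    exact h.fin
  · obtain ⟨e1, h1⟩ := ha.append hy hlt
    rcases hX.linear.2.2 x y hx hy with h | rfl | h
    · obtain ⟨e2, h2⟩ := ih.append hy (fun z hz => by
        rcases mem_adj.1 hz with hz | rfl
        · exact hlt z hz
        · exact h)
      rw [show adj (adj a y) x = adj (adj a x) y from ext fun z => by simp [or_right_comm]]
      exact h2.fin
    · rw [show adj (adj a x) x = adj a x from ext fun z => by simp]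
      exact ih.fin
    · obtain ⟨e2, h2⟩ := h1.append hx (fun z hz => by
        rcases mem_adj.1 hz with hz | rfl
        · exact hX.linear.2.1 _ _ _ (ha.mem hz) hy hx (hlt z hz) h
        · exact h)
      exact h2.fin

theorem finSub_cup {a b : M} (ha : FinSub X a) (hb : FinSub X b) : FinSub X (cup a b) := by
  refine hX.finSub_induction (P := fun b => FinSub X (cup a b)) (hX.pr_finSub (by fun_prop)) ?_
    (fun b y _ hy _ ih => ?_) b hb
  · rwa [show cup a empty = a from ext fun z => by simp]
  · rw [show cup a (adj b y) = adj (cup a b) y from ext fun z => by simp [or_assoc]]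
    exact hX.finSub_adj ih hy

end Small

theorem ordOrder_small {α : M} (hα : IsOrd α) : Small (ordOrder α) :=
  ⟨ordOrder_linear hα, ⟨α, fun _ h => h⟩, by unfold ordOrder; fun_prop, by unfold ordOrder; fun_prop⟩

/-! ### Quantifiers over components of pairs -/

theorem left_mem_univ {x y z : M} (h : z = pair x y) : x ∈ᴹ univ z :=
  (univ_univ z).left (y := y) (by rw [← h]; exact mem_univ_self z)

theorem right_mem_univ {x y z : M} (h : z = pair x y) : y ∈ᴹ univ z :=
  (univ_univ z).right (x := x) (by rw [← h]; exact mem_univ_self z)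

theorem PR.exists_pair {f : Γ → M} {P : Γ → M → M → Prop} (hf : PR M f)
    (hP : PR M (fun z : (Γ × M) × M => P z.1.1 z.1.2 z.2)) :
    PR M (fun z => ∃ x y, f z = ATRSet.pair x y ∧ P z x y) :=
  PR.ex (u := fun z => ATRSet.univ (f z)) (by fun_prop) (fun _ _ ⟨_, h, _⟩ => left_mem_univ h)
    (PR.ex (u := fun z : Γ × M => ATRSet.univ (f z.1)) (by fun_prop)
      (fun _ _ h => right_mem_univ h.1) (PR.and (by fun_prop) hP))

theorem PR.exists_eq_pair {f g : Γ → M} {P : Γ → M → Prop} (hf : PR M f) (hg : PR M g)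
    (hP : PR M (fun z : Γ × M => P z.1 z.2)) :
    PR M (fun z => ∃ y, f z = ATRSet.pair (g z) y ∧ P z y) :=
  PR.ex (u := fun z : Γ => ATRSet.univ (f z)) (by fun_prop)
      (fun _ _ h => right_mem_univ h.1) (by fun_prop)

/-! ### Order sums -/

theorem PR.add_mem {X Y : Γ → ClassOrder M}
    (hX : PR M (fun z : Γ × M => (X z.1).mem z.2))
    (hY : PR M (fun z : Γ × M => (Y z.1).mem z.2)) :
    PR M (fun z : Γ × M => ((X z.1).add (Y z.1)).mem z.2) := by
  unfold ClassOrder.add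
  refine PR.or (PR.congr (PR.exists_eq_pair (f := fun z : Γ × M => z.2) (g := fun _ => ATRSet.empty)
    (P := fun z x => (X z.1).mem x) (by fun_prop) (by fun_prop) ?_) fun z => ?_)
    (PR.congr (PR.exists_eq_pair (f := fun z : Γ × M => z.2) (g := fun _ => ATRSet.adj ATRSet.empty ATRSet.empty)
    (P := fun z x => (Y z.1).mem x) (by fun_prop) (by fun_prop) ?_) fun z => ?_)
  · exact hX.comp (f := fun z : (Γ × M) × M => (z.1.1, z.2)) (by fun_prop)
  · simp only [and_comm]
  · exact hY.comp (f := fun z : (Γ × M) × M => (z.1.1, z.2)) (by fun_prop)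
  · simp only [and_comm]

theorem PR.add_lt {X Y : Γ → ClassOrder M}
    (hX : PR M (fun z : Γ × M × M => (X z.1).lt z.2.1 z.2.2))
    (hY : PR M (fun z : Γ × M × M => (Y z.1).lt z.2.1 z.2.2)) :
    PR M (fun z : Γ × M × M => ((X z.1).add (Y z.1)).lt z.2.1 z.2.2) := by
  unfold ClassOrder.add
  have key : ∀ (c d : M) (P : Γ → M → M → Prop), PR M (fun z : Γ × M × M => P z.1 z.2.1 z.2.2) →
      PR M (fun z : Γ × M × M => ∃ x y, z.2.1 = ATRSet.pair c x ∧ z.2.2 = ATRSet.pair d y ∧ P z.1 x y) := by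
    intro c d P hP
    refine PR.congr (PR.exists_eq_pair (f := fun z : Γ × M × M => z.2.1) (g := fun _ => c)
      (P := fun z x => ∃ y, z.2.2 = ATRSet.pair d y ∧ P z.1 x y) (by fun_prop) (by fun_prop)
      (PR.exists_eq_pair (f := fun z : (Γ × M × M) × M => z.1.2.2) (g := fun _ => d)
        (P := fun z y => P z.1.1 z.2 y) (by fun_prop) (by fun_prop) ?_)) fun z => ?_
    · exact hP.comp (f := fun z : ((Γ × M × M) × M) × M => (z.1.1.1, z.1.2, z.2)) (by fun_prop)
    · simp only [exists_and_left]
  have h1 := key empty empty (fun z x y => (X z).lt x y) hX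
  have h2 := key empty (ATRSet.adj empty empty) (fun _ _ _ => True) (by fun_prop)
  have h3 := key (ATRSet.adj empty empty) (ATRSet.adj empty empty) (fun z x y => (Y z).lt x y) hY
  simp only [and_true] at h2
  exact h1.or (h2.or h3)

theorem empty_ne_one : (empty : M) ≠ adj empty empty :=
  fun h => not_mem_empty (empty : M) (by conv_rhs => rw [h]
                                         simp)

section add

variable {X Y : ClassOrder M}

theorem add_mem_left {x : M} : (X.add Y).mem (pair empty x) ↔ X.mem x := by
  simp [ClassOrder.add, empty_ne_one]

theorem add_mem_right {x : M} : (X.add Y).mem (pair (adj empty empty) x) ↔ Y.mem x := by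
  simp [ClassOrder.add, empty_ne_one.symm]

theorem add_lt_left {x y : M} : (X.add Y).lt (pair empty x) (pair empty y) ↔ X.lt x y := by
  simp [ClassOrder.add, empty_ne_one]

theorem add_lt_right {x y : M} :
    (X.add Y).lt (pair (adj empty empty) x) (pair (adj empty empty) y) ↔ Y.lt x y := by
  simp [ClassOrder.add, empty_ne_one.symm]

theorem add_lt_left_right {x y : M} : (X.add Y).lt (pair empty x) (pair (adj empty empty) y) := by
  simp [ClassOrder.add]

theorem not_add_lt_right_left {x y : M} :
    ¬ (X.add Y).lt (pair (adj empty empty) x) (pair empty y) := by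
  simp [ClassOrder.add, empty_ne_one, empty_ne_one.symm]

theorem add_linear (hX : X.IsLinear) (hY : Y.IsLinear) : (X.add Y).IsLinear := by
  refine ⟨?_, ?_, ?_⟩
  · rintro _ (⟨x, hx, rfl⟩ | ⟨x, hx, rfl⟩)
    · rw [add_lt_left]; exact hX.1 x hx
    · rw [add_lt_right]; exact hY.1 x hx
  · rintro _ _ _ (⟨x, hx, rfl⟩ | ⟨x, hx, rfl⟩) (⟨y, hy, rfl⟩ | ⟨y, hy, rfl⟩)
      (⟨z, hz, rfl⟩ | ⟨z, hz, rfl⟩) <;>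
      simp only [add_lt_left, add_lt_right, add_lt_left_right, not_add_lt_right_left,
        false_imp_iff, imp_true_iff]
    · exact hX.2.1 x y z hx hy hz
    · exact hY.2.1 x y z hx hy hz
  · rintro _ _ (⟨x, hx, rfl⟩ | ⟨x, hx, rfl⟩) (⟨y, hy, rfl⟩ | ⟨y, hy, rfl⟩) <;>
      simp only [add_lt_left, add_lt_right, add_lt_left_right, not_add_lt_right_left,
        pair_inj, true_and, true_or, or_true]
    · exact hX.2.2 x y hx hy
    · exact hY.2.2 x y hx hy

theorem Small.add (hX : Small X) (hY : Small Y) : Small (X.add Y) := by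
  obtain ⟨A, hA⟩ := hX.bdd
  obtain ⟨B, hB⟩ := hY.bdd
  refine ⟨add_linear hX.linear hY.linear, ⟨univ (pair A B), ?_⟩, ?_, ?_⟩
  · have hU := univ_univ (pair A B)
    obtain ⟨h1, h2⟩ := hU.pair_mem_iff.1 (mem_univ_self (pair A B))
    rintro z (⟨x, hx, rfl⟩ | ⟨x, hx, rfl⟩)
    · exact hU.pair hU.empty (hU.trans h1 (hA x hx))
    · exact hU.pair (hU.adj hU.empty hU.empty) (hU.trans h2 (hB x hx))
  · exact (PR.add_mem (Γ := M) (X := fun _ => X) (Y := fun _ => Y) (hX.pr_mem.comp (by fun_prop))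
      (hY.pr_mem.comp (by fun_prop))).comp (f := fun x => (x, x)) (by fun_prop)
  · exact (PR.add_lt (Γ := M) (X := fun _ => X) (Y := fun _ => Y)
      (hX.pr_lt.comp (f := fun z : M × M × M => z.2) (by fun_prop))
      (hY.pr_lt.comp (f := fun z : M × M × M => z.2) (by fun_prop))).comp
        (f := fun x : M × M => (x.1, x)) (by fun_prop)

end add

theorem NatHom.ext {m n f g : M} (hf : NatHom m n f) (hg : NatHom m n g)
    (h : ∀ i, i ∈ᴹ m → app f i = app g i) : f = g := hf.2.2.1.ext hg.2.2.1 h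

/-! ### Extension of predilators to linear orders -/

namespace Predil

/-- The part of the definition of a predilator that is needed to extend it to linear orders. -/
structure WPre (D : Predil M) : Prop where
  linear : ∀ n, n ∈ᴹ om → (D.ob n).IsLinear
  map_fun : ∀ m n f σ, NatHom m n f → D.El m σ → ∃! τ, D.map m n f σ τ
  map_mem : ∀ m n f σ τ, NatHom m n f → D.El m σ → D.map m n f σ τ → D.El n τ
  map_lt : ∀ m n f σ σ' τ τ', NatHom m n f → D.El m σ → D.El m σ' →
    D.map m n f σ τ → D.map m n f σ' τ' → D.lt m σ σ' → D.lt n τ τ'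
  map_comp : ∀ k m n f g h ρ σ τ, NatHom k m f → NatHom m n g → NatHom k n h →
    (∀ i, i ∈ᴹ k → app h i = app g (app f i)) → D.El k ρ →
    D.map k m f ρ σ → D.map m n g σ τ → D.map k n h ρ τ
  supp_sub : ∀ n σ i, n ∈ᴹ om → D.El n σ → D.supp n σ i → i ∈ᴹ n
  supp_nat : ∀ m n f σ τ, NatHom m n f → D.El m σ → D.map m n f σ τ →
    ∀ j, D.supp n τ j ↔ ∃ i, D.supp m σ i ∧ app f i = j

theorem IsPredilator.wPre {D : Predil M} (h : D.IsPredilator) : D.WPre :=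
  ⟨h.linear, h.map_fun, h.map_mem, h.map_lt, h.map_comp, h.supp_sub, h.supp_nat⟩

namespace WPre

variable {D : Predil M} (hD : D.WPre)
include hD

theorem map_lt_iff {m n f σ σ' τ τ' : M} (hf : NatHom m n f) (h : D.El m σ) (h' : D.El m σ')
    (hm : D.map m n f σ τ) (hm' : D.map m n f σ' τ') : D.lt m σ σ' ↔ D.lt n τ τ' := by
  refine ⟨hD.map_lt _ _ _ _ _ _ _ hf h h' hm hm', fun hlt => ?_⟩
  have hτ := hD.map_mem _ _ _ _ _ hf h hm
  have hτ' := hD.map_mem _ _ _ _ _ hf h' hm'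
  have hl := hD.linear n hf.2.1
  rcases (hD.linear m hf.1).2.2 σ σ' h h' with h1 | rfl | h1
  · exact h1
  · rw [(hD.map_fun _ _ _ _ hf h).unique hm hm'] at hlt
    exact absurd hlt (hl.1 _ hτ')
  · exact absurd (hl.2.1 _ _ _ hτ hτ' hτ hlt (hD.map_lt _ _ _ _ _ _ _ hf h' h hm' hm h1))
      (hl.1 _ hτ)

theorem map_inj {m n f σ σ' τ : M} (hf : NatHom m n f) (h : D.El m σ) (h' : D.El m σ')
    (hm : D.map m n f σ τ) (hm' : D.map m n f σ' τ) : σ = σ' := by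
  have hτ := hD.map_mem _ _ _ _ _ hf h hm
  have hl := (hD.linear n hf.2.1).1 τ hτ
  rcases (hD.linear m hf.1).2.2 σ σ' h h' with h1 | rfl | h1
  · exact absurd ((hD.map_lt_iff hf h h' hm hm').1 h1) hl
  · rfl
  · exact absurd ((hD.map_lt_iff hf h' h hm' hm).1 h1) hl

end WPre

/-- The element `p` of `D(X)` with support contained in the finite set `c` corresponds to the
element `v` of `D(n)` for `n = |c|`. -/
def Val (D : Predil M) (X : ClassOrder M) (p c n v : M) : Prop :=
  ∃ σ a k e e' f, p = pair σ a ∧ Enum X a k e ∧ Enum X c n e' ∧ D.Tr σ k ∧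
    (∀ x, x ∈ᴹ a → x ∈ᴹ c) ∧ NatHom k n f ∧ (∀ i, i ∈ᴹ k → app e' (app f i) = app e i) ∧
    D.map k n f σ v

@[simp] theorem extSupp_pair {σ a x : M} : extSupp (pair σ a) x ↔ x ∈ᴹ a := by
  simp [extSupp]

theorem ext_mem_supp {D : Predil M} {X : ClassOrder M} {p x : M} (h : (D.ext X).mem p)
    (hx : extSupp p x) : X.mem x := by
  obtain ⟨σ, a, n, e, rfl, he, hσ⟩ := h
  exact he.mem (extSupp_pair.1 hx)

section

variable {D : Predil M} {X : ClassOrder M} {p q c n v w : M}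

theorem exists_val (hD : D.WPre) (hX : X.IsLinear) (hp : (D.ext X).mem p) {e : M}
    (hc : Enum X c n e) (hpc : ∀ x, extSupp p x → x ∈ᴹ c) : ∃ v, D.Val X p c n v := by
  obtain ⟨σ, a, k, ea, rfl, he, hσ⟩ := hp
  have hac : ∀ x, x ∈ᴹ a → x ∈ᴹ c := fun x hx => hpc x (extSupp_pair.2 hx)
  obtain ⟨f, hf, hv⟩ := he.exists_inclHom hX hc hac
  obtain ⟨v, hv', -⟩ := hD.map_fun _ _ _ _ hf hσ.2.1
  exact ⟨v, σ, a, k, ea, e, f, rfl, he, hc, hσ, hac, hf, hv, hv'⟩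

theorem Val.el (hD : D.WPre) (h : D.Val X p c n v) : D.El n v := by
  obtain ⟨σ, a, k, e, e', f, -, -, -, hσ, -, hf, -, hm⟩ := h
  exact hD.map_mem _ _ _ _ _ hf hσ.2.1 hm

/-- The support of `v` in `D(n)` recovers the finite set `a`: since `(σ, k)` lies in the trace,
naturality makes this support the range of the inclusion of `a` into `c`. Once the finite sets of
`p` and `q` agree, so do the inclusions, and `D(f)` is injective. -/
theorem Val.eq (hD : D.WPre) (hX : X.IsLinear) (h : D.Val X p c n v) (h' : D.Val X q c n v) :
    p = q := by
  obtain ⟨σ, a, k, e, e₁, f, rfl, he, he₁, hσ, -, hf, hv, hm⟩ := h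
  obtain ⟨τ, b, m, e', e₂, g, rfl, he', he₂, hτ, -, hg, hw, hm'⟩ := h'
  obtain ⟨-, rfl⟩ := he₁.unique hX he₂
  have key : ∀ {σ a k e f τ b m e' g : M}, Enum X a k e → Enum X b m e' → D.Tr σ k → D.Tr τ m →
      NatHom k n f → NatHom m n g → (∀ i, i ∈ᴹ k → app e₁ (app f i) = app e i) →
      (∀ i, i ∈ᴹ m → app e₁ (app g i) = app e' i) → D.map k n f σ v → D.map m n g τ v →
      ∀ x, x ∈ᴹ a → x ∈ᴹ b := by
    intro σ a k e f τ b m e' g he he' hσ hτ hf hg hv hw hm hm' x hx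
    obtain ⟨i, hi, rfl⟩ := he.exists_index hx
    have h1 := (hD.supp_nat _ _ _ _ _ hf hσ.2.1 hm (app f i)).2 ⟨i, hσ.2.2 i hi, rfl⟩
    obtain ⟨j, hj, e⟩ := (hD.supp_nat _ _ _ _ _ hg hτ.2.1 hm' _).1 h1
    have hj' := hD.supp_sub _ _ _ hτ.1 hτ.2.1 hj
    rw [← hv i hi, ← e, hw j hj']
    exact he'.app_mem hj'
  obtain rfl : a = b := ATRSet.ext fun x =>
    ⟨key he he' hσ hτ hf hg hv hw hm hm' x, key he' he hτ hσ hg hf hw hv hm' hm x⟩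
  obtain ⟨rfl, rfl⟩ := he.unique hX he'
  obtain rfl : f = g := hf.ext hg fun i hi => he₁.inj hX (hf.2.2.2.1 i hi) (hg.2.2.2.1 i hi)
    ((hv i hi).trans (hw i hi).symm)
  rw [hD.map_inj hf hσ.2.1 hτ.2.1 hm hm']

theorem Val.unique (hD : D.WPre) (hX : X.IsLinear) (h : D.Val X p c n v) (h' : D.Val X p c n w) :
    v = w := by
  obtain ⟨σ, a, k, e, e₁, f, rfl, he, he₁, hσ, -, hf, hv, hm⟩ := h
  obtain ⟨τ, b, m, e', e₂, g, e0, he', he₂, hτ, -, hg, hw, hm'⟩ := h'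
  obtain ⟨rfl, rfl⟩ := pair_inj.1 e0
  obtain ⟨-, rfl⟩ := he₁.unique hX he₂
  obtain ⟨rfl, rfl⟩ := he.unique hX he'
  obtain rfl : f = g := hf.ext hg fun i hi => he₁.inj hX (hf.2.2.2.1 i hi) (hg.2.2.2.1 i hi)
    ((hv i hi).trans (hw i hi).symm)
  exact (hD.map_fun _ _ _ _ hf hσ.2.1).unique hm hm'

/-- Values with respect to different finite sets. -/
theorem Val.trans (hD : D.WPre) (hX : X.IsLinear) {d m g e e' v' : M} (h : D.Val X p c n v)
    (h' : D.Val X p d m v') (he : Enum X c n e) (he' : Enum X d m e') (hg : NatHom n m g)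
    (hge : ∀ i, i ∈ᴹ n → app e' (app g i) = app e i) : D.map n m g v v' := by
  obtain ⟨σ, a, k, ea, e₁, f, rfl, hea, he₁, hσ, hac, hf, hv, hm⟩ := h
  obtain ⟨τ, b, l, eb, e₂, f', e0, heb, he₂, hτ, hbc, hf', hv', hm'⟩ := h'
  obtain ⟨rfl, rfl⟩ := pair_inj.1 e0
  obtain ⟨-, rfl⟩ := he₁.unique hX he
  obtain ⟨-, rfl⟩ := he₂.unique hX he'
  obtain ⟨rfl, rfl⟩ := hea.unique hX heb
  obtain ⟨w, hw, -⟩ := hD.map_fun _ _ _ _ hg (hD.map_mem _ _ _ _ _ hf hσ.2.1 hm)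
  have := hD.map_comp _ _ _ _ _ _ _ _ _ hf hg hf' (fun i hi => ?_) hσ.2.1 hm hw
  · rwa [(hD.map_fun _ _ _ _ hf' hσ.2.1).unique hm' this]
  · exact he₂.inj hX (hf'.2.2.2.1 i hi) (hg.2.2.2.1 _ (hf.2.2.2.1 i hi))
      (by rw [hv' i hi, hge _ (hf.2.2.2.1 i hi), hv i hi])

/-- The order on `D(X)` is defined via the union of the two supports. The inclusion of this union
into `c` induces a map that preserves and reflects the order, so any finite set that contains both
supports gives the same comparison. -/
theorem Val.lt_iff (hD : D.WPre) (hX : Small X) (h : D.Val X p c n v) (h' : D.Val X q c n w) :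
    (D.ext X).lt p q ↔ D.lt n v w := by
  have hv := h
  have hw := h'
  have hXl := hX.linear
  obtain ⟨σ, a, k, ea, e₁, f, rfl, hea, he₁, hσ, hac, hf, -, hm⟩ := h
  obtain ⟨τ, b, m, eb, e₂, f', rfl, heb, he₂, hτ, hbc, hf', -, hm'⟩ := h'
  obtain ⟨-, rfl⟩ := he₁.unique hXl he₂
  obtain ⟨n', e', he'⟩ := hX.finSub_cup hea.fin heb.fin
  obtain ⟨h0, hh0, hh0e⟩ := he'.exists_inclHom hXl he₁ fun x hx => by
    rcases mem_cup.1 hx with hx | hx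
    · exact hac x hx
    · exact hbc x hx
  have hp : (D.ext X).mem (pair σ a) := ⟨σ, a, k, ea, rfl, hea, hσ⟩
  have hq : (D.ext X).mem (pair τ b) := ⟨τ, b, m, eb, rfl, heb, hτ⟩
  obtain ⟨v', hv'⟩ := exists_val hD hXl hp he' (fun x hx => by simp [extSupp_pair.1 hx])
  obtain ⟨w', hw'⟩ := exists_val hD hXl hq he' (fun x hx => by simp [extSupp_pair.1 hx])
  rw [← hD.map_lt_iff hh0 (hv'.el hD) (hw'.el hD) (hv'.trans hD hXl hv he' he₁ hh0 hh0e)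
    (hw'.trans hD hXl hw he' he₁ hh0 hh0e)]
  constructor
  · rintro ⟨σ₁, a₁, τ₁, b₁, e0, e1, c₁, k₁, m₁, n₁, f₁, g₁, σ', τ', hc₁,
      ⟨hf₁, ea₁, ec₁, hea₁, hec₁, hfe₁⟩, ⟨hg₁, eb₁, ec₁', heb₁, hec₁', hge₁⟩, hm₁, hm₁', hlt⟩
    obtain ⟨rfl, rfl⟩ := pair_inj.1 e0
    obtain ⟨rfl, rfl⟩ := pair_inj.1 e1
    obtain rfl : c₁ = cup a b := ATRSet.ext fun x => by rw [hc₁, mem_cup]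
    obtain ⟨rfl, rfl⟩ := hea₁.unique hXl hea
    obtain ⟨rfl, rfl⟩ := heb₁.unique hXl heb
    obtain ⟨rfl, rfl⟩ := hec₁.unique hXl he'
    obtain ⟨-, rfl⟩ := hec₁'.unique hXl hec₁
    have h1 : D.Val X (pair σ a) (cup a b) n₁ σ' :=
      ⟨σ, a, k₁, ea₁, _, f₁, rfl, hea, he', hσ, fun x hx => by simp [hx], hf₁, hfe₁, hm₁⟩
    have h2 : D.Val X (pair τ b) (cup a b) n₁ τ' :=
      ⟨τ, b, m₁, eb₁, _, g₁, rfl, heb, he', hτ, fun x hx => by simp [hx], hg₁, hge₁, hm₁'⟩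
    rwa [hv'.unique hD hXl h1, hw'.unique hD hXl h2]
  · intro hlt
    obtain ⟨σ₁, a₁, k₁, ea₁, e₃, f₁, e0, hea₁, he₃, -, -, hf₁, hfe₁, hm₁⟩ := hv'
    obtain ⟨τ₁, b₁, m₁, eb₁, e₄, g₁, e1, heb₁, he₄, -, -, hg₁, hge₁, hm₁'⟩ := hw'
    obtain ⟨rfl, rfl⟩ := pair_inj.1 e0
    obtain ⟨rfl, rfl⟩ := pair_inj.1 e1
    exact ⟨σ, a, τ, b, rfl, rfl, cup a b, k₁, m₁, n', f₁, g₁, v', w', fun x => mem_cup,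
      ⟨hf₁, ea₁, e₃, hea₁, he₃, hfe₁⟩, ⟨hg₁, eb₁, e₄, heb₁, he₄, hge₁⟩, hm₁, hm₁', hlt⟩

/-- The axioms of linear orders involve at most three elements, so a common finite set for three
elements is enough to transfer them from `D(n)` to `D(X)`. -/
theorem exists_vals (hD : D.WPre) (hX : Small X) {r : M} (hp : (D.ext X).mem p)
    (hq : (D.ext X).mem q) (hr : (D.ext X).mem r) :
    ∃ c n u v w, n ∈ᴹ om ∧ D.Val X p c n u ∧ D.Val X q c n v ∧ D.Val X r c n w := by
  have hp' := hp
  have hq' := hq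
  have hr' := hr
  obtain ⟨σ, a, k, ea, rfl, hea, hσ⟩ := hp
  obtain ⟨τ, b, m, eb, rfl, heb, hτ⟩ := hq
  obtain ⟨ρ, d, l, ed, rfl, hed, hρ⟩ := hr
  obtain ⟨n, e, he⟩ := hX.finSub_cup (hX.finSub_cup hea.fin heb.fin) hed.fin
  obtain ⟨u, hu⟩ := exists_val hD hX.linear hp' he (fun x hx => by simp [extSupp_pair.1 hx])
  obtain ⟨v, hv⟩ := exists_val hD hX.linear hq' he (fun x hx => by simp [extSupp_pair.1 hx])
  obtain ⟨w, hw⟩ := exists_val hD hX.linear hr' he (fun x hx => by simp [extSupp_pair.1 hx])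
  exact ⟨_, n, u, v, w, he.1, hu, hv, hw⟩

theorem ext_linear (hD : D.WPre) (hX : Small X) : (D.ext X).IsLinear := by
  refine ⟨fun p hp => ?_, fun p q r hp hq hr => ?_, fun p q hp hq => ?_⟩
  · obtain ⟨c, n, u, v, w, hn, hu, hv, hw⟩ := exists_vals hD hX hp hp hp
    rw [hu.lt_iff hD hX hu]
    exact (hD.linear n hn).1 u (hu.el hD)
  · obtain ⟨c, n, u, v, w, hn, hu, hv, hw⟩ := exists_vals hD hX hp hq hr
    rw [hu.lt_iff hD hX hv, hv.lt_iff hD hX hw, hu.lt_iff hD hX hw]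
    exact (hD.linear n hn).2.1 u v w (hu.el hD) (hv.el hD) (hw.el hD)
  · obtain ⟨c, n, u, v, w, hn, hu, hv, hw⟩ := exists_vals hD hX hp hq hq
    rw [hu.lt_iff hD hX hv, hv.lt_iff hD hX hu]
    refine ((hD.linear n hn).2.2 u v (hu.el hD) (hv.el hD)).imp id (Or.imp ?_ id)
    rintro rfl
    exact hu.eq hD hX.linear hv

end

section

variable {D : Predil M} {X Y : ClassOrder M} {H : M → M} {σ a τ b a' b' : M}

/-- The action of the extended functor on embeddings. -/
theorem ext_mem_image (hH : PR M H) (h : (D.ext X).mem (pair σ a))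
    (h1 : ∀ x, x ∈ᴹ a → Y.mem (H x))
    (h2 : ∀ x y, x ∈ᴹ a → y ∈ᴹ a → X.lt x y → Y.lt (H x) (H y))
    (ha' : ∀ y, y ∈ᴹ a' ↔ ∃ x, x ∈ᴹ a ∧ y = H x) : (D.ext Y).mem (pair σ a') := by
  obtain ⟨σ₁, a₁, k, ea, e0, hea, hσ⟩ := h
  obtain ⟨rfl, rfl⟩ := pair_inj.1 e0
  obtain ⟨e', he', -⟩ := hea.image hH h1 h2 ha'
  exact ⟨σ, a', k, e', rfl, he', hσ⟩

theorem ext_lt_image (hX : X.IsLinear) (hH : PR M H) (h : (D.ext X).lt (pair σ a) (pair τ b))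
    (h1 : ∀ x, x ∈ᴹ a ∨ x ∈ᴹ b → Y.mem (H x))
    (h2 : ∀ x y, x ∈ᴹ a ∨ x ∈ᴹ b → y ∈ᴹ a ∨ y ∈ᴹ b → X.lt x y → Y.lt (H x) (H y))
    (ha' : ∀ y, y ∈ᴹ a' ↔ ∃ x, x ∈ᴹ a ∧ y = H x) (hb' : ∀ y, y ∈ᴹ b' ↔ ∃ x, x ∈ᴹ b ∧ y = H x) :
    (D.ext Y).lt (pair σ a') (pair τ b') := by
  obtain ⟨σ₁, a₁, τ₁, b₁, e0, e1, c, k, m, n, f, g, σ', τ', hc,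
      ⟨hf, ea, ec, hea, hec, hfe⟩, ⟨hg, eb, ec', heb, hec', hge⟩, hm, hm', hlt⟩ := h
  obtain ⟨rfl, rfl⟩ := pair_inj.1 e0
  obtain ⟨rfl, rfl⟩ := pair_inj.1 e1
  obtain ⟨-, rfl⟩ := hec.unique hX hec'
  obtain ⟨c', hc'⟩ := exists_image c hH
  obtain ⟨ea', hea', hea''⟩ := hea.image (Y := Y) hH (fun x hx => h1 x (Or.inl hx))
    (fun x y hx hy => h2 x y (Or.inl hx) (Or.inl hy)) ha'
  obtain ⟨eb', heb', heb''⟩ := heb.image (Y := Y) hH (fun x hx => h1 x (Or.inr hx))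
    (fun x y hx hy => h2 x y (Or.inr hx) (Or.inr hy)) hb'
  obtain ⟨ec', hec', hec''⟩ := hec.image (Y := Y) hH (fun x hx => h1 x ((hc x).1 hx))
    (fun x y hx hy => h2 x y ((hc x).1 hx) ((hc y).1 hy)) hc'
  refine ⟨σ, a', τ, b', rfl, rfl, c', k, m, n, f, g, σ', τ', fun x => ?_,
    ⟨hf, ea', ec', hea', hec', fun i hi => ?_⟩, ⟨hg, eb', ec', heb', hec', fun i hi => ?_⟩,
    hm, hm', hlt⟩
  · rw [hc', ha', hb']
    simp only [hc, or_and_right, exists_or]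
  · rw [hec'' _ (hf.2.2.2.1 i hi), hfe i hi, hea'' i hi]
  · rw [hec'' _ (hg.2.2.2.1 i hi), hge i hi, heb'' i hi]

/-- Elements of `D(X)` as elements of `D(Y)`, when `X` and `Y` coincide on the supports. -/
theorem ext_mem_of_supp {p : M} (h : (D.ext X).mem p) (h1 : ∀ x, extSupp p x → Y.mem x)
    (h2 : ∀ x y, extSupp p x → extSupp p y → X.lt x y → Y.lt x y) : (D.ext Y).mem p := by
  have h' := h
  obtain ⟨σ, a, k, ea, rfl, hea, hσ⟩ := h
  simp only [extSupp_pair] at h1 h2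
  exact ext_mem_image (H := fun x => x) (by fun_prop) h' h1 h2 (by simp)

theorem ext_lt_of_supp {p q : M} (hX : X.IsLinear) (h : (D.ext X).lt p q)
    (h1 : ∀ x, extSupp p x ∨ extSupp q x → Y.mem x)
    (h2 : ∀ x y, extSupp p x ∨ extSupp q x → extSupp p y ∨ extSupp q y → X.lt x y → Y.lt x y) :
    (D.ext Y).lt p q := by
  have h' := h
  obtain ⟨σ, a, τ, b, rfl, rfl, -⟩ := h
  simp only [extSupp_pair] at h1 h2
  exact ext_lt_image hX (H := fun x => x) (by fun_prop) h' h1 h2 (by simp) (by simp)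

end

/-! ### Initial segments -/

/-- `X` is an initial segment of `Y`. -/
structure _root_.ATRSet.ClassOrder.IniSub (X Y : ClassOrder M) : Prop where
  mem : ∀ {x}, X.mem x → Y.mem x
  lt_iff : ∀ {x y}, X.mem x → X.mem y → (X.lt x y ↔ Y.lt x y)
  down : ∀ {x y}, Y.mem x → X.mem y → Y.lt x y → X.mem x

/-- `D'(n)` is an initial segment of `D(n)`, naturally in `n`. -/
structure Sub (D' D : Predil M) : Prop where
  ini : ∀ {n}, n ∈ᴹ om → (D'.ob n).IniSub (D.ob n)
  map_iff : ∀ {m n f σ τ}, NatHom m n f → D'.El m σ → (D'.map m n f σ τ ↔ D.map m n f σ τ)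
  supp_iff : ∀ {n σ i}, n ∈ᴹ om → D'.El n σ → (D'.supp n σ i ↔ D.supp n σ i)
  reflect : ∀ {m n f σ τ}, NatHom m n f → D.El m σ → D.map m n f σ τ → D'.El n τ → D'.El m σ

theorem Sub.refl (D : Predil M) : D.Sub D :=
  ⟨fun _ => ⟨id, fun _ _ => Iff.rfl, fun h _ _ => h⟩, fun _ _ => Iff.rfl, fun _ _ => Iff.rfl,
    fun _ h _ _ => h⟩

section

variable {D' D : Predil M} {X : ClassOrder M}

theorem Sub.tr (h : D'.Sub D) {σ n : M} (hσ : D'.Tr σ n) : D.Tr σ n :=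
  ⟨hσ.1, (h.ini hσ.1).mem hσ.2.1, fun i hi => (h.supp_iff hσ.1 hσ.2.1).1 (hσ.2.2 i hi)⟩

theorem Sub.val (h : D'.Sub D) {p c n v : M} (hv : D'.Val X p c n v) : D.Val X p c n v := by
  obtain ⟨σ, a, k, ea, e₁, f, rfl, hea, he₁, hσ, hac, hf, hfe, hm⟩ := hv
  exact ⟨σ, a, k, ea, e₁, f, rfl, hea, he₁, h.tr hσ, hac, hf, hfe, (h.map_iff hf hσ.2.1).1 hm⟩

theorem Sub.ext_mem (h : D'.Sub D) {p : M} (hp : (D'.ext X).mem p) : (D.ext X).mem p := by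
  obtain ⟨σ, a, k, ea, rfl, hea, hσ⟩ := hp
  exact ⟨σ, a, k, ea, rfl, hea, h.tr hσ⟩

/-- Everything can be checked in `D'(n)` and `D(n)` over a common finite set. For downward closure,
the value of `p` falls into `D'(n)`, and `reflect` pulls this membership back from `D(f)(σ)` to `σ`.
-/
theorem Sub.ext (h : D'.Sub D) (hD' : D'.WPre) (hD : D.WPre) (hX : Small X) :
    (D'.ext X).IniSub (D.ext X) := by
  refine ⟨h.ext_mem, fun {p q} hp hq => ?_, fun {p q} hp hq hpq => ?_⟩
  · obtain ⟨c, n, u, v, w, hn, hu, hv, hw⟩ := exists_vals hD' hX hp hq hq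
    rw [hu.lt_iff hD' hX hv, (h.val hu).lt_iff hD hX (h.val hv)]
    exact (h.ini hn).lt_iff (hu.el hD') (hv.el hD')
  · obtain ⟨c, n, u, v, w, hn, hu, hv, hw⟩ := exists_vals hD hX hp (h.ext_mem hq) (h.ext_mem hq)
    obtain ⟨e, he⟩ : ∃ e, Enum X c n e := by
      obtain ⟨_, _, _, _, e, _, _, _, he, _⟩ := hu
      exact ⟨e, he⟩
    obtain ⟨v', hv'⟩ := exists_val hD' hX.linear hq he fun x hx => by
      obtain ⟨σ, a, k, ea, e₁, f, rfl, hea, he₁, hσ, hac, -⟩ := hv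
      exact hac x (extSupp_pair.1 hx)
    obtain rfl := hv.unique hD hX.linear (h.val hv')
    have hu' := (h.ini hn).down (hu.el hD) (hv'.el hD') ((hu.lt_iff hD hX hv).1 hpq)
    obtain ⟨σ, a, k, ea, e₁, f, rfl, hea, he₁, hσ, hac, hf, hfe, hm⟩ := hu
    have := h.reflect hf hσ.2.1 hm hu'
    exact ⟨σ, a, k, ea, rfl, hea, hσ.1, this, fun i hi => (h.supp_iff hσ.1 this).2 (hσ.2.2 i hi)⟩

end

/-! ### Shifts -/

section

variable {γ m n f x y : M}

theorem addMap_left : addMap γ m f (pair empty x) y ↔ x ∈ᴹ γ ∧ y = pair empty x := by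
  simp [addMap, empty_ne_one]

theorem addMap_right : addMap γ m f (pair (adj empty empty) x) y ↔
    x ∈ᴹ m ∧ y = pair (adj empty empty) (app f x) := by
  simp [addMap, empty_ne_one.symm]

@[fun_prop]
theorem PR.addMap {γ m f x y : Γ → M} (hγ : PR M γ) (hm : PR M m) (hf : PR M f) (hx : PR M x)
    (hy : PR M y) : PR M (fun z => addMap (γ z) (m z) (f z) (x z) (y z)) := by
  unfold Predil.addMap
  exact PR.or (PR.ex_mem (by fun_prop) (by fun_prop)) (PR.ex_mem (by fun_prop) (by fun_prop))

theorem add_small (hγ : IsOrd γ) (hn : n ∈ᴹ om) : Small ((ordOrder γ).add (ordOrder n)) :=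
  (ordOrder_small hγ).add (ordOrder_small (isOrd_of_mem_om hn))

/-- The function `γ + f` as a set. -/
theorem exists_addMap (hγ : IsOrd γ) (hf : NatHom m n f) : ∃ h : M,
    (∀ x, ((ordOrder γ).add (ordOrder m)).mem x → ∀ y, addMap γ m f x y ↔ y = app h x) ∧
    (∀ x, ((ordOrder γ).add (ordOrder m)).mem x → ((ordOrder γ).add (ordOrder n)).mem (app h x)) ∧
    (∀ x y, ((ordOrder γ).add (ordOrder m)).mem x → ((ordOrder γ).add (ordOrder m)).mem y →
      ((ordOrder γ).add (ordOrder m)).lt x y → 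
      ((ordOrder γ).add (ordOrder n)).lt (app h x) (app h y)) := by
  have hS := add_small hγ hf.1
  obtain ⟨B, hB⟩ := (add_small hγ hf.2.1).bdd
  obtain ⟨A, hA⟩ : ∃ A, ∀ x, x ∈ᴹ A ↔ ((ordOrder γ).add (ordOrder m)).mem x := by
    obtain ⟨A, hA⟩ := hS.bdd
    obtain ⟨s, hs⟩ := sep A hS.pr_mem
    exact ⟨s, fun x => (hs x).trans ⟨And.right, fun h => ⟨hA x h, h⟩⟩⟩
  have huniq : ∀ x y y', x ∈ᴹ A → addMap γ m f x y → addMap γ m f x y' → y = y' := by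
    intro x y y' hx h h'
    rcases (hA x).1 hx with ⟨z, hz, rfl⟩ | ⟨z, hz, rfl⟩
    · rw [(addMap_left.1 h).2, (addMap_left.1 h').2]
    · rw [(addMap_right.1 h).2, (addMap_right.1 h').2]
  obtain ⟨h, hh, hv⟩ := exists_fun_of_rel A B (R := fun x y => addMap γ m f x y) (by fun_prop)
    (fun x hx => by
      rcases (hA x).1 hx with ⟨z, hz, rfl⟩ | ⟨z, hz, rfl⟩
      · exact ⟨_, hB _ (add_mem_left.2 hz), addMap_left.2 ⟨hz, rfl⟩⟩
      · exact ⟨_, hB _ (add_mem_right.2 (hf.2.2.2.1 z hz)), addMap_right.2 ⟨hz, rfl⟩⟩) huniq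
  have e1 : ∀ z, z ∈ᴹ γ → app h (pair empty z) = pair empty z := fun z hz =>
    (addMap_left.1 (hv _ ((hA _).2 (add_mem_left.2 hz))).2).2
  have e2 : ∀ z, z ∈ᴹ m → app h (pair (adj empty empty) z) = pair (adj empty empty) (app f z) :=
    fun z hz => (addMap_right.1 (hv _ ((hA _).2 (add_mem_right.2 hz))).2).2
  refine ⟨h, fun x hx y => ⟨fun hy => huniq x _ _ ((hA x).2 hx) hy (hv x ((hA x).2 hx)).2, ?_⟩,
    ?_, ?_⟩
  · rintro rfl
    exact (hv x ((hA x).2 hx)).2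
  · rintro _ (⟨z, hz, rfl⟩ | ⟨z, hz, rfl⟩)
    · rw [e1 z hz]; exact add_mem_left.2 hz
    · rw [e2 z hz]; exact add_mem_right.2 (hf.2.2.2.1 z hz)
  · rintro _ _ (⟨z, hz, rfl⟩ | ⟨z, hz, rfl⟩) (⟨z', hz', rfl⟩ | ⟨z', hz', rfl⟩)
    · rw [e1 z hz, e1 z' hz']
      simp only [add_lt_left, imp_self]
    · rw [e1 z hz, e2 z' hz']
      simp only [add_lt_left_right, imp_self]
    · simp only [not_add_lt_right_left, false_imp_iff]
    · rw [e2 z hz, e2 z' hz']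
      simp only [add_lt_right]
      exact hf.2.2.2.2 z z' hz hz'

theorem extMap_pair {F : M → M → Prop} {σ a q : M} :
    extMap F (pair σ a) q ↔ ∃ b, q = pair σ b ∧ ∀ y, y ∈ᴹ b ↔ ∃ x, x ∈ᴹ a ∧ F x y := by
  constructor
  · rintro ⟨σ', a', b, e, rfl, hb⟩
    obtain ⟨rfl, rfl⟩ := pair_inj.1 e
    exact ⟨b, rfl, hb⟩
  · rintro ⟨b, rfl, hb⟩
    exact ⟨σ, a, b, rfl, rfl, hb⟩

theorem extMap_unique {F : M → M → Prop} {p q q' : M} (h : extMap F p q) (h' : extMap F p q') :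
    q = q' := by
  obtain ⟨σ, a, b, rfl, rfl, hb⟩ := h
  obtain ⟨b', rfl, hb'⟩ := extMap_pair.1 h'
  rw [show b = b' from ATRSet.ext fun y => by rw [hb, hb']]

variable {D D' : Predil M}

/-- Linearity is that of `D(γ + n)`. The map `D(γ + f)` keeps `σ` and replaces the finite set by its
image under the embedding `γ + f`, so its properties reduce to those of images under embeddings. -/
theorem WPre.shift (hD : D.WPre) (hγ : IsOrd γ) : (D.shift γ).WPre where
  linear n hn := ext_linear hD (add_small hγ hn)
  map_fun m n f p hf hp := by
    obtain ⟨h, h1, h2, h3⟩ := exists_addMap hγ hf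
    obtain ⟨σ, a, k, e, rfl, he, hσ⟩ := hp
    obtain ⟨b, hb⟩ := exists_image a (F := fun x => app h x) (by fun_prop)
    have : extMap (addMap γ m f) (pair σ a) (pair σ b) := by
      refine extMap_pair.2 ⟨b, rfl, fun y => ?_⟩
      rw [hb]
      exact exists_congr fun x => and_congr_right fun hx => (h1 x (he.mem hx) y).symm
    exact ⟨pair σ b, this, fun q hq => extMap_unique hq this⟩
  map_mem m n f p q hf hp hm := by
    obtain ⟨h, h1, h2, h3⟩ := exists_addMap hγ hf
    have hp' := hp
    obtain ⟨σ, a, k, e, rfl, he, hσ⟩ := hp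
    obtain ⟨b, rfl, hb⟩ := extMap_pair.1 hm
    refine ext_mem_image (H := fun x => app h x) (by fun_prop) hp' (fun x hx => h2 x (he.mem hx))
      (fun x y hx hy => h3 x y (he.mem hx) (he.mem hy)) fun y => ?_
    rw [hb]
    exact exists_congr fun x => and_congr_right fun hx => (h1 x (he.mem hx) y)
  map_lt m n f p p' q q' hf hp hp' hm hm' hlt := by
    obtain ⟨h, h1, h2, h3⟩ := exists_addMap hγ hf
    obtain ⟨σ, a, k, e, rfl, he, hσ⟩ := hp
    obtain ⟨b, rfl, hb⟩ := extMap_pair.1 hm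
    obtain ⟨σ', a', k', e', rfl, he', hσ'⟩ := hp'
    obtain ⟨b', rfl, hb'⟩ := extMap_pair.1 hm'
    have hmem : ∀ x, x ∈ᴹ a ∨ x ∈ᴹ a' → ((ordOrder γ).add (ordOrder m)).mem x := by
      rintro x (hx | hx)
      · exact he.mem hx
      · exact he'.mem hx
    refine ext_lt_image (add_small hγ hf.1).linear (H := fun x => app h x) (by fun_prop) hlt
      (fun x hx => h2 x (hmem x hx))
      (fun x y hx hy => h3 x y (hmem x hx) (hmem y hy)) (fun y => ?_) fun y => ?_
    · rw [hb]
      exact exists_congr fun x => and_congr_right fun hx => (h1 x (he.mem hx) y)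
    · rw [hb']
      exact exists_congr fun x => and_congr_right fun hx => (h1 x (he'.mem hx) y)
  map_comp k m n f g h p q r hf hg hh hfg hp hq hr := by
    obtain ⟨σ, a, k, e, rfl, he, hσ⟩ := hp
    obtain ⟨b, rfl, hb⟩ := extMap_pair.1 hq
    obtain ⟨c, rfl, hc⟩ := extMap_pair.1 hr
    refine extMap_pair.2 ⟨c, rfl, fun y => ?_⟩
    rw [hc]
    simp only [hb]
    constructor
    · rintro ⟨x, ⟨w, hw, hwx⟩, hxy⟩
      refine ⟨w, hw, ?_⟩
      rcases he.mem hw with ⟨z, hz, rfl⟩ | ⟨z, hz, rfl⟩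
      · obtain ⟨-, rfl⟩ := addMap_left.1 hwx
        exact addMap_left.2 (addMap_left.1 hxy)
      · obtain ⟨-, rfl⟩ := addMap_right.1 hwx
        exact addMap_right.2 ⟨hz, by rw [(addMap_right.1 hxy).2, hfg z hz]⟩
    · rintro ⟨w, hw, hwy⟩
      rcases he.mem hw with ⟨z, hz, rfl⟩ | ⟨z, hz, rfl⟩
      · exact ⟨_, ⟨_, hw, addMap_left.2 ⟨hz, rfl⟩⟩, addMap_left.2 (addMap_left.1 hwy)⟩
      · refine ⟨_, ⟨_, hw, addMap_right.2 ⟨hz, rfl⟩⟩, addMap_right.2 ⟨hf.2.2.2.1 z hz, ?_⟩⟩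
        rw [(addMap_right.1 hwy).2, hfg z hz]
  supp_sub n p i hn hp hi := hi.1
  supp_nat m n f p q hf hp hm j := by
    obtain ⟨σ, a, k, e, rfl, he, hσ⟩ := hp
    obtain ⟨b, rfl, hb⟩ := extMap_pair.1 hm
    simp only [Predil.shift, extSupp_pair, hb]
    constructor
    · rintro ⟨hj, x, hx, hxj⟩
      rcases he.mem hx with ⟨z, hz, rfl⟩ | ⟨z, hz, rfl⟩
      · have := (pair_inj.1 (addMap_left.1 hxj).2).1
        exact absurd this.symm empty_ne_one
      · exact ⟨z, ⟨hz, hx⟩, (pair_inj.1 (addMap_right.1 hxj).2).2.symm⟩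
    · rintro ⟨i, ⟨hi, hia⟩, rfl⟩
      exact ⟨hf.2.2.2.1 i hi, _, hia, addMap_right.2 ⟨hi, rfl⟩⟩

theorem Sub.shift (h : D'.Sub D) (hD' : D'.WPre) (hD : D.WPre) (hγ : IsOrd γ) :
    (D'.shift γ).Sub (D.shift γ) where
  ini hn := h.ext hD' hD (add_small hγ hn)
  map_iff _ _ := Iff.rfl
  supp_iff _ _ := Iff.rfl
  reflect {m n f p q} hf hp hm hq := by
    obtain ⟨h', h1, h2, h3⟩ := exists_addMap hγ hf
    obtain ⟨σ, a, k, e, rfl, he, hσ⟩ := hp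
    obtain ⟨b, rfl, hb⟩ := extMap_pair.1 hm
    obtain ⟨e', he', -⟩ := he.image (Y := (ordOrder γ).add (ordOrder n)) (H := fun x => app h' x)
      (by fun_prop) (fun x hx => h2 x (he.mem hx))
      (fun x y hx hy => h3 x y (he.mem hx) (he.mem hy)) (b := b) fun y => by
        rw [hb]
        exact exists_congr fun x => and_congr_right fun hx => (h1 x (he.mem hx) y)
    obtain ⟨σ', b', k', e'', e0, he'', hσ'⟩ := hq
    obtain ⟨rfl, rfl⟩ := pair_inj.1 e0
    -- The embedding `γ + f` preserves cardinalities, so the trace condition for `σ` at `|b|` is the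
    -- one at `|a|`.
    obtain ⟨rfl, -⟩ := he'.unique (add_small hγ hf.2.1).linear he''
    exact ⟨σ, a, k, e, rfl, he, hσ'⟩

end

/-! ### Sums -/

section

variable {L : ClassOrder M} {D : M → Predil M}

theorem sum_el {n α σ : M} : (sum L D).El n (pair α σ) ↔ L.mem α ∧ (D α).El n σ := by
  simp only [sum, pair_inj]
  grind

theorem sum_lt {n α σ β τ : M} : (sum L D).lt n (pair α σ) (pair β τ) ↔
    L.mem α ∧ L.mem β ∧ (L.lt α β ∨ (α = β ∧ (D α).lt n σ τ)) := by
  simp only [sum, pair_inj]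
  grind

theorem sum_map {m n f α σ q : M} : (sum L D).map m n f (pair α σ) q ↔
    ∃ τ, q = pair α τ ∧ L.mem α ∧ (D α).map m n f σ τ := by
  simp only [sum, pair_inj]
  grind

theorem sum_supp {n α σ i : M} : (sum L D).supp n (pair α σ) i ↔ L.mem α ∧ (D α).supp n σ i := by
  simp only [sum, pair_inj]
  grind

theorem WPre.sum (hL : L.IsLinear) (hD : ∀ α, L.mem α → (D α).WPre) : (sum L D).WPre where
  linear n hn := by
    refine ⟨?_, ?_, ?_⟩
    · rintro _ ⟨α, σ, rfl, hα, hσ⟩ h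
      rcases (sum_lt.1 h).2.2 with h | h
      · exact hL.1 α hα h
      · exact ((hD α hα).linear n hn).1 σ hσ h.2
    · rintro _ _ _ ⟨α, σ, rfl, hα, hσ⟩ ⟨β, τ, rfl, hβ, hτ⟩ ⟨δ, ρ, rfl, hδ, hρ⟩ h h'
      refine sum_lt.2 ⟨hα, hδ, ?_⟩
      rcases (sum_lt.1 h).2.2 with h1 | ⟨rfl, h1⟩
      · rcases (sum_lt.1 h').2.2 with h2 | ⟨rfl, h2⟩
        · exact Or.inl (hL.2.1 _ _ _ hα hβ hδ h1 h2)
        · exact Or.inl h1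
      · rcases (sum_lt.1 h').2.2 with h2 | ⟨rfl, h2⟩
        · exact Or.inl h2
        · exact Or.inr ⟨rfl, ((hD α hα).linear n hn).2.1 _ _ _ hσ hτ hρ h1 h2⟩
    · rintro _ _ ⟨α, σ, rfl, hα, hσ⟩ ⟨β, τ, rfl, hβ, hτ⟩
      have h1 : ∀ {α σ β τ}, ((Predil.sum L D).ob n).lt (pair α σ) (pair β τ) ↔ _ :=
        fun {α σ β τ} => sum_lt (L := L) (D := D)
      rw [h1, h1]
      rcases hL.2.2 α β hα hβ with h | rfl | h
      · exact Or.inl ⟨hα, hβ, Or.inl h⟩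
      · rcases ((hD α hα).linear n hn).2.2 σ τ hσ hτ with h | rfl | h
        · exact Or.inl ⟨hα, hβ, Or.inr ⟨rfl, h⟩⟩
        · exact Or.inr (Or.inl rfl)
        · exact Or.inr (Or.inr ⟨hα, hβ, Or.inr ⟨rfl, h⟩⟩)
      · exact Or.inr (Or.inr ⟨hβ, hα, Or.inl h⟩)
  map_fun := by
    rintro m n f _ hf ⟨α, σ, rfl, hα, hσ⟩
    obtain ⟨τ, hτ, hu⟩ := (hD α hα).map_fun m n f σ hf hσ
    refine ⟨pair α τ, sum_map.2 ⟨τ, rfl, hα, hτ⟩, fun q hq => ?_⟩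
    obtain ⟨τ', rfl, -, hτ'⟩ := sum_map.1 hq
    rw [hu τ' hτ']
  map_mem := by
    rintro m n f _ q hf ⟨α, σ, rfl, hα, hσ⟩ hq
    obtain ⟨τ, rfl, -, hτ⟩ := sum_map.1 hq
    exact sum_el.2 ⟨hα, (hD α hα).map_mem m n f σ τ hf hσ hτ⟩
  map_lt := by
    rintro m n f _ _ q q' hf ⟨α, σ, rfl, hα, hσ⟩ ⟨β, σ', rfl, hβ, hσ'⟩ hq hq' h
    obtain ⟨τ, rfl, -, hτ⟩ := sum_map.1 hq
    obtain ⟨τ', rfl, -, hτ'⟩ := sum_map.1 hq'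
    refine sum_lt.2 ⟨hα, hβ, ?_⟩
    rcases (sum_lt.1 h).2.2 with h1 | ⟨rfl, h1⟩
    · exact Or.inl h1
    · exact Or.inr ⟨rfl, (hD α hα).map_lt m n f σ σ' τ τ' hf hσ hσ' hτ hτ' h1⟩
  map_comp := by
    rintro k m n f g h _ q r hf hg hh hfg ⟨α, ρ, rfl, hα, hρ⟩ hq hr
    obtain ⟨σ, rfl, -, hσ⟩ := sum_map.1 hq
    obtain ⟨τ, rfl, -, hτ⟩ := sum_map.1 hr
    exact sum_map.2 ⟨τ, rfl, hα, (hD α hα).map_comp k m n f g h ρ σ τ hf hg hh hfg hρ hσ hτ⟩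
  supp_sub := by
    rintro n _ i hn ⟨α, σ, rfl, hα, hσ⟩ hi
    exact (hD α hα).supp_sub n σ i hn hσ (sum_supp.1 hi).2
  supp_nat := by
    rintro m n f _ q hf ⟨α, σ, rfl, hα, hσ⟩ hq j
    obtain ⟨τ, rfl, -, hτ⟩ := sum_map.1 hq
    simp only [sum_supp, hα, true_and]
    exact (hD α hα).supp_nat m n f σ τ hf hσ hτ j

/-- A partial sum is an initial segment of the full sum. -/
theorem Sub.sum {μ ν : M} (hν : IsOrd ν) (hμ : μ ∈ᴹ ν) :
    (Predil.sum (ordOrder μ) D).Sub (Predil.sum (ordOrder ν) D) where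
  ini {n} hn := by
    refine ⟨?_, ?_, ?_⟩
    · rintro _ ⟨α, σ, rfl, hα, hσ⟩
      exact sum_el.2 ⟨hν.1 μ hμ α hα, hσ⟩
    · rintro _ _ ⟨α, σ, rfl, hα, hσ⟩ ⟨β, τ, rfl, hβ, hτ⟩
      refine (sum_lt (L := ordOrder μ) (D := D)).trans (Iff.trans ?_
        (sum_lt (L := ordOrder ν) (D := D)).symm)
      exact and_congr (iff_of_true hα (hν.1 μ hμ α hα)) (and_congr (iff_of_true hβ (hν.1 μ hμ β hβ))
        Iff.rfl)
    · rintro _ _ ⟨α, σ, rfl, hα, hσ⟩ ⟨β, τ, rfl, hβ, hτ⟩ h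
      refine sum_el.2 ⟨?_, hσ⟩
      rcases (sum_lt.1 h).2.2 with h | ⟨rfl, h⟩
      · exact (hν.mem hμ).1 β hβ α h
      · exact hβ
  map_iff := by
    rintro m n f _ q hf ⟨α, σ, rfl, hα, hσ⟩
    rw [sum_map, sum_map]
    exact exists_congr fun τ => and_congr_right fun _ => and_congr_left fun _ =>
      iff_of_true hα (hν.1 μ hμ α hα)
  supp_iff := by
    rintro n _ i hn ⟨α, σ, rfl, hα, hσ⟩
    rw [sum_supp, sum_supp]
    exact and_congr_left fun _ => iff_of_true hα (hν.1 μ hμ α hα)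
  reflect := by
    rintro m n f _ q hf ⟨α, σ, rfl, hα, hσ⟩ hq h
    obtain ⟨τ, rfl, -, hτ⟩ := sum_map.1 hq
    exact sum_el.2 ⟨(sum_el.1 h).1, hσ⟩

end

/-! ### Comparison of fixed points -/

/-- The embedding `π` witnesses that `Ω` is a `ψ`-fixed point of `D`. -/
structure IsPsiWith (D : Predil M) (Ω π : M) : Prop where
  isFunOn : IsFunOn π Ω
  mem : ∀ α, α ∈ᴹ Ω → (D.ext (ordOrder Ω)).mem (app π α)
  lt : ∀ α β, α ∈ᴹ Ω → β ∈ᴹ Ω → α ∈ᴹ β → (D.ext (ordOrder Ω)).lt (app π α) (app π β)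
  supp : ∀ α β, α ∈ᴹ Ω → β ∈ᴹ Ω → extSupp (app π β) α → α ∈ᴹ β
  surj : ∀ τ, (D.ext (ordOrder Ω)).mem τ →
    (∀ α, extSupp τ α → (D.ext (ordOrder Ω)).lt (app π α) τ) → ∃ β, β ∈ᴹ Ω ∧ app π β = τ

theorem isPsiFixedPoint_iff {D : Predil M} {Ω : M} :
    D.IsPsiFixedPoint Ω ↔ IsOrd Ω ∧ ∃ π, D.IsPsiWith Ω π :=
  and_congr_right fun _ => exists_congr fun _ =>
    ⟨fun ⟨h1, h2, h3, h4, h5⟩ => ⟨h1, h2, h3, h4, h5⟩, fun ⟨h1, h2, h3, h4, h5⟩ => ⟨h1, h2, h3, h4, h5⟩⟩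

theorem ord_mem {D : Predil M} {α β p : M} (h : (D.ext (ordOrder α)).mem p)
    (hs : ∀ x, extSupp p x → x ∈ᴹ β) : (D.ext (ordOrder β)).mem p :=
  ext_mem_of_supp h hs fun _ _ _ _ h => h

theorem ord_lt {D : Predil M} {α β p q : M} (hα : IsOrd α) (h : (D.ext (ordOrder α)).lt p q)
    (hs : ∀ x, extSupp p x → x ∈ᴹ β) (hs' : ∀ x, extSupp q x → x ∈ᴹ β) :
    (D.ext (ordOrder β)).lt p q :=
  ext_lt_of_supp (ordOrder_linear hα) h (fun x hx => hx.elim (hs x) (hs' x)) fun _ _ _ _ h => h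

namespace IsPsiWith

variable {D D' : Predil M} {Ω Ω' π π' : M}

theorem lt_iff (h : D.IsPsiWith Ω π) (hD : D.WPre) (hΩ : IsOrd Ω) {α β : M} (hα : α ∈ᴹ Ω)
    (hβ : β ∈ᴹ Ω) : (D.ext (ordOrder Ω)).lt (app π α) (app π β) ↔ α ∈ᴹ β := by
  refine ⟨fun hl => ?_, h.lt α β hα hβ⟩
  have hlin := ext_linear hD (ordOrder_small hΩ)
  rcases (hΩ.mem hα).trichotomy (hΩ.mem hβ) with h1 | rfl | h1
  · exact h1
  · exact absurd hl (hlin.1 _ (h.mem α hα))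
  · exact absurd (hlin.2.1 _ _ _ (h.mem α hα) (h.mem β hβ) (h.mem α hα) hl (h.lt β α hβ hα h1))
      (hlin.1 _ (h.mem α hα))

theorem inj (h : D.IsPsiWith Ω π) (hD : D.WPre) (hΩ : IsOrd Ω) {α β : M} (hα : α ∈ᴹ Ω)
    (hβ : β ∈ᴹ Ω) (he : app π α = app π β) : α = β := by
  rcases (hΩ.mem hα).trichotomy (hΩ.mem hβ) with h1 | h1 | h1
  · have h2 := h.lt α β hα hβ h1
    rw [he, h.lt_iff hD hΩ hβ hβ] at h2
    exact absurd h2 (not_mem_self _)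
  · exact h1
  · have h2 := h.lt β α hβ hα h1
    rw [he, h.lt_iff hD hΩ hβ hβ] at h2
    exact absurd h2 (not_mem_self _)

theorem supp_mem (h : D.IsPsiWith Ω π) {α β : M} (hβ : β ∈ᴹ Ω) (hα : extSupp (app π β) α) :
    α ∈ᴹ β :=
  h.supp α β (ext_mem_supp (h.mem β hβ) hα) hβ hα

/-- Induction on `β`. Both values have support below `β`, so they can be compared in `D(β)`. Suppose
`π β` is smaller: as `D'` is an initial segment, `π β` belongs to `D'`, and by induction hypothesis
it lies above the values of `π'` on its support. So it equals `π' δ` for some `δ`, where `δ < β` by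
monotonicity; then `π δ = π' δ = π β` contradicts injectivity. If `π' β` is smaller, the roles are
exchanged, and the passage to the initial segment is replaced by the inclusion of `D'` in `D`. -/
theorem app_eq (h : D.IsPsiWith Ω π) (h' : D'.IsPsiWith Ω' π') (hD : D.WPre) (hD' : D'.WPre)
    (hS : D'.Sub D) (hΩ : IsOrd Ω) (hΩ' : IsOrd Ω') :
    ∀ β, β ∈ᴹ Ω' → β ∈ᴹ Ω → app π' β = app π β := by
  refine mem_induction (P := fun β => β ∈ᴹ Ω → app π' β = app π β) (by fun_prop)
    fun β hβ' ih hβ => ?_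
  have hβo := hΩ.mem hβ
  have hβi := ordOrder_small hβo
  have ini := hS.ext hD' hD hβi
  have ih' : ∀ α, α ∈ᴹ β → app π' α = app π α := fun α hα =>
    ih α hα (hΩ'.1 β hβ' α hα) (hΩ.1 β hβ α hα)
  have s : ∀ x, extSupp (app π β) x → x ∈ᴹ β := fun x hx => h.supp_mem hβ hx
  have s' : ∀ x, extSupp (app π' β) x → x ∈ᴹ β := fun x hx => h'.supp_mem hβ' hx
  have sα : ∀ α, α ∈ᴹ β → ∀ x, extSupp (app π α) x → x ∈ᴹ β := fun α hα x hx =>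
    hβo.1 α hα x (h.supp_mem (hΩ.1 β hβ α hα) hx)
  have sα' : ∀ α, α ∈ᴹ β → ∀ x, extSupp (app π' α) x → x ∈ᴹ β := fun α hα x hx =>
    hβo.1 α hα x (h'.supp_mem (hΩ'.1 β hβ' α hα) hx)
  have m := ord_mem (h.mem β hβ) s
  have m' := ord_mem (h'.mem β hβ') s'
  have mα : ∀ α, α ∈ᴹ β → (D'.ext (ordOrder β)).mem (app π' α) := fun α hα =>
    ord_mem (h'.mem α (hΩ'.1 β hβ' α hα)) (sα' α hα)
  rcases (ext_linear hD hβi).2.2 _ _ m (ini.mem m') with hl | he | hl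
  · exfalso
    have m1 := ini.down m m' hl
    obtain ⟨δ, hδ, e⟩ := h'.surj _ (ord_mem m1 fun x hx => hΩ'.1 β hβ' x (s x hx)) fun α hα => by
      have hαβ := s α hα
      refine ord_lt (α := β) hβo ((ini.lt_iff (mα α hαβ) m1).2 ?_)
        (fun x hx => hΩ'.1 β hβ' x (sα' α hαβ x hx)) fun x hx => hΩ'.1 β hβ' x (s x hx)
      rw [ih' α hαβ]
      exact ord_lt hΩ (h.lt α β (hΩ.1 β hβ α hαβ) hβ hαβ) (sα α hαβ) s
    have hl' := ord_lt (β := Ω') hβo ((ini.lt_iff m1 m').2 hl)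
      (fun x hx => hΩ'.1 β hβ' x (s x hx)) fun x hx => hΩ'.1 β hβ' x (s' x hx)
    rw [← e, h'.lt_iff hD' hΩ' hδ hβ'] at hl'
    have := h.inj hD hΩ (hΩ.1 β hβ δ hl') hβ ((ih' δ hl').symm.trans e)
    subst this
    exact not_mem_self _ hl'
  · exact he.symm
  · exfalso
    obtain ⟨δ, hδ, e⟩ := h.surj _ (ord_mem (ini.mem m') fun x hx => hΩ.1 β hβ x (s' x hx))
      fun α hα => by
        have hαβ := s' α hα
        refine ord_lt (α := β) hβo ?_
          (fun x hx => hΩ.1 β hβ x (sα α hαβ x hx)) fun x hx => hΩ.1 β hβ x (s' x hx)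
        rw [← ih' α hαβ, ← ini.lt_iff (mα α hαβ) m']
        exact ord_lt hΩ' (h'.lt α β (hΩ'.1 β hβ' α hαβ) hβ' hαβ) (sα' α hαβ) s'
    have hl' := ord_lt (β := Ω) hβo hl
      (fun x hx => hΩ.1 β hβ x (s' x hx)) fun x hx => hΩ.1 β hβ x (s x hx)
    rw [← e, h.lt_iff hD hΩ hδ hβ] at hl'
    have := h'.inj hD' hΩ' (hΩ'.1 β hβ' δ hl') hβ' ((ih' δ hl').trans e)
    subst this
    exact not_mem_self _ hl'

/-- If `Ω` were below `Ω'`, then `π' Ω` would be an element of `D(Ω)` above the values of `π` on its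
support. Hence it would equal `π δ = π' δ` for some `δ < Ω`, against injectivity of `π'`. -/
theorem ordLe (h : D.IsPsiWith Ω π) (h' : D'.IsPsiWith Ω' π') (hD : D.WPre) (hD' : D'.WPre)
    (hS : D'.Sub D) (hΩ : IsOrd Ω) (hΩ' : IsOrd Ω') : OrdLe Ω' Ω := by
  rcases hΩ'.trichotomy hΩ with h1 | h1 | h1
  · exact Or.inl h1
  · exact Or.inr h1
  exfalso
  have key := h.app_eq h' hD hD' hS hΩ hΩ'
  have hs := hΩ'.1 Ω h1
  have ini := hS.ext hD' hD (ordOrder_small hΩ')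
  have s : ∀ x, extSupp (app π' Ω) x → x ∈ᴹ Ω := fun x hx => h'.supp_mem h1 hx
  obtain ⟨δ, hδ, e⟩ := h.surj (app π' Ω) (hS.ext_mem (ord_mem (h'.mem Ω h1) s)) fun α hα => by
    have hαΩ := s α hα
    rw [← key α (hs α hαΩ) hαΩ]
    exact ord_lt hΩ' ((ini.lt_iff (h'.mem _ (hs α hαΩ)) (h'.mem _ h1)).1
      (h'.lt α Ω (hs α hαΩ) h1 hαΩ)) (fun x hx => hΩ.1 α hαΩ x (h'.supp_mem (hs α hαΩ) hx)) s
  have := h'.inj hD' hΩ' (hs δ hδ) h1 ((key δ (hs δ hδ) hδ).trans e)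
  subst this
  exact not_mem_self _ hδ

end IsPsiWith

theorem IsPsiFixedPoint.unique {D : Predil M} (hD : D.WPre) {Ω Ω' : M} (h : D.IsPsiFixedPoint Ω)
    (h' : D.IsPsiFixedPoint Ω') : Ω = Ω' := by
  obtain ⟨hΩ, π, hπ⟩ := isPsiFixedPoint_iff.1 h
  obtain ⟨hΩ', π', hπ'⟩ := isPsiFixedPoint_iff.1 h'
  rcases hπ.ordLe hπ' hD hD (.refl D) hΩ hΩ' with h1 | h1
  · rcases hπ'.ordLe hπ hD hD (.refl D) hΩ' hΩ with h2 | h2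
    · exact absurd h1 (not_mem_mem h2)
    · exact h2
  · exact h1.symm

/-- The fixed point of a union of predilators is the supremum of the fixed points. -/
theorem IsPsiFixedPoint.isOrdSup {D : Predil M} {E : M → Predil M} {l Ω : M} (hD : D.WPre)
    (hE : ∀ μ, μ ∈ᴹ l → (E μ).WPre) (hS : ∀ μ, μ ∈ᴹ l → (E μ).Sub D)
    (hU : ∀ p, (D.ext (ordOrder Ω)).mem p → ∃ μ, μ ∈ᴹ l ∧ ((E μ).ext (ordOrder Ω)).mem p)
    (hex : ∀ μ, μ ∈ᴹ l → ∃ β, (E μ).IsPsiFixedPoint β) (h : D.IsPsiFixedPoint Ω) :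
    IsOrdSup (fun β => ∃ μ, μ ∈ᴹ l ∧ (E μ).IsPsiFixedPoint β) Ω := by
  obtain ⟨hΩ, π, hπ⟩ := isPsiFixedPoint_iff.1 h
  refine ⟨hΩ, fun β hβ => ?_, fun Ω₁ hΩ₁ hle => ?_⟩
  · obtain ⟨μ, hμ, hβ⟩ := hβ
    obtain ⟨hβo, π', hπ'⟩ := isPsiFixedPoint_iff.1 hβ
    exact hπ.ordLe hπ' hD (hE μ hμ) (hS μ hμ) hΩ hβo
  · rcases hΩ.trichotomy hΩ₁ with h1 | h1 | h1
    · exact Or.inl h1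
    · exact Or.inr h1
    exfalso
    -- The upper bound `Ω₁` is taken as an argument of `π`. It remains to refute that the value lies
    -- in some `E μ` whose fixed point `β` is at most `Ω₁`.
    obtain ⟨μ, hμ, hm⟩ := hU _ (hπ.mem _ h1)
    obtain ⟨β, hβ⟩ := hex μ hμ
    have hβle := hle β ⟨μ, hμ, hβ⟩
    obtain ⟨hβo, π', hπ'⟩ := isPsiFixedPoint_iff.1 hβ
    have hβΩ : β ∈ᴹ Ω := by
      rcases hβle with h2 | rfl
      · exact hΩ.1 _ h1 β h2
      · exact h1
    have hs := hΩ.1 β hβΩ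
    have ini := (hS μ hμ).ext (hE μ hμ) hD (ordOrder_small hΩ)
    have key := hπ.app_eq hπ' hD (hE μ hμ) (hS μ hμ) hΩ hβo
    -- `π β` is at most `π Ω₁`, and the latter lies in the initial segment given by `E μ`.
    have m : ((E μ).ext (ordOrder Ω)).mem (app π β) := by
      rcases hβle with h2 | rfl
      · exact ini.down (hπ.mem _ hβΩ) hm (hπ.lt _ _ hβΩ h1 h2)
      · exact hm
    have s : ∀ x, extSupp (app π β) x → x ∈ᴹ β := fun x hx => hπ.supp_mem hβΩ hx
    -- The support of `π β` is below `β`, so `π β` is an element of `E μ (β)` to which the fixed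
    -- point property of `β` applies. It becomes a value at some `δ < β`.
    obtain ⟨δ, hδ, e⟩ := hπ'.surj _ (ord_mem m s) fun α hα => by
      have hαβ := s α hα
      have s' : ∀ x, extSupp (app π' α) x → x ∈ᴹ β := fun x hx =>
        hβo.1 α hαβ x (hπ'.supp_mem hαβ hx)
      refine ord_lt hΩ ((ini.lt_iff (ord_mem (hπ'.mem α hαβ) fun x hx => hs x (s' x hx)) m).2 ?_) s' s
      rw [key α hαβ (hs α hαβ)]
      exact hπ.lt α β (hs α hαβ) hβΩ hαβ
    have := hπ.inj hD hΩ (hs δ hδ) hβΩ ((key δ hδ (hs δ hδ)).symm.trans e)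
    subst this
    exact not_mem_self _ hδ

/-- Every element of a sum lies in a partial sum. -/
theorem exists_mem_shift_sum {D : M → Predil M} {l γ p : M} {X : ClassOrder M} (hl : IsLimitOrd l)
    (hp : (((sum (ordOrder l) D).shift γ).ext X).mem p) :
    ∃ μ, μ ∈ᴹ l ∧ (((sum (ordOrder μ) D).shift γ).ext X).mem p := by
  obtain ⟨q, b, n, e, rfl, he, hn, ⟨s, a, k, e', rfl, he', hk, ⟨α, σ, rfl, hα, hσ⟩, hs⟩, hq⟩ := hp
  -- The element `p` involves a single summand with index `α`, and a limit has an element `μ` above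
  -- `α`.
  obtain ⟨μ, hμ, hαμ⟩ := hl.2.2 α hα
  exact ⟨μ, hμ, _, b, n, e, rfl, he, hn, ⟨_, a, k, e', rfl, he', hk, sum_el.2 ⟨hαμ, hσ⟩,
    fun i hi => sum_supp.2 ⟨hαμ, (sum_supp.1 (hs i hi)).2⟩⟩, hq⟩

end Predil

/-! ### Definability of extended predilators -/

theorem PR.all {u : Γ → M} {P : Γ → M → Prop} (hu : PR M u) (hb : ∀ y x, ¬ P y x → x ∈ᴹ u y)
    (hP : PR M (fun z : Γ × M => P z.1 z.2)) : PR M (fun y => ∀ x, P y x) :=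
  PR.congr (PR.all_mem hu hP) fun y => forall_congr' fun x =>
    ⟨fun h _ => h, fun h => by_contra fun hn => hn (h (hb y x hn))⟩

theorem Univ.app_mem {U f x : M} (hU : Univ U) (hf : f ∈ᴹ U) : app f x ∈ᴹ U := by
  by_cases h : ∃! y, ATRSet.pair x y ∈ᴹ f
  · exact hU.right (hU.trans hf (app_spec h))
  · rw [app, dif_neg h]
    exact hU.empty

@[fun_prop]
theorem PR.natHom {m n f : Γ → M} (hm : PR M m) (hn : PR M n) (hf : PR M f) :
    PR M (fun z => NatHom (m z) (n z) (f z)) := by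
  unfold NatHom
  refine PR.and (by fun_prop) (PR.and (by fun_prop) (PR.and (by fun_prop) (PR.and
    (PR.all_mem (by fun_prop) (by fun_prop)) (PR.congr
    (Q := fun z => ∀ i, i ∈ᴹ m z → ∀ j, j ∈ᴹ m z → i ∈ᴹ j → ATRSet.app (f z) i ∈ᴹ ATRSet.app (f z) j)
    (PR.all_mem (by fun_prop) (PR.all_mem (by fun_prop) (by fun_prop))) fun z => ?_))))
  exact ⟨fun h i hi j hj => h i j hi hj, fun h i j hi hj => h i hi j hj⟩

/-- One fixed set bounds all quantifiers over morphisms between finite orders. -/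
theorem NatHom.mem_univ {m n f : M} (h : NatHom m n f) : f ∈ᴹ univ om :=
  (univ_univ om).fun_mem h.1 h.2.2.1 fun i hi => (univ_univ om).of_mem_om _
    (om_trans h.2.1 (h.2.2.2.1 i hi))

theorem Enum.mem_univ_self {X : ClassOrder M} {a n e : M} (h : Enum X a n e) : e ∈ᴹ univ a :=
  (h.mem_univ (univ_univ a) fun _ hx => (univ_univ a).trans (ATRSet.mem_univ_self a) hx).1

theorem PR.inclHom {X : Γ → ClassOrder M} {a b m n f : Γ → M} (ha : PR M a) (hb : PR M b)
    (hm : PR M m) (hn : PR M n) (hf : PR M f)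
    (hXm : PR M (fun z : Γ × M => (X z.1).mem z.2))
    (hXl : PR M (fun z : Γ × M × M => (X z.1).lt z.2.1 z.2.2)) :
    PR M (fun z => InclHom (X z) (a z) (b z) (m z) (n z) (f z)) := by
  unfold InclHom
  refine PR.and (by fun_prop) (PR.ex (u := fun z => ATRSet.univ (a z)) (by fun_prop)
    (fun z e ⟨_, h, _⟩ => h.mem_univ_self) (PR.ex (u := fun z => ATRSet.univ (b z.1)) (by fun_prop)
    (fun z e ⟨_, h, _⟩ => h.mem_univ_self) (PR.and ?_ (PR.and ?_
    (PR.all_mem (by fun_prop) (by fun_prop))))))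
  all_goals
    exact PR.enum (X := fun z : (Γ × M) × M => X z.1.1) (by fun_prop) (by fun_prop)
      (by fun_prop) (hXm.comp (f := fun z : ((Γ × M) × M) × M => (z.1.1.1, z.2)) (by fun_prop))
      (hXl.comp (f := fun z : ((Γ × M) × M) × M × M => (z.1.1.1, z.2)) (by fun_prop))

namespace Predil

/-- The relations of `D` are primitive recursive and bounded. -/
structure IsPR (D : Predil M) : Prop where
  el : PR M (fun z : M × M => D.El z.1 z.2)
  lt : PR M (fun z : M × M × M => D.lt z.1 z.2.1 z.2.2)
  map : PR M (fun z : M × M × M × M × M => D.map z.1 z.2.1 z.2.2.1 z.2.2.2.1 z.2.2.2.2)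
  supp : PR M (fun z : M × M × M => D.supp z.1 z.2.1 z.2.2)
  el_bdd : ∃ B, ∀ n σ, D.El n σ → σ ∈ᴹ B
  map_bdd : ∃ B, ∀ m n f σ τ, D.map m n f σ τ → τ ∈ᴹ B

variable {D : Predil M}

theorem IsPR.tr (hD : D.IsPR) {σ n : Γ → M} (hσ : PR M σ) (hn : PR M n) :
    PR M (fun z => D.Tr (σ z) (n z)) := by
  unfold Tr
  exact PR.and (by fun_prop) (PR.and (hD.el.comp (f := fun z => (n z, σ z)) (by fun_prop))
    (PR.all_mem (by fun_prop) (hD.supp.comp (f := fun z : Γ × M => (n z.1, σ z.1, z.2))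
      (by fun_prop))))

theorem IsPR.ext_mem (hD : D.IsPR) {X : Γ → ClassOrder M} {p : Γ → M} (hp : PR M p)
    (hXm : PR M (fun z : Γ × M => (X z.1).mem z.2))
    (hXl : PR M (fun z : Γ × M × M => (X z.1).lt z.2.1 z.2.2)) :
    PR M (fun z => (D.ext (X z)).mem (p z)) := by
  unfold Predil.ext
  simp only [exists_and_left]
  refine PR.exists_pair (P := fun z σ a => ∃ n, ∃ e, Enum (X z) a n e ∧ D.Tr σ n) hp
    (PR.ex (u := fun _ => om) (by fun_prop) (fun z n ⟨_, h, _⟩ => h.1)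
      (PR.ex (u := fun z => ATRSet.univ z.1.2) (by fun_prop) (fun z e ⟨h, _⟩ => h.mem_univ_self)
        (PR.and ?_ (hD.tr (by fun_prop) (by fun_prop)))))
  exact PR.enum (X := fun z : (((Γ × M) × M) × M) × M => X z.1.1.1.1) (by fun_prop) (by fun_prop)
      (by fun_prop)
      (hXm.comp (f := fun z : ((((Γ × M) × M) × M) × M) × M => (z.1.1.1.1.1, z.2)) (by fun_prop))
      (hXl.comp (f := fun z : ((((Γ × M) × M) × M) × M) × M × M => (z.1.1.1.1.1, z.2)) (by fun_prop))

theorem IsPR.ext_lt (hD : D.IsPR) {X : Γ → ClassOrder M} {p q : Γ → M} (hp : PR M p) (hq : PR M q)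
    (hXm : PR M (fun z : Γ × M => (X z.1).mem z.2))
    (hXl : PR M (fun z : Γ × M × M => (X z.1).lt z.2.1 z.2.2)) :
    PR M (fun z => (D.ext (X z)).lt (p z) (q z)) := by
  obtain ⟨B, hB⟩ := hD.map_bdd
  refine PR.congr (Q := fun z => ∃ σ a, p z = pair σ a ∧ ∃ τ b, q z = pair τ b ∧
    ∃ c k m n f g σ' τ', (∀ x, x ∈ᴹ c ↔ x ∈ᴹ a ∨ x ∈ᴹ b) ∧
      InclHom (X z) a c k n f ∧ InclHom (X z) b c m n g ∧
      D.map k n f σ σ' ∧ D.map m n g τ τ' ∧ D.lt n σ' τ') ?_ fun z => ?_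
  · refine PR.exists_pair (P := fun z σ a => ∃ τ b, q z = pair τ b ∧
      ∃ c k m n f g σ' τ', (∀ x, x ∈ᴹ c ↔ x ∈ᴹ a ∨ x ∈ᴹ b) ∧
      InclHom (X z) a c k n f ∧ InclHom (X z) b c m n g ∧
      D.map k n f σ σ' ∧ D.map m n g τ τ' ∧ D.lt n σ' τ') hp ?_
    refine PR.exists_pair (f := fun z : (Γ × M) × M => q z.1.1) (P := fun z τ b =>
      ∃ c k m n f g σ' τ', (∀ x, x ∈ᴹ c ↔ x ∈ᴹ z.2 ∨ x ∈ᴹ b) ∧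
      InclHom (X z.1.1) z.2 c k n f ∧ InclHom (X z.1.1) b c m n g ∧
      D.map k n f z.1.2 σ' ∧ D.map m n g τ τ' ∧ D.lt n σ' τ') (by fun_prop) ?_
    -- Bounds for the eight witnesses: the set `c` is finite with elements from `a ∪ b`,
    -- cardinalities lie in `ω`, morphisms in `univ om`, and the values of `D` on morphisms in `B`.
    refine PR.ex (u := fun z => ATRSet.univ (ATRSet.cup z.1.1.2 z.2)) (by fun_prop) ?_
      (PR.ex (u := fun _ => om) (by fun_prop) ?_
      (PR.ex (u := fun _ => om) (by fun_prop) ?_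
      (PR.ex (u := fun _ => om) (by fun_prop) ?_
      (PR.ex (u := fun _ => ATRSet.univ om) (by fun_prop) ?_
      (PR.ex (u := fun _ => ATRSet.univ om) (by fun_prop) ?_
      (PR.ex (u := fun _ => B) (by fun_prop) ?_
      (PR.ex (u := fun _ => B) (by fun_prop) ?_
      (PR.and ?_ (PR.and ?_ (PR.and ?_ (PR.and ?_ (PR.and ?_ ?_))))))))))))
    · rintro z c ⟨k, m, n, f, g, σ', τ', hc, ⟨-, e, e', -, h, -⟩, -⟩
      refine (h.mem_univ (univ_univ _) fun x hx => ?_).2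
      exact (univ_univ _).trans (mem_univ_self _) (mem_cup.2 ((hc x).1 hx))
    · rintro z k ⟨m, n, f, g, σ', τ', hc, ⟨h, -⟩, -⟩
      exact h.1
    · rintro z m ⟨n, f, g, σ', τ', hc, -, ⟨h, -⟩, -⟩
      exact h.1
    · rintro z n ⟨f, g, σ', τ', hc, -, ⟨h, -⟩, -⟩
      exact h.2.1
    · rintro z f ⟨g, σ', τ', hc, ⟨h, -⟩, -⟩
      exact h.mem_univ
    · rintro z g ⟨σ', τ', hc, -, ⟨h, -⟩, -⟩
      exact h.mem_univ
    · rintro z σ' ⟨τ', hc, -, -, h, -⟩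
      exact hB _ _ _ _ _ h
    · rintro z τ' ⟨hc, -, -, -, h, -⟩
      exact hB _ _ _ _ _ h
    · refine PR.all (u := fun z => ATRSet.cup z.1.1.1.1.1.1.1.2
        (ATRSet.cup z.1.1.1.1.1.1.1.1.1.1.2 z.1.1.1.1.1.1.1.1.2)) (by fun_prop) (fun z x h => ?_)
        (by fun_prop)
      by_contra hn
      simp only [mem_cup, not_or] at hn
      exact h (by simp [hn])
    · exact PR.inclHom (X := fun z : (((((((((((Γ × M) × M) × M) × M) × M) × M) × M) × M) × M) × M) × M)
        × M => X z.1.1.1.1.1.1.1.1.1.1.1.1) (by fun_prop) (by fun_prop) (by fun_prop) (by fun_prop)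
        (by fun_prop)
        (hXm.comp (f := fun z : ((((((((((((Γ × M) × M) × M) × M) × M) × M) × M) × M) × M) × M) × M)
          × M) × M => (z.1.1.1.1.1.1.1.1.1.1.1.1.1, z.2)) (by fun_prop))
        (hXl.comp (f := fun z : ((((((((((((Γ × M) × M) × M) × M) × M) × M) × M) × M) × M) × M) × M)
          × M) × M × M => (z.1.1.1.1.1.1.1.1.1.1.1.1.1, z.2)) (by fun_prop))
    · exact PR.inclHom (X := fun z : (((((((((((Γ × M) × M) × M) × M) × M) × M) × M) × M) × M) × M) × M)
        × M => X z.1.1.1.1.1.1.1.1.1.1.1.1) (by fun_prop) (by fun_prop) (by fun_prop) (by fun_prop)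
        (by fun_prop)
        (hXm.comp (f := fun z : ((((((((((((Γ × M) × M) × M) × M) × M) × M) × M) × M) × M) × M) × M)
          × M) × M => (z.1.1.1.1.1.1.1.1.1.1.1.1.1, z.2)) (by fun_prop))
        (hXl.comp (f := fun z : ((((((((((((Γ × M) × M) × M) × M) × M) × M) × M) × M) × M) × M) × M)
          × M) × M × M => (z.1.1.1.1.1.1.1.1.1.1.1.1.1, z.2)) (by fun_prop))
    · exact hD.map.comp (f := fun z : (((((((((((Γ × M) × M) × M) × M) × M) × M) × M) × M) × M) × M) × M)
        × M => (z.1.1.1.1.1.1.2, z.1.1.1.1.2, z.1.1.1.2, z.1.1.1.1.1.1.1.1.1.1.1.2, z.1.2)) (by fun_prop)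
    · exact hD.map.comp (f := fun z : (((((((((((Γ × M) × M) × M) × M) × M) × M) × M) × M) × M) × M) × M)
        × M => (z.1.1.1.1.1.2, z.1.1.1.1.2, z.1.1.2, z.1.1.1.1.1.1.1.1.1.2, z.2)) (by fun_prop)
    · exact hD.lt.comp (f := fun z : (((((((((((Γ × M) × M) × M) × M) × M) × M) × M) × M) × M) × M) × M)
        × M => (z.1.1.1.1.2, z.1.2, z.2)) (by fun_prop)
  · constructor
    · rintro ⟨σ, a, τ, b, h1, h2, h3⟩
      exact ⟨σ, a, h1, τ, b, h2, h3⟩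
    · rintro ⟨σ, a, h1, τ, b, h2, h3⟩
      exact ⟨σ, a, τ, b, h1, h2, h3⟩

/-! ### Definability of the shifted sum -/

theorem code_mem_univ {d E L F S : M} (h : d = code E L F S) :
    E ∈ᴹ univ d ∧ L ∈ᴹ univ d ∧ F ∈ᴹ univ d ∧ S ∈ᴹ univ d := by
  have hU := univ_univ d
  have hd : code E L F S ∈ᴹ univ d := by rw [← h]; exact mem_univ_self d
  unfold code at hd
  exact ⟨hU.left (hU.left hd), hU.right (hU.left hd), hU.left (hU.right hd), hU.right (hU.right hd)⟩

theorem PR.exists_code {d : Γ → M} {P : Γ → M → M → M → M → Prop} (hd : PR M d)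
    (hP : PR M (fun z : (((Γ × M) × M) × M) × M => P z.1.1.1.1 z.1.1.1.2 z.1.1.2 z.1.2 z.2)) :
    PR M (fun z => ∃ E L F S, d z = code E L F S ∧ P z E L F S) := by
  refine PR.ex (u := fun z => univ (d z)) (by fun_prop)
    (fun z _ ⟨_, _, _, h, _⟩ => (code_mem_univ h).1)
    (PR.ex (u := fun z => univ (d z.1)) (by fun_prop)
    (fun z _ ⟨_, _, h, _⟩ => (code_mem_univ h).2.1)
    (PR.ex (u := fun z => univ (d z.1.1)) (by fun_prop)
    (fun z _ ⟨_, h, _⟩ => (code_mem_univ h).2.2.1)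
    (PR.ex (u := fun z => univ (d z.1.1.1)) (by fun_prop)
    (fun z _ ⟨h, _⟩ => (code_mem_univ h).2.2.2) ?_)))
  unfold code
  exact PR.and (by fun_prop) hP

theorem isPR_sum (D l : M) : (sum (ordOrder l) fun α => ofCode (app D α)).IsPR where
  el := by
    refine PR.congr (PR.exists_pair (f := fun z : M × M => z.2) (P := fun z α σ => α ∈ᴹ l ∧
      ∃ E L F S, app D α = code E L F S ∧ pair z.1 σ ∈ᴹ E) (by fun_prop) (PR.and (by fun_prop)
      ?_)) fun z => Iff.rfl
    exact (PR.exists_code (d := fun z : ((M × M) × M) × M => app D z.1.2)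
        (P := fun z E L F S => pair z.1.1.1 z.2 ∈ᴹ E) (by fun_prop) (by fun_prop))
  lt := by
    refine PR.congr (Q := fun z : M × M × M => ∃ α σ, z.2.1 = pair α σ ∧ ∃ β τ, z.2.2 = pair β τ ∧
      α ∈ᴹ l ∧ β ∈ᴹ l ∧ (α ∈ᴹ β ∨ (α = β ∧
        ∃ E L F S, app D α = code E L F S ∧ pair z.1 (pair σ τ) ∈ᴹ L))) ?_ fun z => ?_
    · refine PR.exists_pair (f := fun z : M × M × M => z.2.1) (P := fun z α σ => ∃ β τ,
        z.2.2 = pair β τ ∧ α ∈ᴹ l ∧ β ∈ᴹ l ∧ (α ∈ᴹ β ∨ (α = β ∧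
        ∃ E L F S, app D α = code E L F S ∧ pair z.1 (pair σ τ) ∈ᴹ L))) (by fun_prop)
        (PR.exists_pair (f := fun z : ((M × M × M) × M) × M => z.1.1.2.2) (P := fun z β τ =>
        z.1.2 ∈ᴹ l ∧ β ∈ᴹ l ∧ (z.1.2 ∈ᴹ β ∨ (z.1.2 = β ∧
        ∃ E L F S, app D z.1.2 = code E L F S ∧ pair z.1.1.1 (pair z.2 τ) ∈ᴹ L))) (by fun_prop) 
        (PR.and (by fun_prop) (PR.and (by fun_prop) (PR.or (by fun_prop) (PR.and (by fun_prop) ?_)))))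
      exact PR.exists_code (d := fun z : ((((M × M × M) × M) × M) × M) × M => app D z.1.1.1.2)
        (P := fun z E L F S => pair z.1.1.1.1.1 (pair z.1.1.2 z.2) ∈ᴹ L) (by fun_prop) (by fun_prop)
    · constructor
      · rintro ⟨α, σ, β, τ, h1, h2, h3⟩
        exact ⟨α, σ, h1, β, τ, h2, h3⟩
      · rintro ⟨α, σ, h1, β, τ, h2, h3⟩
        exact ⟨α, σ, β, τ, h1, h2, h3⟩
  map := by
    refine PR.congr (Q := fun z : M × M × M × M × M => ∃ α σ, z.2.2.2.1 = pair α σ ∧ ∃ τ,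
      z.2.2.2.2 = pair α τ ∧ α ∈ᴹ l ∧ ∃ E L F S, app D α = code E L F S ∧
        pair (pair (pair z.1 z.2.1) z.2.2.1) (pair σ τ) ∈ᴹ F) ?_ fun z => ?_
    · refine PR.exists_pair (f := fun z : M × M × M × M × M => z.2.2.2.1) (P := fun z α σ => ∃ τ,
        z.2.2.2.2 = pair α τ ∧ α ∈ᴹ l ∧ ∃ E L F S, app D α = code E L F S ∧
        pair (pair (pair z.1 z.2.1) z.2.2.1) (pair σ τ) ∈ᴹ F) (by fun_prop)
        (PR.exists_eq_pair (f := fun z : ((M × M × M × M × M) × M) × M => z.1.1.2.2.2.2)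
          (g := fun z => z.1.2) (P := fun z τ => z.1.2 ∈ᴹ l ∧ ∃ E L F S,
          app D z.1.2 = code E L F S ∧
          pair (pair (pair z.1.1.1 z.1.1.2.1) z.1.1.2.2.1) (pair z.2 τ) ∈ᴹ F) (by fun_prop)
          (by fun_prop) (PR.and (by fun_prop) ?_))
      exact PR.exists_code (d := fun z : (((M × M × M × M × M) × M) × M) × M => app D z.1.1.2)
        (P := fun z E L F S => pair (pair (pair z.1.1.1.1 z.1.1.1.2.1) z.1.1.1.2.2.1)
          (pair z.1.2 z.2) ∈ᴹ F) (by fun_prop) (by fun_prop)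
    · constructor
      · rintro ⟨α, σ, τ, h1, h2, h3⟩
        exact ⟨α, σ, h1, τ, h2, h3⟩
      · rintro ⟨α, σ, h1, τ, h2, h3⟩
        exact ⟨α, σ, τ, h1, h2, h3⟩
  supp := by
    refine PR.congr (PR.exists_pair (f := fun z : M × M × M => z.2.1) (P := fun z α σ => α ∈ᴹ l ∧
      ∃ E L F S, app D α = code E L F S ∧ pair z.1 (pair σ z.2.2) ∈ᴹ S) (by fun_prop)
      (PR.and (by fun_prop) ?_)) fun z => Iff.rfl
    exact PR.exists_code (d := fun z : ((M × M × M) × M) × M => app D z.1.2)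
        (P := fun z E L F S => pair z.1.1.1 (pair z.2 z.1.1.2.2) ∈ᴹ S) (by fun_prop) (by fun_prop)
  el_bdd := by
    have hU := univ_univ (pair D l)
    obtain ⟨h1, h2⟩ := hU.pair_mem_iff.1 (mem_univ_self (pair D l))
    refine ⟨univ (pair D l), ?_⟩
    rintro n _ ⟨α, σ, rfl, hα, E, L, F, S, hc, h⟩
    have hd := hU.app_mem (x := α) h1
    rw [hc] at hd
    exact hU.pair (hU.trans h2 hα) (hU.right (hU.trans (hU.left (hU.left hd)) h))
  map_bdd := by
    have hU := univ_univ (pair D l)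
    obtain ⟨h1, h2⟩ := hU.pair_mem_iff.1 (mem_univ_self (pair D l))
    refine ⟨univ (pair D l), ?_⟩
    rintro m n f _ _ ⟨α, σ, τ, rfl, rfl, hα, E, L, F, S, hc, h⟩
    have hd := hU.app_mem (x := α) h1
    rw [hc] at hd
    exact hU.pair (hU.trans h2 hα) (hU.right (hU.right (hU.trans (hU.left (hU.right hd)) h)))

/-! ### Bounded versions of shifted predilators -/

/-- The restriction of the data of `D` to relevant arguments. -/
def restrict (D : Predil M) (B : M) : Predil M where
  El n σ := n ∈ᴹ om ∧ D.El n σ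
  lt := D.lt
  map m n f σ τ := τ ∈ᴹ B ∧ D.map m n f σ τ
  supp := D.supp

/-- The relations of a shift make sense for arbitrary arguments in place of `n` and `f`, and no set
bounds them. Cutting them down changes nothing at natural numbers and actual morphisms: both
versions are initial segments of each other, and so fixed points can be transferred by
`IsPsiWith.of_agree`. -/
theorem restrict_sub (D : Predil M) {B : M} (hD : D.WPre) (hB : ∀ n σ, n ∈ᴹ om → D.El n σ → σ ∈ᴹ B) :
    (D.restrict B).Sub D where
  ini hn := ⟨And.right, fun _ _ => Iff.rfl, fun h _ _ => ⟨hn, h⟩⟩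
  map_iff hf hσ := ⟨And.right, fun h => ⟨hB _ _ hf.2.1 (hD.map_mem _ _ _ _ _ hf hσ.2 h), h⟩⟩
  supp_iff _ _ := Iff.rfl
  reflect hf hσ _ _ := ⟨hf.1, hσ⟩

theorem sub_restrict (D : Predil M) {B : M} (hD : D.WPre) (hB : ∀ n σ, n ∈ᴹ om → D.El n σ → σ ∈ᴹ B) :
    D.Sub (D.restrict B) where
  ini hn := ⟨fun h => ⟨hn, h⟩, fun _ _ => Iff.rfl, fun h _ _ => h.2⟩
  map_iff hf hσ := ⟨fun h => ⟨hB _ _ hf.2.1 (hD.map_mem _ _ _ _ _ hf hσ h), h⟩, And.right⟩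
  supp_iff _ _ := Iff.rfl
  reflect _ hσ _ _ := hσ.2

theorem WPre.restrict {D : Predil M} {B : M} (hD : D.WPre)
    (hB : ∀ n σ, n ∈ᴹ om → D.El n σ → σ ∈ᴹ B) : (D.restrict B).WPre where
  linear n hn := ⟨fun x hx => (hD.linear n hn).1 x hx.2,
    fun x y z hx hy hz => (hD.linear n hn).2.1 x y z hx.2 hy.2 hz.2,
    fun x y hx hy => (hD.linear n hn).2.2 x y hx.2 hy.2⟩
  map_fun m n f σ hf hσ := by
    obtain ⟨τ, h, hu⟩ := hD.map_fun m n f σ hf hσ.2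
    exact ⟨τ, ⟨hB _ _ hf.2.1 (hD.map_mem _ _ _ _ _ hf hσ.2 h), h⟩, fun τ' h' => hu τ' h'.2⟩
  map_mem m n f σ τ hf hσ h := ⟨hf.2.1, hD.map_mem _ _ _ _ _ hf hσ.2 h.2⟩
  map_lt m n f σ σ' τ τ' hf hσ hσ' h h' := hD.map_lt m n f σ σ' τ τ' hf hσ.2 hσ'.2 h.2 h'.2
  map_comp k m n f g h ρ σ τ hf hg hh hfg hρ h1 h2 :=
    ⟨h2.1, hD.map_comp k m n f g h ρ σ τ hf hg hh hfg hρ.2 h1.2 h2.2⟩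
  supp_sub n σ i hn hσ := hD.supp_sub n σ i hn hσ.2
  supp_nat m n f σ τ hf hσ h := hD.supp_nat m n f σ τ hf hσ.2 h.2

theorem Sub.trans {D D' D'' : Predil M} (h : D.Sub D') (h' : D'.Sub D'') :
    D.Sub D'' where
  ini hn := ⟨fun hx => (h'.ini hn).mem ((h.ini hn).mem hx), fun hx hy => ((h.ini hn).lt_iff hx hy).trans
      ((h'.ini hn).lt_iff ((h.ini hn).mem hx) ((h.ini hn).mem hy)),
    fun hx hy hl => by
      have hx' := (h'.ini hn).down hx ((h.ini hn).mem hy) hl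
      exact (h.ini hn).down hx' hy (((h'.ini hn).lt_iff hx' ((h.ini hn).mem hy)).2 hl)⟩
  map_iff hf hσ := (h.map_iff hf hσ).trans (h'.map_iff hf ((h.ini hf.1).mem hσ))
  supp_iff hn hσ := (h.supp_iff hn hσ).trans (h'.supp_iff hn ((h.ini hn).mem hσ))
  reflect {m n f σ τ} hf hσ hm hτ := by
    have hσ' := h'.reflect hf hσ hm ((h.ini hf.2.1).mem hτ)
    exact h.reflect hf hσ' ((h'.map_iff hf hσ').2 hm) hτ

theorem IsPsiWith.of_agree {D D' : Predil M} {Ω π : M} (hD : D.WPre) (hD' : D'.WPre)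
    (h1 : D'.Sub D) (h2 : D.Sub D') (hΩ : IsOrd Ω) (h : D'.IsPsiWith Ω π) : D.IsPsiWith Ω π := by
  have ini := h1.ext hD' hD (ordOrder_small hΩ)
  refine ⟨h.isFunOn, fun α hα => ini.mem (h.mem α hα), fun α β hα hβ hαβ =>
    (ini.lt_iff (h.mem α hα) (h.mem β hβ)).1 (h.lt α β hα hβ hαβ), h.supp, fun τ hτ hs => ?_⟩
  refine h.surj τ (h2.ext_mem hτ) fun α hα => ?_
  have hαΩ : α ∈ᴹ Ω := ext_mem_supp hτ hα
  exact (ini.lt_iff (h.mem α hαΩ) (h2.ext_mem hτ)).2 (hs α hα)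

theorem PR.extSupp {p x : Γ → M} (hp : PR M p) (hx : PR M x) :
    PR M (fun z => Predil.extSupp (p z) (x z)) :=
  PR.exists_pair (P := fun z _ a => x z ∈ᴹ a) hp (by fun_prop)

theorem PR.add_ord_mem (γ : M) {X : Γ → M} (hX : PR M X) :
    PR M (fun z : Γ × M => ((ordOrder γ).add (ordOrder (X z.1))).mem z.2) :=
  PR.add_mem (X := fun _ => ordOrder γ) (Y := fun z => ordOrder (X z))
    (by unfold ordOrder; fun_prop) (by unfold ordOrder; fun_prop)

theorem PR.add_ord_lt (γ : M) {X : Γ → M} :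
    PR M (fun z : Γ × M × M => ((ordOrder γ).add (ordOrder (X z.1))).lt z.2.1 z.2.2) :=
  PR.add_lt (X := fun _ => ordOrder γ) (Y := fun z => ordOrder (X z))
    (by unfold ordOrder; fun_prop) (by unfold ordOrder; fun_prop)

/-- The equivalence that describes the image `b` is split into two inclusions in which `y` ranges
over `b` or over the universe generated by `x` and `f`. The latter is large enough, since a value of
`γ + f` at `x` is `x` itself or a pair formed from a value of `f`. -/
theorem PR.extMap {γ : M} {m f p q : Γ → M} (hm : PR M m) (hf : PR M f) (hp : PR M p) (hq : PR M q) :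
    PR M (fun z => Predil.extMap (Predil.addMap γ (m z) (f z)) (p z) (q z)) := by
  refine PR.congr (Q := fun z => ∃ σ a, p z = pair σ a ∧ ∃ b, q z = pair σ b ∧
    (∀ y, y ∈ᴹ b → ∃ x, x ∈ᴹ a ∧ Predil.addMap γ (m z) (f z) x y) ∧
    ∀ x, x ∈ᴹ a → ∀ y, y ∈ᴹ univ (pair x (f z)) → Predil.addMap γ (m z) (f z) x y → y ∈ᴹ b) ?_ fun z => ?_
  · refine PR.exists_pair (P := fun z σ a => ∃ b, q z = pair σ b ∧
      (∀ y, y ∈ᴹ b → ∃ x, x ∈ᴹ a ∧ Predil.addMap γ (m z) (f z) x y) ∧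
      ∀ x, x ∈ᴹ a → ∀ y, y ∈ᴹ univ (pair x (f z)) → Predil.addMap γ (m z) (f z) x y → y ∈ᴹ b) hp
      (PR.exists_eq_pair (f := fun z : (Γ × M) × M => q z.1.1) (g := fun z => z.1.2) (P := fun z b =>
        (∀ y, y ∈ᴹ b → ∃ x, x ∈ᴹ z.2 ∧ Predil.addMap γ (m z.1.1) (f z.1.1) x y) ∧
        ∀ x, x ∈ᴹ z.2 → ∀ y, y ∈ᴹ univ (pair x (f z.1.1)) → Predil.addMap γ (m z.1.1) (f z.1.1) x y →
          y ∈ᴹ b) (by fun_prop) (by fun_prop) (PR.and ?_ ?_))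
    · exact PR.all_mem (by fun_prop) (PR.ex_mem (by fun_prop) (by fun_prop))
    · exact PR.all_mem (by fun_prop) (PR.all_mem (by fun_prop) (by fun_prop))
  · have key : ∀ a b, (∀ y, y ∈ᴹ b ↔ ∃ x, x ∈ᴹ a ∧ Predil.addMap γ (m z) (f z) x y) ↔
        ((∀ y, y ∈ᴹ b → ∃ x, x ∈ᴹ a ∧ Predil.addMap γ (m z) (f z) x y) ∧ ∀ x, x ∈ᴹ a → ∀ y,
          y ∈ᴹ univ (pair x (f z)) → Predil.addMap γ (m z) (f z) x y → y ∈ᴹ b) := by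
      intro a b
      refine ⟨fun h => ⟨fun y => (h y).1, fun x hx y _ hxy => (h y).2 ⟨x, hx, hxy⟩⟩,
        fun h y => ⟨h.1 y, ?_⟩⟩
      rintro ⟨x, hx, hxy⟩
      refine h.2 x hx y ?_ hxy
      have hU := univ_univ (pair x (f z))
      obtain ⟨h1, h2⟩ := hU.pair_mem_iff.1 (mem_univ_self (pair x (f z)))
      rcases hxy with ⟨w, -, rfl, rfl⟩ | ⟨i, -, rfl, rfl⟩
      · exact h1
      · exact hU.pair (hU.adj hU.empty hU.empty) (hU.app_mem h2)
    constructor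
    · rintro ⟨σ, a, b, h1, h2, h3⟩
      exact ⟨σ, a, h1, b, h2, (key a b).1 h3⟩
    · rintro ⟨σ, a, h1, b, h2, h3⟩
      exact ⟨σ, a, b, h1, h2, (key a b).2 h3⟩

theorem exists_bound_shift {D : Predil M} (hD : D.IsPR) (γ : M) :
    ∃ B, ∀ n σ, n ∈ᴹ om → (D.shift γ).El n σ → σ ∈ᴹ B := by
  obtain ⟨B, hB⟩ := hD.el_bdd
  refine ⟨univ (pair B γ), fun n p hn hp => ?_⟩
  have hU := univ_univ (pair B γ)
  obtain ⟨h1, h2⟩ := hU.pair_mem_iff.1 (mem_univ_self (pair B γ))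
  obtain ⟨σ, a, k, e, rfl, he, hσ⟩ := hp
  refine hU.pair (hU.trans h1 (hB _ _ hσ.2.1)) (he.mem_univ hU fun x hx => ?_).2
  rcases he.mem hx with ⟨z, hz, rfl⟩ | ⟨z, hz, rfl⟩
  · exact hU.pair hU.empty (hU.trans h2 hz)
  · exact hU.pair (hU.adj hU.empty hU.empty) (hU.of_mem_om z (om_trans hn hz))

theorem IsPR.shift_restrict {D : Predil M} (hD : D.IsPR) {γ B : M}
    (hB : ∀ n σ, n ∈ᴹ om → (D.shift γ).El n σ → σ ∈ᴹ B) : ((D.shift γ).restrict B).IsPR where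
  el := PR.and (by fun_prop) (hD.ext_mem (Γ := M × M)
    (X := fun z => (ordOrder γ).add (ordOrder z.1)) (by fun_prop)
    (PR.add_ord_mem γ (by fun_prop)) (PR.add_ord_lt γ))
  lt := hD.ext_lt (Γ := M × M × M)
    (X := fun z => (ordOrder γ).add (ordOrder z.1)) (by fun_prop) (by fun_prop)
    (PR.add_ord_mem γ (by fun_prop)) (PR.add_ord_lt γ)
  map := PR.and (by fun_prop) (PR.extMap (by fun_prop) (by fun_prop) (by fun_prop) (by fun_prop))
  supp := PR.and (by fun_prop) (PR.extSupp (by fun_prop) (by fun_prop))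
  el_bdd := ⟨B, fun n σ h => hB n σ h.1 h.2⟩
  map_bdd := ⟨B, fun _ _ _ _ _ h => h.1⟩

/-! ### The term order -/

/-- The strict part of a reflexive order that is given by a set of ordered pairs. -/
def strictPart (S : M) : ClassOrder M where
  mem x := pair x x ∈ᴹ S
  lt x y := x ≠ y ∧ pair x y ∈ᴹ S

/-- The element `p` of `D(X)` is a term over `X`. -/
def IsTerm (D : Predil M) (X : ClassOrder M) (p : M) : Prop :=
  (D.ext X).mem p ∧ ∀ s, extSupp p s → (D.ext X).lt s p

/-- The reflexive order on terms over `X`. -/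
def TermLe (D : Predil M) (X : ClassOrder M) (p q : M) : Prop :=
  D.IsTerm X p ∧ D.IsTerm X q ∧ (p = q ∨ (D.ext X).lt p q)

theorem strictPart_mem_univ {S x : M} (h : (strictPart S).mem x) : x ∈ᴹ univ S :=
  (univ_univ S).left ((univ_univ S).trans (mem_univ_self S) h)

theorem PR.strictPart_mem {S : Γ → M} (hS : PR M S) :
    PR M (fun z : Γ × M => (strictPart (S z.1)).mem z.2) := by
  unfold strictPart; fun_prop

theorem PR.strictPart_lt {S : Γ → M} (hS : PR M S) :
    PR M (fun z : Γ × M × M => (strictPart (S z.1)).lt z.2.1 z.2.2) := by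
  unfold strictPart
  exact PR.and (PR.not (by fun_prop)) (by fun_prop)

theorem strictPart_small {S : M} (h : (strictPart S).IsLinear) : Small (strictPart S) :=
  ⟨h, ⟨univ S, fun _ => strictPart_mem_univ⟩,
    (PR.strictPart_mem (Γ := M) (S := fun _ => S) (by fun_prop)).comp (f := fun x => (x, x))
      (by fun_prop),
    (PR.strictPart_lt (Γ := M) (S := fun _ => S) (by fun_prop)).comp (f := fun x => (x.1, x))
      (by fun_prop)⟩

theorem PR.linear_strictPart {S : Γ → M} (hS : PR M S) :
    PR M (fun z => (strictPart (S z)).IsLinear) := by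
  refine PR.congr (Q := fun z => (∀ x, x ∈ᴹ univ (S z) → (strictPart (S z)).mem x →
      ¬ (strictPart (S z)).lt x x) ∧
    (∀ x, x ∈ᴹ univ (S z) → ∀ y, y ∈ᴹ univ (S z) → ∀ w, w ∈ᴹ univ (S z) →
      (strictPart (S z)).mem x → (strictPart (S z)).mem y → (strictPart (S z)).mem w →
      (strictPart (S z)).lt x y → (strictPart (S z)).lt y w → (strictPart (S z)).lt x w) ∧
    (∀ x, x ∈ᴹ univ (S z) → ∀ y, y ∈ᴹ univ (S z) → (strictPart (S z)).mem x →
      (strictPart (S z)).mem y →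
      (strictPart (S z)).lt x y ∨ x = y ∨ (strictPart (S z)).lt y x)) ?_ fun z => ?_
  · simp only [strictPart, ne_eq]
    refine PR.and (PR.all_mem (by fun_prop) (by fun_prop)) (PR.and (PR.all_mem (by fun_prop)
      (PR.all_mem (by fun_prop) (PR.all_mem (by fun_prop) (by fun_prop)))) (PR.all_mem (by fun_prop)
      (PR.all_mem (by fun_prop) (by fun_prop))))
  · have := fun x => strictPart_mem_univ (S := S z) (x := x)
    constructor
    · rintro ⟨h1, h2, h3⟩
      exact ⟨fun x _ => h1 x, fun x _ y _ w _ => h2 x y w, fun x _ y _ => h3 x y⟩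
    · rintro ⟨h1, h2, h3⟩
      exact ⟨fun x hx => h1 x (this x hx) hx, fun x y w hx hy hw => h2 x (this x hx) y (this y hy) w
        (this w hw) hx hy hw, fun x y hx hy => h3 x (this x hx) y (this y hy) hx hy⟩

/-- The term order will be a fixed point of the operator `Φ`, which must be primitive recursive to
be iterated. Orders are coded reflexively so that one set of pairs determines the field as well as
the order. All terms over `S` lie in the universe generated by `S` and the bound `B` for the
elements of `D(n)`. -/
theorem exists_terms_step {D : Predil M} (hD : D.IsPR) : ∃ Φ : M → M, PR M Φ ∧
    (∀ S p q, pair p q ∈ᴹ Φ S ↔ D.TermLe (strictPart S) p q) ∧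
    ∀ S z, z ∈ᴹ Φ S → ∃ p q, z = pair p q := by
  obtain ⟨B, hB⟩ := hD.el_bdd
  have hmem : PR M (fun z : M × M => (D.ext (strictPart z.1)).mem z.2) :=
    hD.ext_mem (Γ := M × M) (X := fun z => strictPart z.1) (by fun_prop)
      (PR.strictPart_mem (by fun_prop)) (PR.strictPart_lt (by fun_prop))
  have hlt : PR M (fun z : M × M × M => (D.ext (strictPart z.1)).lt z.2.1 z.2.2) :=
    hD.ext_lt (Γ := M × M × M) (X := fun z => strictPart z.1) (by fun_prop) (by fun_prop)
      (PR.strictPart_mem (by fun_prop)) (PR.strictPart_lt (by fun_prop))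
  have hT : PR M (fun z : M × M => D.IsTerm (strictPart z.1) z.2) := by
    refine PR.and hmem (PR.all (u := fun z => univ z.2) (by fun_prop) (fun z s h => ?_)
      (PR.imp (PR.extSupp (by fun_prop) (by fun_prop))
        (hlt.comp (f := fun z : (M × M) × M => (z.1.1, z.2, z.1.2)) (by fun_prop))))
    obtain ⟨⟨σ, a, h, hs⟩, -⟩ := Classical.not_imp.1 h
    exact (univ_univ _).trans (right_mem_univ h) hs
  obtain ⟨Φ, hΦ, h⟩ := PR.exists_sep (Γ := M) (u := fun S => univ (pair B S))
    (P := fun S z => ∃ p q, z = pair p q ∧ D.TermLe (strictPart S) p q) (by fun_prop)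
    (PR.exists_pair (f := fun z : M × M => z.2) (P := fun z p q => D.TermLe (strictPart z.1) p q)
      (by fun_prop) (PR.and
        (hT.comp (f := fun z : ((M × M) × M) × M => (z.1.1.1, z.1.2)) (by fun_prop)) (PR.and
        (hT.comp (f := fun z : ((M × M) × M) × M => (z.1.1.1, z.2)) (by fun_prop)) (PR.or
        (by fun_prop)
        (hlt.comp (f := fun z : ((M × M) × M) × M => (z.1.1.1, z.1.2, z.2)) (by fun_prop))))))
  refine ⟨Φ, hΦ, fun S p q => ?_, fun S z hz => ?_⟩
  · rw [h]
    constructor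
    · rintro ⟨-, p', q', e, hpq⟩
      obtain ⟨rfl, rfl⟩ := pair_inj.1 e
      exact hpq
    · intro hpq
      have hU := univ_univ (pair B S)
      obtain ⟨h1, h2⟩ := hU.pair_mem_iff.1 (mem_univ_self (pair B S))
      have key : ∀ p, D.IsTerm (strictPart S) p → p ∈ᴹ univ (pair B S) := by
        rintro _ ⟨⟨σ, a, n, e, rfl, he, hσ⟩, -⟩
        exact hU.pair (hU.trans h1 (hB _ _ hσ.2.1))
          (he.mem_univ hU fun x hx => hU.left (hU.trans h2 (he.mem hx))).2
      exact ⟨hU.pair (key _ hpq.1) (key _ hpq.2.1), p, q, rfl, hpq⟩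
  · obtain ⟨-, p, q, rfl, -⟩ := (h S z).1 hz
    exact ⟨p, q, rfl⟩

theorem ext_lt_supp {D : Predil M} {X : ClassOrder M} {p q x : M} (h : (D.ext X).lt p q)
    (hx : extSupp p x ∨ extSupp q x) : X.mem x := by
  obtain ⟨σ, a, τ, b, rfl, rfl, c, k, m, n, f, g, σ', τ', hc, ⟨-, e, e', he, -⟩,
    ⟨-, e₁, e₁', he₁, -⟩, -⟩ := h
  rw [extSupp_pair, extSupp_pair] at hx
  exact hx.elim he.mem he₁.mem

/-- Adding pairs keeps all strict comparisons of `S`, so the inclusion of the fields preserves the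
order and hence acts on the extended predilator. -/
theorem TermLe.mono {D : Predil M} {S S' : M} (hS : (strictPart S).IsLinear)
    (h : ∀ z, z ∈ᴹ S → z ∈ᴹ S') {p q : M} (hpq : D.TermLe (strictPart S) p q) :
    D.TermLe (strictPart S') p q := by
  have hlt : ∀ p q, (D.ext (strictPart S)).lt p q → (D.ext (strictPart S')).lt p q := fun p q hl =>
    ext_lt_of_supp hS hl (fun x hx => h _ (ext_lt_supp hl hx))
      fun x y _ _ hxy => ⟨hxy.1, h _ hxy.2⟩
  have hT : ∀ p, D.IsTerm (strictPart S) p → D.IsTerm (strictPart S') p := fun p hp =>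
    ⟨ext_mem_of_supp hp.1 (fun x hx => h _ (ext_mem_supp hp.1 hx))
      fun x y _ _ hxy => ⟨hxy.1, h _ hxy.2⟩, fun s hs => hlt s p (hp.2 s hs)⟩
  exact ⟨hT p hpq.1, hT q hpq.2.1, hpq.2.2.imp id (hlt p q)⟩

theorem linear_of_termLe {D : Predil M} (hD : D.WPre) {S S' : M} (hS : (strictPart S).IsLinear)
    (h : ∀ p q, pair p q ∈ᴹ S' ↔ D.TermLe (strictPart S) p q) : (strictPart S').IsLinear := by
  have hlin := ext_linear hD (strictPart_small hS)
  have hm : ∀ {p}, (strictPart S').mem p → (D.ext (strictPart S)).mem p :=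
    fun {p} hp => ((h p p).1 hp).1.1
  have hlt : ∀ {p q}, (strictPart S').lt p q → (D.ext (strictPart S)).lt p q := fun {p q} hpq =>
    ((h p q).1 hpq.2).2.2.resolve_left hpq.1
  have hlt' : ∀ {p q}, (strictPart S').mem p → (strictPart S').mem q →
      (D.ext (strictPart S)).lt p q → (strictPart S').lt p q := fun {p q} hp hq hpq => by
    refine ⟨?_, (h p q).2 ⟨((h p p).1 hp).1, ((h q q).1 hq).1, Or.inr hpq⟩⟩
    rintro rfl
    exact hlin.1 _ (hm hp) hpq
  refine ⟨fun x _ hx => hx.1 rfl, fun x y z hx hy hz hxy hyz => ?_, fun x y hx hy => ?_⟩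
  · exact hlt' hx hz (hlin.2.1 _ _ _ (hm hx) (hm hy) (hm hz) (hlt hxy) (hlt hyz))
  · exact (hlin.2.2 x y (hm hx) (hm hy)).imp (hlt' hx hy) (Or.imp id (hlt' hy hx))

/-- The linear order of terms over a predilator, as an inductively defined fixed point. -/
theorem exists_terms {D : Predil M} (hD : D.WPre) (hP : D.IsPR) : ∃ X : ClassOrder M, Small X ∧
    (∀ p, X.mem p ↔ D.IsTerm X p) ∧
    (∀ p q, X.mem p → X.mem q → (X.lt p q ↔ (D.ext X).lt p q)) ∧
    ∀ P : M → Prop, PR M P → (∀ p, X.mem p → (∀ s, extSupp p s → P s) → P p) →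
      ∀ p, X.mem p → P p := by
  obtain ⟨Φ, hΦ, hΦ', hΦp⟩ := exists_terms_step hP
  -- With `W n` the union of `R m` over `m ∈ n`, the recursion reads `R n = Φ (W n)`. Once the
  -- stages are known to increase, this yields `W (n + 1) = Φ (W n)`.
  obtain ⟨R, hR, hR'⟩ := PR.recursion (Γ := M) (h := fun w _ _ => Φ w)
    (hΦ.comp (f := fun z : M × M × M => z.1) (by fun_prop))
  obtain ⟨W, hW, hW'⟩ := PR.exists_bUnion (Γ := M) (u := fun n => n) (F := fun _ m => R m empty)
    (by fun_prop) (hR.comp (f := fun z : M × M => (z.2, empty)) (by fun_prop))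
  have hRW : ∀ n, R n empty = Φ (W n) := fun n => by
    obtain ⟨w, hw, e⟩ := hR' n empty
    rw [e, show w = W n from ATRSet.ext fun z => by rw [hw, hW']]
  have mW : ∀ n z, z ∈ᴹ W n ↔ ∃ m, m ∈ᴹ n ∧ z ∈ᴹ Φ (W m) := by
    simpa only [hRW] using hW'
  have Wmono : ∀ n, IsOrd n → ∀ m, m ∈ᴹ n → ∀ z, z ∈ᴹ W m → z ∈ᴹ W n := fun n hn m hm z hz => by
    obtain ⟨k, hk, hz⟩ := (mW m z).1 hz
    exact (mW n z).2 ⟨k, hn.1 m hm k hk, hz⟩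
  have Φmono : ∀ S S', (strictPart S).IsLinear → (∀ z, z ∈ᴹ S → z ∈ᴹ S') →
      ∀ z, z ∈ᴹ Φ S → z ∈ᴹ Φ S' := fun S S' hS h z hz => by
    obtain ⟨p, q, rfl⟩ := hΦp S z hz
    exact (hΦ' S' p q).2 (((hΦ' S p q).1 hz).mono hS h)
  have Wsucc' : ∀ n, (∀ z, z ∈ᴹ W n → z ∈ᴹ Φ (W n)) → W (adj n n) = Φ (W n) := fun n h =>
    ATRSet.ext fun z => by
      rw [mW]
      constructor
      · rintro ⟨m, hm, hz⟩
        rcases mem_adj.1 hm with hm | rfl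
        · exact h z ((mW n z).2 ⟨m, hm, hz⟩)
        · exact hz
      · exact fun hz => ⟨n, by simp, hz⟩
  -- Linearity of a stage and inclusion in the next stage are proved together, as `Φ` is known to be
  -- monotone only above linear stages.
  have C : ∀ n, n ∈ᴹ om → (strictPart (W n)).IsLinear ∧ ∀ z, z ∈ᴹ W n → z ∈ᴹ Φ (W n) := by
    refine om_induction (P := fun n => (strictPart (W n)).IsLinear ∧
      ∀ z, z ∈ᴹ W n → z ∈ᴹ Φ (W n)) (PR.and (PR.linear_strictPart (by fun_prop))
      (PR.all_mem (by fun_prop) (by fun_prop))) ?_ fun n hn ih => ?_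
    · have h0 : ∀ z, ¬ z ∈ᴹ W empty := fun z hz => by
        obtain ⟨m, hm, -⟩ := (mW _ _).1 hz
        exact not_mem_empty _ hm
      exact ⟨⟨fun x hx => (h0 _ hx).elim, fun x _ _ hx => (h0 _ hx).elim,
        fun x _ hx => (h0 _ hx).elim⟩, fun z hz => (h0 _ hz).elim⟩
    · have hs := Wsucc' n ih.2
      refine ⟨linear_of_termLe hD ih.1 fun p q => by rw [hs, hΦ'], ?_⟩
      rw [hs]
      exact Φmono _ _ ih.1 ih.2
  have Wsucc : ∀ n, n ∈ᴹ om → W (adj n n) = Φ (W n) := fun n hn => Wsucc' n (C n hn).2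
  have mO : ∀ z, z ∈ᴹ W om ↔ ∃ n, n ∈ᴹ om ∧ z ∈ᴹ W n := fun z => by
    constructor
    · intro hz
      obtain ⟨n, hn, hz⟩ := (mW _ _).1 hz
      exact ⟨_, succ_mem_om hn, by rwa [Wsucc n hn]⟩
    · rintro ⟨n, hn, hz⟩
      exact Wmono om isOrd_om n hn z hz
  have dir : ∀ z z', z ∈ᴹ W om → z' ∈ᴹ W om → ∃ n, n ∈ᴹ om ∧ z ∈ᴹ W n ∧ z' ∈ᴹ W n := by
    intro z z' hz hz'
    obtain ⟨n, hn, hz⟩ := (mO z).1 hz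
    obtain ⟨m, hm, hz'⟩ := (mO z').1 hz'
    have hno := isOrd_of_mem_om hn
    have hmo := isOrd_of_mem_om hm
    rcases hno.trichotomy hmo with h | rfl | h
    · exact ⟨m, hm, Wmono m hmo n h z hz, hz'⟩
    · exact ⟨n, hn, hz, hz'⟩
    · exact ⟨n, hn, hz, Wmono n hno m h z' hz'⟩
  have fld : ∀ n p q, pair p q ∈ᴹ W n → (strictPart (W n)).mem p ∧ (strictPart (W n)).mem q := by
    intro n p q h
    obtain ⟨m, hm, h⟩ := (mW _ _).1 h
    have h' := (hΦ' _ _ _).1 h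
    exact ⟨(mW _ _).2 ⟨m, hm, (hΦ' _ _ _).2 ⟨h'.1, h'.1, Or.inl rfl⟩⟩,
      (mW _ _).2 ⟨m, hm, (hΦ' _ _ _).2 ⟨h'.2.1, h'.2.1, Or.inl rfl⟩⟩⟩
  have hlin : (strictPart (W om)).IsLinear := by
    refine ⟨fun x _ hx => hx.1 rfl, fun x y z _ _ _ hxy hyz => ?_, fun x y hx hy => ?_⟩
    · obtain ⟨n, hn, h1, h2⟩ := dir _ _ hxy.2 hyz.2
      have := (C n hn).1.2.1 x y z (fld n _ _ h1).1 (fld n _ _ h1).2 (fld n _ _ h2).2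
        ⟨hxy.1, h1⟩ ⟨hyz.1, h2⟩
      exact ⟨this.1, Wmono om isOrd_om n hn _ this.2⟩
    · obtain ⟨n, hn, h1, h2⟩ := dir _ _ hx hy
      exact ((C n hn).1.2.2 x y h1 h2).imp (fun h => ⟨h.1, Wmono om isOrd_om n hn _ h.2⟩)
        (Or.imp id fun h => ⟨h.1, Wmono om isOrd_om n hn _ h.2⟩)
  have hX := strictPart_small hlin
  -- A comparison that holds in the limit already holds at any stage that contains both elements,
  -- since this stage is linear and its order is preserved.
  have hback : ∀ n, n ∈ᴹ om → ∀ x y, (strictPart (W n)).mem x → (strictPart (W n)).mem y →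
      (strictPart (W om)).lt x y → (strictPart (W n)).lt x y := by
    intro n hn x y hx hy hl
    rcases (C n hn).1.2.2 x y hx hy with h | h | h
    · exact h
    · exact absurd h hl.1
    · have hx' := Wmono om isOrd_om n hn _ hx
      have hy' := Wmono om isOrd_om n hn _ hy
      exact absurd (hlin.2.1 x y x hx' hy' hx' hl ⟨h.1, Wmono om isOrd_om n hn _ h.2⟩) (hlin.1 x hx')
  -- This is why `ω` steps suffice: a finite support in the limit is contained in one stage, so that
  -- a term over the limit is a term over this stage and appears in the next one.
  have hfin : ∀ a, FinSub (strictPart (W om)) a → ∃ n, n ∈ᴹ om ∧ ∀ x, x ∈ᴹ a →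
      (strictPart (W n)).mem x := by
    refine hX.finSub_induction (PR.ex_mem (by fun_prop) (PR.all_mem (by fun_prop) ?_))
      ⟨empty, by simp, by simp⟩ fun a y _ hy _ ⟨n, hn, ih⟩ => ?_
    · unfold strictPart; fun_prop
    · obtain ⟨m, hm, hy⟩ := (mO _).1 hy
      have hno := isOrd_of_mem_om hn
      have hmo := isOrd_of_mem_om hm
      rcases hno.trichotomy hmo with h | rfl | h
      · refine ⟨m, hm, fun x hx => ?_⟩
        rcases mem_adj.1 hx with hx | rfl
        · exact Wmono m hmo n h _ (ih x hx)
        · exact hy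
      · refine ⟨n, hn, fun x hx => ?_⟩
        rcases mem_adj.1 hx with hx | rfl
        · exact ih x hx
        · exact hy
      · refine ⟨n, hn, fun x hx => ?_⟩
        rcases mem_adj.1 hx with hx | rfl
        · exact ih x hx
        · exact Wmono n hno m h _ hy
  have hfix : ∀ p q, pair p q ∈ᴹ W om ↔ D.TermLe (strictPart (W om)) p q := by
    intro p q
    constructor
    · intro h
      obtain ⟨n, hn, h⟩ := (mW _ _).1 h
      exact ((hΦ' _ _ _).1 h).mono (C n hn).1 (Wmono om isOrd_om n hn)
    · intro h
      obtain ⟨n, hn, hs⟩ : ∃ n, n ∈ᴹ om ∧ ∀ x, extSupp p x ∨ extSupp q x →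
          (strictPart (W n)).mem x := by
        obtain ⟨⟨⟨σ, a, k, e, rfl, he, -⟩, -⟩, ⟨⟨τ, b, k', e', rfl, he', -⟩, -⟩, -⟩ := h
        obtain ⟨n, hn, h⟩ := hfin _ (hX.finSub_cup he.fin he'.fin)
        exact ⟨n, hn, fun x hx => h x (by simpa using hx)⟩
      have hlt : ∀ p q, (∀ x, extSupp p x ∨ extSupp q x → (strictPart (W n)).mem x) →
          (D.ext (strictPart (W om))).lt p q → (D.ext (strictPart (W n))).lt p q :=
        fun p q hs hl => ext_lt_of_supp hlin hl hs fun x y hx hy =>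
          hback n hn x y (hs x hx) (hs y hy)
      have hT : ∀ p, (∀ x, extSupp p x → (strictPart (W n)).mem x) →
          D.IsTerm (strictPart (W om)) p → D.IsTerm (strictPart (W n)) p := fun p hs hp =>
        ⟨ext_mem_of_supp hp.1 hs fun x y hx hy => hback n hn x y (hs x hx) (hs y hy),
          -- To compare `s` and `p` over `W n`, the support of `s` must lie in `W n` too. It does,
          -- because `s` was formed over an earlier stage `W m`.
          fun s hs' => hlt s p (fun x hx => hx.elim (fun hx => by
            obtain ⟨m, hm, h⟩ := (mW _ _).1 (hs s hs')
            exact Wmono n (isOrd_of_mem_om hn) m hm _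
              (ext_mem_supp ((hΦ' _ _ _).1 h).1.1 hx)) (hs x)) (hp.2 s hs')⟩
      exact (mW _ _).2 ⟨n, hn, (hΦ' _ _ _).2 ⟨hT p (fun x hx => hs x (Or.inl hx)) h.1,
        hT q (fun x hx => hs x (Or.inr hx)) h.2.1, h.2.2.imp id (hlt p q hs)⟩⟩
  refine ⟨strictPart (W om), hX, fun p => (hfix p p).trans ⟨fun h => h.1,
    fun h => ⟨h, h, Or.inl rfl⟩⟩, fun p q hp hq => ?_, fun P hP' ih => ?_⟩
  · constructor
    · exact fun h => ((hfix p q).1 h.2).2.2.resolve_left h.1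
    · intro h
      have hp' := ((hfix p p).1 hp).1
      refine ⟨?_, (hfix p q).2 ⟨hp', ((hfix q q).1 hq).1, Or.inr h⟩⟩
      rintro rfl
      exact (ext_linear hD hX).1 _ hp'.1 h
  -- Induction on stages: the support of a term in stage `n + 1` consists of terms in stage `n`.
  · have key : ∀ n, n ∈ᴹ om → ∀ p, p ∈ᴹ univ (W n) → pair p p ∈ᴹ W n → P p := by
      refine om_induction (P := fun n => ∀ p, p ∈ᴹ univ (W n) → pair p p ∈ᴹ W n → P p)
        (PR.all_mem (by fun_prop) (by fun_prop)) (fun p _ h => ?_) fun n hn ihn p _ h => ?_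
      · obtain ⟨m, hm, -⟩ := (mW _ _).1 h
        exact (not_mem_empty _ hm).elim
      · refine ih p ((mO _).2 ⟨_, succ_mem_om hn, h⟩) fun s hs => ?_
        rw [Wsucc n hn] at h
        have hs' := ext_mem_supp ((hΦ' _ _ _).1 h).1.1 hs
        exact ihn s (strictPart_mem_univ hs') hs'
    intro p hp
    obtain ⟨n, hn, h⟩ := (mO _).1 hp
    exact key n hn p (strictPart_mem_univ h) h

end Predil

/-! ### Projections -/

theorem exists_fst : ∃ G : M → M, PR M G ∧ ∀ x y, G (pair x y) = x := by
  obtain ⟨G, hG, h⟩ := PR.exists_sep (Γ := M) (u := fun p => univ p)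
    (P := fun p z => ∃ x y, p = pair x y ∧ z ∈ᴹ x) (by fun_prop)
    (PR.exists_pair (f := fun z : M × M => z.1) (P := fun z x _ => z.2 ∈ᴹ x) (by fun_prop)
      (by fun_prop))
  refine ⟨G, hG, fun x y => ext fun z => ?_⟩
  rw [h]
  constructor
  · rintro ⟨-, x', y', e, hz⟩
    rwa [(pair_inj.1 e).1]
  · exact fun hz => ⟨(univ_univ _).trans (left_mem_univ rfl) hz, x, y, rfl, hz⟩

theorem exists_snd : ∃ G : M → M, PR M G ∧ ∀ x y, G (pair x y) = y := by
  obtain ⟨G, hG, h⟩ := PR.exists_sep (Γ := M) (u := fun p => univ p)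
    (P := fun p z => ∃ x y, p = pair x y ∧ z ∈ᴹ y) (by fun_prop)
    (PR.exists_pair (f := fun z : M × M => z.1) (P := fun z _ y => z.2 ∈ᴹ y) (by fun_prop)
      (by fun_prop))
  refine ⟨G, hG, fun x y => ext fun z => ?_⟩
  rw [h]
  constructor
  · rintro ⟨-, x', y', e, hz⟩
    rwa [(pair_inj.1 e).2]
  · exact fun hz => ⟨(univ_univ _).trans (right_mem_univ rfl) hz, x, y, rfl, hz⟩

/-! ### Fixed points as initial segments of the term order -/

namespace Predil

/-- The recursive definition of the map from a fixed point into the term order. -/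
theorem exists_collapse_inverse (π : M) : ∃ k : M → M, PR M k ∧ ∀ β σ a, app π β = pair σ a →
    ∃ b, k β = pair σ b ∧ ∀ y, y ∈ᴹ b ↔ ∃ x, x ∈ᴹ a ∧ x ∈ᴹ β ∧ y = k x := by
  obtain ⟨G1, hG1, h1⟩ := exists_fst (M := M)
  obtain ⟨G2, hG2, h2⟩ := exists_snd (M := M)
  obtain ⟨I, hI, hI'⟩ := PR.exists_sep (Γ := M × M) (u := fun z => univ z.1)
    (P := fun z y => ∃ x, x ∈ᴹ z.2 ∧ pair x y ∈ᴹ z.1) (by fun_prop)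
    (PR.ex_mem (by fun_prop) (by fun_prop))
  -- `R β` is the singleton of the pair `⟨β, k β⟩`, so the union `w` of earlier values is the graph
  -- of `k` below `β`. The function `I` takes the image of the support under this graph.
  obtain ⟨R, hR, hR'⟩ := PR.recursion (Γ := M) (h := fun w β _ =>
    adj empty (pair β (pair (G1 (app π β)) (I (w, G2 (app π β)))))) (by fun_prop)
  obtain ⟨W, hW, hW'⟩ := PR.exists_bUnion (Γ := M) (u := fun n => n) (F := fun _ m => R m empty)
    (by fun_prop) (hR.comp (f := fun z : M × M => (z.2, empty)) (by fun_prop))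
  have hRW : ∀ β, R β empty =
      adj empty (pair β (pair (G1 (app π β)) (I (W β, G2 (app π β))))) := fun n => by
    obtain ⟨w, hw, e⟩ := hR' n empty
    rw [e, show w = W n from ATRSet.ext fun z => by rw [hw, hW']]
  refine ⟨fun β => pair (G1 (app π β)) (I (W β, G2 (app π β))), by fun_prop, fun β σ a e => ?_⟩
  have hWβ : ∀ x y, pair x y ∈ᴹ W β ↔ x ∈ᴹ β ∧ y = pair (G1 (app π x)) (I (W x, G2 (app π x))) := by
    intro x y
    simp only [hW', hRW, mem_adj, not_mem_empty, false_or, pair_inj]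
    constructor
    · rintro ⟨x', hx, rfl, rfl⟩
      exact ⟨hx, rfl⟩
    · rintro ⟨hx, rfl⟩
      exact ⟨x, hx, rfl, rfl⟩
  refine ⟨I (W β, G2 (app π β)), by simp only [e, h1], fun y => ?_⟩
  rw [hI', e, h2]
  simp only [hWβ]
  refine ⟨fun h => h.2, fun ⟨x, hx, hxy⟩ => ⟨?_, x, hx, hxy⟩⟩
  exact (univ_univ _).right ((univ_univ _).trans (mem_univ_self _) ((hWβ x y).2 hxy))

variable {D D' : Predil M} {X : ClassOrder M} {Ω π : M}

/-- A fixed point of an initial segment embeds onto an initial segment of the term order. -/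
theorem exists_embedding (hD : D.WPre) (hD' : D'.WPre) (hS : D'.Sub D) (hX : Small X)
    (hterm : ∀ p, X.mem p ↔ D.IsTerm X p)
    (hlt : ∀ p q, X.mem p → X.mem q → (X.lt p q ↔ (D.ext X).lt p q))
    (hind : ∀ P : M → Prop, PR M P → (∀ p, X.mem p → (∀ s, extSupp p s → P s) → P p) →
      ∀ p, X.mem p → P p) (hΩ : IsOrd Ω) (h : D'.IsPsiWith Ω π) :
    ∃ k : M → M, PR M k ∧ (∀ β, β ∈ᴹ Ω → X.mem (k β)) ∧
      (∀ α β, α ∈ᴹ Ω → β ∈ᴹ Ω → α ∈ᴹ β → X.lt (k α) (k β)) ∧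
      ∀ t₀, X.mem t₀ → (D'.ext X).mem t₀ → ∀ t, X.mem t → (t = t₀ ∨ X.lt t t₀) →
        ∃ β, β ∈ᴹ Ω ∧ t = k β := by
  obtain ⟨k, hk, hk'⟩ := exists_collapse_inverse π
  have ini := hS.ext hD' hD (ordOrder_small hΩ)
  have iniX := hS.ext hD' hD hX
  have hXl := ext_linear hD hX
  -- the shape of the values of `k`
  have shape : ∀ β, β ∈ᴹ Ω → ∃ σ a b, app π β = pair σ a ∧ k β = pair σ b ∧
      (∀ x, x ∈ᴹ a → x ∈ᴹ β) ∧ ∀ y, y ∈ᴹ b ↔ ∃ x, x ∈ᴹ a ∧ y = k x := by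
    intro β hβ
    obtain ⟨σ, a, n, e, ha, he, hσ⟩ := h.mem β hβ
    obtain ⟨b, hb, hb'⟩ := hk' β σ a ha
    have hs : ∀ x, x ∈ᴹ a → x ∈ᴹ β := fun x hx => h.supp_mem hβ (by rw [ha]; exact extSupp_pair.2 hx)
    refine ⟨σ, a, b, ha, hb, hs, fun y => ?_⟩
    rw [hb']
    exact exists_congr fun x => ⟨fun h => ⟨h.1, h.2.2⟩, fun h => ⟨h.1, hs x h.1, h.2⟩⟩
  -- By induction hypothesis `k` is an embedding of `β` into `X`. The values of `π` up to `β` have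
  -- support below `β`, so this embedding carries their order relations to `D(X)`. As the support of
  -- `k β` consists of values `k x` with `x < β`, monotonicity also shows that `k β` is a term.
  have hQ : ∀ β, β ∈ᴹ Ω → X.mem (k β) ∧ ∀ α, α ∈ᴹ β → X.lt (k α) (k β) := by
    refine mem_induction (PR.and (hX.pr_mem.comp hk) (PR.all_mem (by fun_prop)
      (hX.pr_lt.comp (f := fun z : M × M => (k z.2, k z.1)) (by fun_prop)))) fun β hβ ih => ?_
    have hβs := hΩ.1 β hβ
    have m1 : ∀ α, α ∈ᴹ β → X.mem (k α) := fun α hα => (ih α hα (hβs α hα)).1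
    have m2 : ∀ α α', α ∈ᴹ β → α' ∈ᴹ β → α ∈ᴹ α' → X.lt (k α) (k α') := fun α α' _ hα' hα =>
      (ih α' hα' (hβs α' hα')).2 α hα
    obtain ⟨σ, a, b, ha, hb, has, hb'⟩ := shape β hβ
    have e1 : (D.ext X).mem (k β) := by
      have := ord_mem (β := β) (ini.mem (h.mem β hβ)) fun x hx => h.supp_mem hβ hx
      rw [ha] at this
      rw [hb]
      exact ext_mem_image hk this (fun x hx => m1 x (has x hx))
        (fun x y hx hy => m2 x y (has x hx) (has y hy)) hb'
    have e2 : ∀ α, α ∈ᴹ β → (D.ext X).lt (k α) (k β) := by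
      intro α hα
      obtain ⟨σ₁, a₁, b₁, ha₁, hb₁, has₁, hb₁'⟩ := shape α (hβs α hα)
      have has₁ : ∀ x, x ∈ᴹ a₁ → x ∈ᴹ β := fun x hx => (hΩ.mem hβ).1 α hα x (has₁ x hx)
      have := (ini.lt_iff (h.mem α (hβs α hα)) (h.mem β hβ)).1 (h.lt α β (hβs α hα) hβ hα)
      have := ord_lt (β := β) hΩ this (by rw [ha₁]; simpa using has₁) (by rw [ha]; simpa using has)
      rw [ha, ha₁] at this
      rw [hb, hb₁]
      have hs : ∀ x, x ∈ᴹ a₁ ∨ x ∈ᴹ a → x ∈ᴹ β := fun x hx => hx.elim (has₁ x) (has x)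
      exact ext_lt_image (ordOrder_linear (hΩ.mem hβ)) hk this (fun x hx => m1 x (hs x hx))
        (fun x y hx hy => m2 x y (hs x hx) (hs y hy)) hb₁' hb'
    have hmem : X.mem (k β) := by
      rw [hterm]
      refine ⟨e1, fun s hs => ?_⟩
      rw [hb, extSupp_pair, hb'] at hs
      obtain ⟨x, hx, rfl⟩ := hs
      exact e2 x (has x hx)
    exact ⟨hmem, fun α hα => (hlt _ _ (m1 α hα) hmem).2 (e2 α hα)⟩
  have hkm : ∀ β, β ∈ᴹ Ω → X.mem (k β) := fun β hβ => (hQ β hβ).1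
  have hkl : ∀ α β, α ∈ᴹ Ω → β ∈ᴹ Ω → α ∈ᴹ β → X.lt (k α) (k β) := fun α β _ hβ hα =>
    (hQ β hβ).2 α hα
  have hkinj : ∀ α β, α ∈ᴹ Ω → β ∈ᴹ Ω → k α = k β → α = β := by
    intro α β hα hβ e
    rcases (hΩ.mem hα).trichotomy (hΩ.mem hβ) with h1 | h1 | h1
    · have := hkl α β hα hβ h1
      rw [e] at this
      exact absurd this (hX.linear.1 _ (hkm β hβ))
    · exact h1
    · have := hkl β α hβ hα h1
      rw [e] at this
      exact absurd this (hX.linear.1 _ (hkm β hβ))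
  refine ⟨k, hk, hkm, hkl, fun t₀ ht₀ ht₀' => ?_⟩
  -- Induction on terms: the support of `t` lies below `t`, hence below `t₀`, and so in the range of
  -- `k`. Pulling it back along `k` turns `t` into an element of `D'(Ω)`, and the fixed point
  -- property has to be verified for this element.
  refine hind (fun t => (t = t₀ ∨ X.lt t t₀) → ∃ β, β ∈ᴹ Ω ∧ t = k β) (PR.imp (PR.or (by fun_prop)
    (hX.pr_lt.comp (f := fun t : M => (t, t₀)) (by fun_prop))) (PR.ex_mem (by fun_prop)
    (by fun_prop))) fun t ht ih hle => ?_
  have htt := (hterm t).1 ht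
  have htD' : (D'.ext X).mem t := by
    rcases hle with rfl | hle
    · exact ht₀'
    · exact iniX.down htt.1 ht₀' ((hlt t t₀ ht ht₀).1 hle)
  obtain ⟨σ, a, n, e, rfl, he, hσ⟩ := htD'
  have htD' : (D'.ext X).mem (pair σ a) := ⟨σ, a, n, e, rfl, he, hσ⟩
  have hsub : ∀ s, s ∈ᴹ a → ∃ β, β ∈ᴹ Ω ∧ s = k β := fun s hs => by
    refine ih s (extSupp_pair.2 hs) (Or.inr ?_)
    have h1 := (hlt s _ (he.mem hs) ht).2 (htt.2 s (extSupp_pair.2 hs))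
    rcases hle with rfl | hle
    · exact h1
    · exact hX.linear.2.1 _ _ _ (he.mem hs) ht ht₀ h1 hle
  obtain ⟨j, hj, hj'⟩ := exists_fun_of_rel a Ω (R := fun s β => β ∈ᴹ Ω ∧ s = k β) (by fun_prop)
    (fun s hs => by
      obtain ⟨β, hβ, e⟩ := hsub s hs
      exact ⟨β, hβ, hβ, e⟩)
    fun s β β' _ h1 h2 => hkinj β β' h1.1 h2.1 (h1.2.symm.trans h2.2)
  obtain ⟨a', ha'⟩ := exists_image a (F := fun s => app j s) (by fun_prop)
  have ha'Ω : ∀ α, α ∈ᴹ a' → α ∈ᴹ Ω := fun α hα => by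
    obtain ⟨s, hs, rfl⟩ := (ha' α).1 hα
    exact (hj' s hs).1
  have haa' : ∀ y, y ∈ᴹ a ↔ ∃ x, x ∈ᴹ a' ∧ y = k x := fun y => by
    constructor
    · exact fun hy => ⟨app j y, (ha' _).2 ⟨y, hy, rfl⟩, (hj' y hy).2.2⟩
    · rintro ⟨x, hx, rfl⟩
      obtain ⟨s, hs, rfl⟩ := (ha' x).1 hx
      rw [← (hj' s hs).2.2]
      exact hs
  have hτ : (D'.ext (ordOrder Ω)).mem (pair σ a') := by
    refine ext_mem_image (H := fun s => app j s) (by fun_prop) htD' (fun x hx => (hj' x hx).1)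
      (fun x y hx hy hxy => ?_) ha'
    obtain ⟨hx', -, ex⟩ := hj' x hx
    obtain ⟨hy', -, ey⟩ := hj' y hy
    rcases (hΩ.mem hx').trichotomy (hΩ.mem hy') with h1 | h1 | h1
    · exact h1
    · rw [ex, ey, h1] at hxy
      exact absurd hxy (hX.linear.1 _ (hkm _ hy'))
    · have h2 := hkl _ _ hy' hx' h1
      rw [← ex, ← ey] at h2
      exact absurd (hX.linear.2.1 _ _ _ (he.mem hx) (he.mem hy) (he.mem hx) hxy h2)
        (hX.linear.1 _ (he.mem hx))
  have hback : ∀ α, α ∈ᴹ Ω → (D'.ext (ordOrder Ω)).lt (pair σ a') (app π α) →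
      (D.ext X).lt (pair σ a) (k α) := by
    intro α hα hl
    have := (ini.lt_iff hτ (h.mem α hα)).1 hl
    obtain ⟨σ₁, a₁, b₁, ha₁, hb₁, has₁, hb₁'⟩ := shape α hα
    rw [ha₁] at this
    rw [hb₁]
    have hs : ∀ x, x ∈ᴹ a' ∨ x ∈ᴹ a₁ → x ∈ᴹ Ω := fun x hx =>
      hx.elim (ha'Ω x) fun hx => hΩ.1 α hα x (has₁ x hx)
    exact ext_lt_image (ordOrder_linear hΩ) hk this (fun x hx => hkm x (hs x hx))
      (fun x y hx hy => hkl x y (hs x hx) (hs y hy)) haa' hb₁'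
  have hkπ : ∀ α, α ∈ᴹ Ω → app π α = pair σ a' → pair σ a = k α := by
    intro α hα e
    obtain ⟨σ₁, a₁, b₁, ha₁, hb₁, has₁, hb₁'⟩ := shape α hα
    obtain ⟨rfl, rfl⟩ := pair_inj.1 (ha₁.symm.trans e)
    rw [hb₁, show a = b₁ from ATRSet.ext fun y => by rw [haa', hb₁']]
  -- If `π α` were not below the pulled back element for some `α` in its support, pushing forward
  -- along `k` would place `t` at or below the element `k α` of its own support, while `t` is a
  -- term.
  obtain ⟨β, hβ, e⟩ := h.surj _ hτ fun α hα => by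
    rw [extSupp_pair] at hα
    have hαΩ := ha'Ω α hα
    have hαa : k α ∈ᴹ a := (haa' _).2 ⟨α, hα, rfl⟩
    have hl := htt.2 _ (extSupp_pair.2 hαa)
    have hm := ((hterm _).1 (hkm α hαΩ)).1
    rcases (ext_linear hD' (ordOrder_small hΩ)).2.2 _ _ (h.mem α hαΩ) hτ with h1 | h1 | h1
    · exact h1
    · rw [hkπ α hαΩ h1] at hl
      exact absurd hl (hXl.1 _ hm)
    · exact absurd (hXl.2.1 _ _ _ hm htt.1 hm hl (hback α hαΩ h1)) (hXl.1 _ hm)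
  exact ⟨β, hβ, hkπ β hβ e⟩

/-- The term order is well-founded if the predilator is a union of initial segments with fixed
points. -/
theorem terms_wf {E : M → Predil M} {l : M} (hD : D.WPre) (hE : ∀ μ, μ ∈ᴹ l → (E μ).WPre)
    (hS : ∀ μ, μ ∈ᴹ l → (E μ).Sub D) (hX : Small X)
    (hterm : ∀ p, X.mem p ↔ D.IsTerm X p)
    (hlt : ∀ p q, X.mem p → X.mem q → (X.lt p q ↔ (D.ext X).lt p q))
    (hind : ∀ P : M → Prop, PR M P → (∀ p, X.mem p → (∀ s, extSupp p s → P s) → P p) →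
      ∀ p, X.mem p → P p)
    (hU : ∀ p, (D.ext X).mem p → ∃ μ, μ ∈ᴹ l ∧ ((E μ).ext X).mem p)
    (hex : ∀ μ, μ ∈ᴹ l → ∃ β, (E μ).IsPsiFixedPoint β) : X.IsWF := by
  rintro s ⟨t₀, ht₀⟩ hs
  have hm₀ := hs t₀ ht₀
  obtain ⟨μ, hμ, hmμ⟩ := hU t₀ ((hterm t₀).1 hm₀).1
  obtain ⟨Ω, hΩ⟩ := hex μ hμ
  obtain ⟨hΩ, π, hπ⟩ := isPsiFixedPoint_iff.1 hΩ
  obtain ⟨k, hk, hkm, hkl, hks⟩ := exists_embedding hD (hE μ hμ) (hS μ hμ) hX hterm hlt hind hΩ hπ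
  obtain ⟨β₀, hβ₀, rfl⟩ := hks t₀ hm₀ hmμ t₀ hm₀ (Or.inl rfl)
  -- All elements of `X` up to `t₀` are in the range of `k`, so a least preimage in the ordinal `Ω`
  -- yields a minimal element of `s`.
  obtain ⟨β, hβ, hβs, hmin⟩ := exists_minimal (A := Ω) (P := fun β => k β ∈ᴹ s) (by fun_prop)
    ⟨β₀, hβ₀, ht₀⟩
  have hle : k β = k β₀ ∨ X.lt (k β) (k β₀) := by
    rcases (hΩ.mem hβ).trichotomy (hΩ.mem hβ₀) with h1 | rfl | h1
    · exact Or.inr (hkl _ _ hβ hβ₀ h1)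
    · exact Or.inl rfl
    · exact absurd ht₀ (hmin β₀ h1 hβ₀)
  refine ⟨k β, hβs, fun x hx hxl => ?_⟩
  have hxm := hs x hx
  obtain ⟨α, hα, rfl⟩ := hks (k β₀) hm₀ hmμ x hxm (Or.inr (by
    rcases hle with h1 | h1
    · rwa [← h1]
    · exact hX.linear.2.1 _ _ _ hxm (hkm β hβ) hm₀ hxl h1))
  rcases (hΩ.mem hα).trichotomy (hΩ.mem hβ) with h1 | rfl | h1
  · exact hmin α h1 hα hx
  · exact hX.linear.1 _ hxm hxl
  · exact hX.linear.1 _ hxm (hX.linear.2.1 _ _ _ hxm (hkm β hβ) hxm hxl (hkl _ _ hβ hα h1))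

end Predil

/-! ### From the term order to a fixed point -/

/-- Axiom beta yields the order type of a well order. -/
theorem exists_collapse {X : ClassOrder M} (hX : Small X) (hwf : X.IsWF) : ∃ Ω f : M, IsOrd Ω ∧
    (∀ y, y ∈ᴹ Ω ↔ ∃ x, X.mem x ∧ y = app f x) ∧
    ∀ x y, X.mem x → X.mem y → (app f x ∈ᴹ app f y ↔ X.lt x y) := by
  have hpm := hX.pr_mem
  have hpl := hX.pr_lt
  obtain ⟨A₀, hA₀⟩ := hX.bdd
  obtain ⟨A, hA⟩ := sep A₀ hpm
  replace hA : ∀ z, z ∈ᴹ A ↔ X.mem z := fun z => (hA z).trans ⟨And.right, fun h => ⟨hA₀ z h, h⟩⟩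
  -- The set `A` itself is placed on top of all its elements. This puts every element of `A` into
  -- the field of `r`, on which axiom beta provides values, even if `X` has only one element.
  obtain ⟨r, hr⟩ := sep (univ A) (P := fun p => ∃ x y, p = pair x y ∧
      x ∈ᴹ A ∧ ((y ∈ᴹ A ∧ X.lt x y) ∨ y = A))
    (PR.exists_pair (f := fun p : M => p) (by fun_prop) (PR.and (by fun_prop) (PR.or (PR.and
      (by fun_prop) (hpl.comp (f := fun z : (M × M) × M => (z.1.2, z.2)) (by fun_prop)))
      (by fun_prop))))
  have hU := univ_univ A
  have hAU := mem_univ_self A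
  have hr' : ∀ x y, pair x y ∈ᴹ r ↔ x ∈ᴹ A ∧ ((y ∈ᴹ A ∧ X.lt x y) ∨ y = A) := by
    intro x y
    rw [hr]
    constructor
    · rintro ⟨-, x', y', e, h⟩
      obtain ⟨rfl, rfl⟩ := pair_inj.1 e
      exact h
    · intro h
      refine ⟨hU.pair (hU.trans hAU h.1) ?_, x, y, rfl, h⟩
      rcases h.2 with h | rfl
      · exact hU.trans hAU h.1
      · exact hAU
  have hrA : ∀ x y, y ∈ᴹ A → (pair x y ∈ᴹ r ↔ x ∈ᴹ A ∧ X.lt x y) := by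
    intro x y hy
    have : y ≠ A := by
      rintro rfl
      exact not_mem_self _ hy
    simp [hr', hy, this]
  have hrw : WFRel r := by
    rintro s ⟨y₀, hy₀⟩
    by_cases hs : ∃ x, x ∈ᴹ s ∧ x ∈ᴹ A
    · obtain ⟨x₀, h1, h2⟩ := hs
      obtain ⟨s', hs'⟩ := sep s (P := fun x => x ∈ᴹ A) (by fun_prop)
      obtain ⟨y, hy, hmin⟩ := hwf s' ⟨x₀, (hs' _).2 ⟨h1, h2⟩⟩ fun x hx => (hA x).1 ((hs' x).1 hx).2
      obtain ⟨hy, hyA⟩ := (hs' y).1 hy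
      refine ⟨y, hy, fun x hx hxy => ?_⟩
      obtain ⟨h3, h4⟩ := (hrA x y hyA).1 hxy
      exact hmin x ((hs' x).2 ⟨hx, h3⟩) h4
    · exact ⟨y₀, hy₀, fun x hx hxy => hs ⟨x, hx, ((hr' _ _).1 hxy).1⟩⟩
  obtain ⟨A', f, hA', -, hf⟩ := hM.out.beta r hrw
  have hf' : ∀ y, y ∈ᴹ A → ∀ z, z ∈ᴹ app f y ↔ ∃ x, x ∈ᴹ A ∧ X.lt x y ∧ z = app f x := by
    intro y hy z
    rw [hf y ((hA' y).2 ⟨A, Or.inl ((hr' _ _).2 ⟨hy, Or.inr rfl⟩)⟩)]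
    simp only [hrA _ y hy, and_assoc]
  obtain ⟨Ω, hΩ⟩ := exists_image A (F := fun x => app f x) (by fun_prop)
  have hlt : ∀ x y, x ∈ᴹ A → y ∈ᴹ A → X.lt x y → app f x ∈ᴹ app f y := fun x y hx hy h =>
    (hf' y hy _).2 ⟨x, hx, h, rfl⟩
  refine ⟨Ω, f, ⟨fun y hy z hz => ?_, fun y hy z hz u hu => ?_⟩, fun y => ?_, fun x y hx hy => ?_⟩
  · obtain ⟨x, hx, rfl⟩ := (hΩ _).1 hy
    obtain ⟨w, hw, -, rfl⟩ := (hf' x hx z).1 hz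
    exact (hΩ _).2 ⟨w, hw, rfl⟩
  · obtain ⟨x, hx, rfl⟩ := (hΩ _).1 hy
    obtain ⟨w, hw, hwx, rfl⟩ := (hf' x hx z).1 hz
    obtain ⟨t, ht, htw, rfl⟩ := (hf' w hw u).1 hu
    exact hlt t x ht hx (hX.linear.2.1 t w x ((hA _).1 ht) ((hA _).1 hw) ((hA _).1 hx) htw hwx)
  · simp only [hΩ, hA]
  · rw [← hA] at hx hy
    refine ⟨fun h => ?_, hlt x y hx hy⟩
    rcases hX.linear.2.2 x y ((hA _).1 hx) ((hA _).1 hy) with h1 | rfl | h1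
    · exact h1
    · exact absurd h (not_mem_self _)
    · exact absurd h (not_mem_mem (hlt y x hy hx h1))

namespace Predil

/-- The order type of a well-founded term order is a `ψ`-fixed point. -/
theorem exists_isPsiFixedPoint_of_terms {D : Predil M} {X : ClassOrder M} (hD : D.WPre)
    (hX : Small X) (hwf : X.IsWF) (hterm : ∀ p, X.mem p ↔ D.IsTerm X p)
    (hlt : ∀ p q, X.mem p → X.mem q → (X.lt p q ↔ (D.ext X).lt p q)) :
    ∃ Ω, D.IsPsiFixedPoint Ω := by
  obtain ⟨Ω, f, hΩ, hfΩ, hfl⟩ := exists_collapse hX hwf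
  have hf : ∀ x, X.mem x → app f x ∈ᴹ Ω := fun x hx => (hfΩ _).2 ⟨x, hx, rfl⟩
  have hinj : ∀ x y, X.mem x → X.mem y → app f x = app f y → x = y := by
    intro x y hx hy e
    rcases hX.linear.2.2 x y hx hy with h1 | h1 | h1
    · rw [← hfl x y hx hy, e] at h1
      exact absurd h1 (not_mem_self _)
    · exact h1
    · rw [← hfl y x hy hx, e] at h1
      exact absurd h1 (not_mem_self _)
  have hpm := hX.pr_mem
  obtain ⟨A, hA⟩ := hX.bdd
  obtain ⟨g, -, hg⟩ := exists_fun_of_rel Ω A (R := fun α x => X.mem x ∧ α = app f x)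
    (PR.and (hpm.comp (by fun_prop)) (by fun_prop))
    (fun α hα => by
      obtain ⟨x, hx, e⟩ := (hfΩ α).1 hα
      exact ⟨x, hA x hx, hx, e⟩)
    fun α x y _ h1 h2 => hinj x y h1.1 h2.1 (h1.2.symm.trans h2.2)
  have hgm : ∀ α, α ∈ᴹ Ω → X.mem (app g α) := fun α hα => (hg α hα).2.1
  have hfg : ∀ α, α ∈ᴹ Ω → app f (app g α) = α := fun α hα => (hg α hα).2.2.symm
  have hgf : ∀ x, X.mem x → app g (app f x) = x := fun x hx =>
    hinj _ _ (hgm _ (hf x hx)) hx (hfg _ (hf x hx))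
  have hgl : ∀ α β, α ∈ᴹ Ω → β ∈ᴹ Ω → (X.lt (app g α) (app g β) ↔ α ∈ᴹ β) := fun α β hα hβ => by
    rw [← hfl _ _ (hgm α hα) (hgm β hβ), hfg α hα, hfg β hβ]
  obtain ⟨G1, hG1, h1⟩ := exists_fst (M := M)
  obtain ⟨G2, hG2, h2⟩ := exists_snd (M := M)
  -- `π` sends `α` to the term `g α` with its support transported to `Ω` by the collapse `f`. It is
  -- the identity of terms, read through the isomorphism.
  obtain ⟨I, hI, hI'⟩ := PR.exists_bUnion (Γ := M) (u := fun t => G2 (app g t))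
    (F := fun _ x => adj empty (app f x)) (by fun_prop) (by fun_prop)
  obtain ⟨π, hπ, hπ'⟩ := exists_fun Ω (F := fun α => pair (G1 (app g α)) (I α)) (by fun_prop)
  have hval : ∀ α, α ∈ᴹ Ω → ∃ σ a b, app g α = pair σ a ∧ app π α = pair σ b ∧
      (∀ x, x ∈ᴹ a → X.mem x) ∧ ∀ y, y ∈ᴹ b ↔ ∃ x, x ∈ᴹ a ∧ y = app f x := by
    intro α hα
    obtain ⟨σ, a, n, e, ha, he, hσ⟩ := ((hterm _).1 (hgm α hα)).1
    refine ⟨σ, a, I α, ha, ?_, fun x hx => he.mem hx, fun y => ?_⟩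
    · rw [hπ' α hα, ha, h1]
    · simp only [hI', ha, h2, mem_adj, not_mem_empty, false_or]
  have hmono : ∀ x y, X.mem x → X.mem y → X.lt x y → (ordOrder Ω).lt (app f x) (app f y) :=
    fun x y hx hy => (hfl x y hx hy).2
  have hπlt : ∀ α σ a b, α ∈ᴹ Ω → (∀ x, x ∈ᴹ a → X.mem x) →
      (∀ y, y ∈ᴹ b ↔ ∃ x, x ∈ᴹ a ∧ y = app f x) → (D.ext X).lt (app g α) (pair σ a) →
      (D.ext (ordOrder Ω)).lt (app π α) (pair σ b) := by
    intro α σ a b hα ha hb h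
    obtain ⟨σ₁, a₁, b₁, e1, e2, ha₁, hb₁⟩ := hval α hα
    rw [e1] at h
    rw [e2]
    have hs : ∀ x, x ∈ᴹ a₁ ∨ x ∈ᴹ a → X.mem x := fun x hx => hx.elim (ha₁ x) (ha x)
    exact ext_lt_image (H := fun x => app f x) hX.linear (by fun_prop) h
      (fun x hx => hf x (hs x hx)) (fun x y hx hy => hmono x y (hs x hx) (hs y hy)) hb₁ hb
  refine ⟨Ω, isPsiFixedPoint_iff.2 ⟨hΩ, π, hπ, fun α hα => ?_, fun α β hα hβ hαβ => ?_,
    fun α β hα hβ hs => ?_, fun τ hτ hτs => ?_⟩⟩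
  · obtain ⟨σ, a, b, e1, e2, ha, hb⟩ := hval α hα
    have h := ((hterm _).1 (hgm α hα)).1
    rw [e1] at h
    rw [e2]
    exact ext_mem_image (H := fun x => app f x) (by fun_prop) h (fun x hx => hf x (ha x hx))
      (fun x y hx hy => hmono x y (ha x hx) (ha y hy)) hb
  · obtain ⟨σ, a, b, e1, e2, ha, hb⟩ := hval β hβ
    have h := (hlt _ _ (hgm α hα) (hgm β hβ)).1 ((hgl α β hα hβ).2 hαβ)
    rw [e1] at h
    rw [e2]
    exact hπlt α σ a b hα ha hb h
  · obtain ⟨σ, a, b, e1, e2, ha, hb⟩ := hval β hβ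
    rw [e2, extSupp_pair, hb] at hs
    obtain ⟨x, hx, rfl⟩ := hs
    have h := ((hterm _).1 (hgm β hβ)).2 x (by rw [e1]; exact extSupp_pair.2 hx)
    rw [← hlt _ _ (ha x hx) (hgm β hβ), ← hfl _ _ (ha x hx) (hgm β hβ), hfg β hβ] at h
    exact h
  · obtain ⟨σ, b, n, e, rfl, he, hσ⟩ := hτ
    -- The given element of `D(Ω)` is pulled back to `D(X)` along the inverse `g` of the collapse.
    -- If the result is a term, its collapse is the required preimage.
    obtain ⟨a, ha⟩ := exists_image b (F := fun α => app g α) (by fun_prop)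
    have haX : ∀ x, x ∈ᴹ a → X.mem x := fun x hx => by
      obtain ⟨α, hα, rfl⟩ := (ha x).1 hx
      exact hgm α (he.mem hα)
    have hba : ∀ y, y ∈ᴹ b ↔ ∃ x, x ∈ᴹ a ∧ y = app f x := fun y => by
      constructor
      · exact fun hy => ⟨app g y, (ha _).2 ⟨y, hy, rfl⟩, (hfg y (he.mem hy)).symm⟩
      · rintro ⟨x, hx, rfl⟩
        obtain ⟨α, hα, rfl⟩ := (ha x).1 hx
        rwa [hfg α (he.mem hα)]
    have hmem : (D.ext X).mem (pair σ a) :=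
      ext_mem_image (H := fun x => app g x) (by fun_prop) ⟨σ, b, n, e, rfl, he, hσ⟩
        (fun x hx => hgm x (he.mem hx))
        (fun x y hx hy h => (hgl x y (he.mem hx) (he.mem hy)).2 h) ha
    have hXl := ext_linear hD hX
    have hΩl := ext_linear hD (ordOrder_small hΩ)
    have hτ : (D.ext (ordOrder Ω)).mem (pair σ b) := ⟨σ, b, n, e, rfl, he, hσ⟩
    have hπeq : ∀ α, α ∈ᴹ Ω → app g α = pair σ a → app π α = pair σ b := by
      intro α hα h
      obtain ⟨σ₁, a₁, b₁, e1, e2, ha₁, hb₁⟩ := hval α hα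
      obtain ⟨rfl, rfl⟩ := pair_inj.1 (e1.symm.trans h)
      rw [e2, show b₁ = b from ATRSet.ext fun y => by rw [hba, hb₁]]
    -- The assumption on `π α` lives in `D(Ω)`. By linearity of `D(X)`, a failure of the term
    -- condition would be carried forward by `f` and contradict it.
    have hterm' : X.mem (pair σ a) := by
      refine (hterm _).2 ⟨hmem, fun s hs => ?_⟩
      obtain ⟨α, hα, rfl⟩ := (ha s).1 (extSupp_pair.1 hs)
      have hαΩ := he.mem hα
      have hl := hτs α (extSupp_pair.2 hα)
      have hm := ((hterm _).1 (hgm α hαΩ)).1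
      rcases hXl.2.2 _ _ hm hmem with h3 | h3 | h3
      · exact h3
      · rw [hπeq α hαΩ h3] at hl
        exact absurd hl (hΩl.1 _ hτ)
      · exfalso
        obtain ⟨σ₁, a₁, b₁, e1, e2, ha₁, hb₁⟩ := hval α hαΩ
        rw [e1] at h3
        rw [e2] at hl
        have hs : ∀ x, x ∈ᴹ a ∨ x ∈ᴹ a₁ → X.mem x := fun x hx => hx.elim (haX x) (ha₁ x)
        have h4 : (D.ext (ordOrder Ω)).lt (pair σ b) (pair σ₁ b₁) :=
          ext_lt_image (H := fun x => app f x) hX.linear (by fun_prop) h3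
            (fun x hx => hf x (hs x hx)) (fun x y hx hy => hmono x y (hs x hx) (hs y hy)) hba hb₁
        have hm₁ : (D.ext (ordOrder Ω)).mem (pair σ₁ b₁) := by
          rw [e1] at hm
          exact ext_mem_image (H := fun x => app f x) (by fun_prop) hm
            (fun x hx => hf x (ha₁ x hx)) (fun x y hx hy => hmono x y (ha₁ x hx) (ha₁ y hy)) hb₁
        exact hΩl.1 _ hτ (hΩl.2.1 _ _ _ hτ hm₁ hτ h4 hl)
    exact ⟨app f (pair σ a), hf _ hterm', hπeq _ (hf _ hterm') (hgf _ hterm')⟩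

/-! ### Sums of limit length -/

variable {D : M → Predil M} {l γ : M}

theorem WPre.shift_sum (hl : IsOrd l) (hγ : IsOrd γ) (hD : ∀ α, α ∈ᴹ l → (D α).WPre) :
    ((Predil.sum (ordOrder l) D).shift γ).WPre :=
  (WPre.sum (ordOrder_linear hl) hD).shift hγ

theorem Sub.shift_sum {μ : M} (hl : IsOrd l) (hγ : IsOrd γ) (hD : ∀ α, α ∈ᴹ l → (D α).WPre)
    (hμ : μ ∈ᴹ l) :
    ((Predil.sum (ordOrder μ) D).shift γ).Sub ((Predil.sum (ordOrder l) D).shift γ) :=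
  (Sub.sum hl hμ).shift
    (WPre.sum (ordOrder_linear (hl.mem hμ)) fun α hα => hD α (hl.1 μ hμ α hα))
    (WPre.sum (ordOrder_linear hl) hD) hγ

/-- A sum of limit length has a fixed point if all its partial sums do. -/
theorem exists_isPsiFixedPoint_shift_sum (hl : IsLimitOrd l) (hγ : IsOrd γ)
    (hD : ∀ α, α ∈ᴹ l → (D α).WPre) (hP : (sum (ordOrder l) D).IsPR)
    (hex : ∀ μ, μ ∈ᴹ l → ∃ β, ((sum (ordOrder μ) D).shift γ).IsPsiFixedPoint β) :
    ∃ Ω, ((sum (ordOrder l) D).shift γ).IsPsiFixedPoint Ω := by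
  have hW := WPre.shift_sum hl.1 hγ hD
  -- The term order is constructed for the restricted shift, whose relations are primitive recursive
  -- and bounded. The partial sums are still initial segments of it, and its fixed point is one of
  -- the original shift.
  obtain ⟨B, hB⟩ := exists_bound_shift hP γ
  have h1 := restrict_sub _ hW hB
  have h2 := sub_restrict _ hW hB
  have hW' := hW.restrict hB
  obtain ⟨X, hX, hterm, hlt, hind⟩ := exists_terms hW' (hP.shift_restrict hB)
  have hwf : X.IsWF := terms_wf (E := fun μ => (sum (ordOrder μ) D).shift γ) hW'
    (fun μ hμ => WPre.shift_sum (hl.1.mem hμ) hγ fun α hα => hD α (hl.1.1 μ hμ α hα))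
    (fun μ hμ => (Sub.shift_sum hl.1 hγ hD hμ).trans h2) hX hterm hlt hind
    (fun p hp => exists_mem_shift_sum hl (h1.ext_mem hp)) hex
  obtain ⟨Ω, hΩ⟩ := exists_isPsiFixedPoint_of_terms hW' hX hwf hterm hlt
  obtain ⟨hΩ, π, hπ⟩ := isPsiFixedPoint_iff.1 hΩ
  exact ⟨Ω, isPsiFixedPoint_iff.2 ⟨hΩ, π, hπ.of_agree hW hW' h1 h2 hΩ⟩⟩

end Predil

end

end ATRSet

theorem mainTheorem9 {M : Type*} [ATRSet.SetStructure M] (hM : ATRSet.ModelsATR0Set M)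
    (lam γ D : M) (hlam : ATRSet.IsLimitOrd lam) (hγ : ATRSet.IsOrd γ)
    (hD : ATRSet.IsFunOn D lam)
    (hdil : ∀ α, α ∈ᴹ lam → ATRSet.Predil.IsDilatorCode (ATRSet.app D α))
    (hex : ∀ μ, μ ∈ᴹ lam → ∃ β, (ATRSet.Predil.shiftedSum D μ γ).IsPsiFixedPoint β) :
    ∃ Ω : M,
      ATRSet.IsOrdSup
        (fun β => ∃ μ, μ ∈ᴹ lam ∧ (ATRSet.Predil.shiftedSum D μ γ).IsPsiFixedPoint β) Ω ∧
      (ATRSet.Predil.shiftedSum D lam γ).IsPsiFixedPoint Ω ∧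
      ∀ Ω', (ATRSet.Predil.shiftedSum D lam γ).IsPsiFixedPoint Ω' → Ω' = Ω := by
  have : Fact (ATRSet.ModelsATR0Set M) := ⟨hM⟩
  have hW : ∀ α, α ∈ᴹ lam → (ATRSet.Predil.ofCode (ATRSet.app D α)).WPre := fun α hα =>
    (hdil α hα).2.1.wPre
  have hl := hlam.1
  obtain ⟨Ω, hΩ⟩ := ATRSet.Predil.exists_isPsiFixedPoint_shift_sum hlam hγ hW
    (ATRSet.Predil.isPR_sum D lam) hex
  exact ⟨Ω, ATRSet.Predil.IsPsiFixedPoint.isOrdSup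
    (E := fun μ => ATRSet.Predil.shiftedSum D μ γ) (ATRSet.Predil.WPre.shift_sum hl hγ hW)
    (fun μ hμ => ATRSet.Predil.WPre.shift_sum (hl.mem hμ) hγ fun α hα => hW α (hl.1 μ hμ α hα))
    (fun μ hμ => ATRSet.Predil.Sub.shift_sum hl hγ hW hμ)
    (fun p hp => ATRSet.Predil.exists_mem_shift_sum hlam hp) hex hΩ, hΩ,
    fun Ω' hΩ' => ATRSet.Predil.IsPsiFixedPoint.unique
      (ATRSet.Predil.WPre.shift_sum hl hγ hW) hΩ' hΩ⟩
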